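/- Let $p>1$ be an odd integer, let $q\in\mathbb C$ be a primitive $p$-th root of unity, and fix the principal branch $q^{\lambda}=e^{\lambda\log q}$ for $\lambda\in\mathbb C$. Put $[\lambda]=\dfrac{q^{\lambda}-q^{-\lambda}}{q-q^{-1}}$. Let $U_q(\mathfrak{sl}_2)$ be the $\mathbb C$-algebra with generators $e,f,K^{\pm1}$ and relations $KK^{-1}=K^{-1}K=1$, $KeK^{-1}=q^2e$, $KfK^{-1}=q^{-2}f$, $[e,f]=\frac{K-K^{-1}}{q-q^{-1}}$. Let $U_q(\widehat{\mathfrak{sl}}_2)$ be the $\mathbb C$-algebra with generators $e_i,f_i,K_i^{\pm1}$ ($i=0,1$) and relations $K_iK_i^{-1}=K_i^{-1}K_i=1$, $K_0K_1=K_1K_0$, $K_ie_iK_i^{-1}=q^2e_i$, $K_if_iK_i^{-1}=q^{-2}f_i$, $K_ie_jK_i^{-1}=q^{-2}e_j$, $K_if_jK_i^{-1}=q^{2}f_j$, $[e_i,f_i]=\frac{K_i-K_i^{-1}}{q-q^{-1}}$, $[e_i,f_j]=0$ and the Serre relations $e_i^3e_j-[3]e_i^2e_je_i+[3]e_ie_je_i^2-e_je_i^3=0$,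 $f_i^3f_j-[3]f_i^2f_jf_i+[3]f_if_jf_i^2-f_jf_i^3=0$ ($i\neq j$). Both have the comultiplication $\Delta e_i=e_i\otimes K_i+1\otimes e_i$, $\Delta f_i=f_i\otimes1+K_i^{-1}\otimes f_i$, $\Delta K_i^{\pm1}=K_i^{\pm1}\otimes K_i^{\pm1}$ (without indices for $U_q(\mathfrak{sl}_2)$). For $x\in\mathbb C\setminus\{0\}$ let $ev_x:U_q(\widehat{\mathfrak{sl}}_2)\to U_q(\mathfrak{sl}_2)$ be the algebra homomorphism with $e_0\mapsto q^{-1}xf$, $e_1\mapsto e$, $f_0\mapsto qx^{-1}e$, $f_1\mapsto f$, $K_0\mapsto K^{-1}$, $K_1\mapsto K$. For $\lambda\in\mathbb C$ let $V_\lambda$ be the $U_q(\mathfrak{sl}_2)$-module with basis $v_0,\dots,v_{p-1}$ and $K^{\pm1}v_i=q^{\pm(\lambda-2i)}v_i$, $fv_i=[i+1]v_{i+1}$ ($fv_{p-1}=0$), $ev_i=[\lambda+1-i]v_{i-1}$ ($ev_0=0$). For $x,y\in\mathbb C\setminus\{0\}$ let $V_\lambda(x)\otimes V_\mu(y)$ be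 the $U_q(\widehat{\mathfrak{sl}}_2)$-module on $V_\lambda\otimes V_\mu$ in which $g$ acts by $(ev_x\otimes ev_y)(\Delta g)$. Let $\lambda_1,\lambda_2\in\mathbb C$ and $x,y\in\mathbb C\setminus\{0\}$, and assume **Condition 1.** $[\lambda_j+1-i]\neq0$ for $0\le i\le p$, $j=1,2$, and $[\lambda_1+\lambda_2-2j+1-i]\ne0$ for $0\le i\le p$, $0\le j\le p-1$. Consider **Condition 2.** $y/x\neq q^{\lambda_1+\lambda_2-2(l-1)}$ for $l=1,\dots,p-1$; **Condition 3.** $y/x\neq q^{-(\lambda_1+\lambda_2-2(l-1))}$ for $l=1,\dots,p-1$. **Theorem 4.1.** (a) The $U_q(\widehat{\mathfrak{sl}}_2)$-modules $V_{\lambda_1}(x)\otimes V_{\lambda_2}(y)$ and $V_{\lambda_2}(y)\otimes V_{\lambda_1}(x)$ are isomorphic if and only if Conditions 2 and 3 both hold. (b) Write $v_i$ and $w_i$ for the above bases of $V_{\lambda_1}$ and $V_{\lambda_2}$. For $0\le l\le p-1$ let $$\Omega_l=\sum_{i=0}^{l}(-1)^iq^{i(2l-i-\lambda_2-1)}\prod_{j=0}^{i}\frac{[\lambda_2-l+j]}{[\lambda_1-j+1]}\;v_i\otimes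 w_{l-i}\in V_{\lambda_1}\otimes V_{\lambda_2},$$ and let $\Omega_l'\in V_{\lambda_2}\otimes V_{\lambda_1}$ be the vector obtained by exchanging the roles of $(\lambda_1,v)$ and $(\lambda_2,w)$. Then, as a $U_q(\mathfrak{sl}_2)$-module, $V_{\lambda_1}\otimes V_{\lambda_2}=\bigoplus_{l=0}^{p-1}U_q(\mathfrak{sl}_2)\Omega_l$ with $U_q(\mathfrak{sl}_2)\Omega_l\cong V_{\lambda_1+\lambda_2-2l}$, and there is a unique $U_q(\mathfrak{sl}_2)$-module isomorphism $I:V_{\lambda_1}\otimes V_{\lambda_2}\to V_{\lambda_2}\otimes V_{\lambda_1}$ with $I\Omega_l=\Omega_l'$ for all $l$. Let $P_l$ be the projection onto the $l$-th summand. If Conditions 2 and 3 hold, then the denominators below are nonzero and $$\check R=\sum_{l=0}^{p-1}c_l\,I\circ P_l,\qquad c_l=\prod_{j=1}^{l}\frac{[\lambda_2-j]\,(xq^{\lambda_1}-yq^{-\lambda_2+2j-2})}{[\lambda_1-j]\,(-xq^{-\lambda_1+2j-2}+yq^{\lambda_2})},$$ is an isomorphism of $U_q(\widehat{\mathfrak{sl}}_2)$-modules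 from $V_{\lambda_1}(x)\otimes V_{\lambda_2}(y)$ to $V_{\lambda_2}(y)\otimes V_{\lambda_1}(x)$. -/

import Mathlib

open scoped TensorProduct

namespace QuantumAffine

noncomputable section

/-- The `q`-number `[lam]_q = (q ^ lam - q ^ (-lam)) / (q - q⁻¹)`. -/
def qnum (q : ℂˣ) (lam : ℂ) : ℂ :=
  ((q : ℂ) ^ lam - (q : ℂ) ^ (-lam)) / ((q : ℂ) - (q : ℂ)⁻¹)

/-- The integer `q`-number `[3]_q = (q³ - q⁻³) / (q - q⁻¹) = q² + 1 + q⁻²`. -/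
def qthree (q : ℂˣ) : ℂ := (q : ℂ) ^ 2 + 1 + ((q : ℂ)⁻¹) ^ 2

/-- Generators `e, f, K, K⁻¹` of `U_q(sl₂)`. -/
inductive Sl2Gen
  | e | f | K | Kinv

/-- Generators `e_i, f_i, K_i, K_i⁻¹` (`i = 0, 1`) of the quantum affine algebra. -/
inductive AffGen
  | e (i : Fin 2) | f (i : Fin 2) | K (i : Fin 2) | Kinv (i : Fin 2)

namespace Sl2Gen

/-- The free generator attached to a symbol. -/
abbrev X (g : Sl2Gen) : FreeAlgebra ℂ Sl2Gen := FreeAlgebra.ι ℂ g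

/-- Defining relations of `U_q(sl₂)`. -/
inductive Rel (q : ℂˣ) : FreeAlgebra ℂ Sl2Gen → FreeAlgebra ℂ Sl2Gen → Prop
  | K_Kinv : Rel q (X K * X Kinv) 1
  | Kinv_K : Rel q (X Kinv * X K) 1
  | K_e : Rel q (X K * X e * X Kinv) ((q : ℂ) ^ 2 • X e)
  | K_f : Rel q (X K * X f * X Kinv) (((q : ℂ)⁻¹) ^ 2 • X f)
  | e_f : Rel q (X e * X f - X f * X e) (((q : ℂ) - (q : ℂ)⁻¹)⁻¹ • (X K - X Kinv))

end Sl2Gen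

namespace AffGen

/-- The free generator attached to a symbol. -/
abbrev X (g : AffGen) : FreeAlgebra ℂ AffGen := FreeAlgebra.ι ℂ g

/-- Defining relations of the quantum affine algebra. -/
inductive Rel (q : ℂˣ) : FreeAlgebra ℂ AffGen → FreeAlgebra ℂ AffGen → Prop
  | K_Kinv (i : Fin 2) : Rel q (X (K i) * X (Kinv i)) 1
  | Kinv_K (i : Fin 2) : Rel q (X (Kinv i) * X (K i)) 1
  | K_K : Rel q (X (K 0) * X (K 1)) (X (K 1) * X (K 0))
  | K_e (i : Fin 2) : Rel q (X (K i) * X (e i) * X (Kinv i)) ((q : ℂ) ^ 2 • X (e i))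
  | K_f (i : Fin 2) : Rel q (X (K i) * X (f i) * X (Kinv i)) (((q : ℂ)⁻¹) ^ 2 • X (f i))
  | K_e' (i j : Fin 2) (h : i ≠ j) :
      Rel q (X (K i) * X (e j) * X (Kinv i)) (((q : ℂ)⁻¹) ^ 2 • X (e j))
  | K_f' (i j : Fin 2) (h : i ≠ j) :
      Rel q (X (K i) * X (f j) * X (Kinv i)) ((q : ℂ) ^ 2 • X (f j))
  | e_f (i : Fin 2) : Rel q (X (e i) * X (f i) - X (f i) * X (e i))
      (((q : ℂ) - (q : ℂ)⁻¹)⁻¹ • (X (K i) - X (Kinv i)))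
  | e_f' (i j : Fin 2) (h : i ≠ j) : Rel q (X (e i) * X (f j) - X (f j) * X (e i)) 0
  | serre_e (i j : Fin 2) (h : i ≠ j) : Rel q
      (X (e i) ^ 3 * X (e j) - qthree q • (X (e i) ^ 2 * X (e j) * X (e i))
        + qthree q • (X (e i) * X (e j) * X (e i) ^ 2) - X (e j) * X (e i) ^ 3) 0
  | serre_f (i j : Fin 2) (h : i ≠ j) : Rel q
      (X (f i) ^ 3 * X (f j) - qthree q • (X (f i) ^ 2 * X (f j) * X (f i))
        + qthree q • (X (f i) * X (f j) * X (f i) ^ 2) - X (f j) * X (f i) ^ 3) 0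

end AffGen

/-- The quantum algebra `U_q(sl₂)`. -/
def UqSl2 (q : ℂˣ) : Type := RingQuot (Sl2Gen.Rel q)

instance (q : ℂˣ) : Ring (UqSl2 q) := inferInstanceAs (Ring (RingQuot (Sl2Gen.Rel q)))

instance (q : ℂˣ) : Algebra ℂ (UqSl2 q) := inferInstanceAs (Algebra ℂ (RingQuot (Sl2Gen.Rel q)))

/-- The quantum affine algebra `U_q(ŝl₂)`. -/
def UqAff (q : ℂˣ) : Type := RingQuot (AffGen.Rel q)

instance (q : ℂˣ) : Ring (UqAff q) := inferInstanceAs (Ring (RingQuot (AffGen.Rel q)))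

instance (q : ℂˣ) : Algebra ℂ (UqAff q) := inferInstanceAs (Algebra ℂ (RingQuot (AffGen.Rel q)))

/-- The quotient map from the free algebra onto `U_q(sl₂)`. -/
def mkSl2 (q : ℂˣ) : FreeAlgebra ℂ Sl2Gen →ₐ[ℂ] UqSl2 q := RingQuot.mkAlgHom ℂ (Sl2Gen.Rel q)

/-- The quotient map from the free algebra onto `U_q(ŝl₂)`. -/
def mkAff (q : ℂˣ) : FreeAlgebra ℂ AffGen →ₐ[ℂ] UqAff q := RingQuot.mkAlgHom ℂ (AffGen.Rel q)

theorem mkSl2_rel {q : ℂˣ} {a b : FreeAlgebra ℂ Sl2Gen} (h : Sl2Gen.Rel q a b) :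
    mkSl2 q a = mkSl2 q b := RingQuot.mkAlgHom_rel ℂ h

theorem mkAff_rel {q : ℂˣ} {a b : FreeAlgebra ℂ AffGen} (h : AffGen.Rel q a b) :
    mkAff q a = mkAff q b := RingQuot.mkAlgHom_rel ℂ h

/-- The class of a generator in `U_q(sl₂)`. -/
def sl2 (q : ℂˣ) (g : Sl2Gen) : UqSl2 q := mkSl2 q g.X

/-- The class of a generator in `U_q(ŝl₂)`. -/
def aff (q : ℂˣ) (g : AffGen) : UqAff q := mkAff q g.X

/-- The homomorphism out of `U_q(sl₂)` given by images of generators satisfying the relations. -/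
def liftSl2 {q : ℂˣ} {B : Type*} [Ring B] [Algebra ℂ B] (F : Sl2Gen → B)
    (hF : ∀ ⦃a b⦄, Sl2Gen.Rel q a b → FreeAlgebra.lift ℂ F a = FreeAlgebra.lift ℂ F b) :
    UqSl2 q →ₐ[ℂ] B :=
  RingQuot.liftAlgHom ℂ ⟨FreeAlgebra.lift ℂ F, hF⟩

/-- The homomorphism out of `U_q(ŝl₂)` given by images of generators satisfying the relations. -/
def liftAff {q : ℂˣ} {B : Type*} [Ring B] [Algebra ℂ B] (F : AffGen → B)
    (hF : ∀ ⦃a b⦄, AffGen.Rel q a b → FreeAlgebra.lift ℂ F a = FreeAlgebra.lift ℂ F b) :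
    UqAff q →ₐ[ℂ] B :=
  RingQuot.liftAlgHom ℂ ⟨FreeAlgebra.lift ℂ F, hF⟩

theorem liftSl2_gen {q : ℂˣ} {B : Type*} [Ring B] [Algebra ℂ B] (F : Sl2Gen → B)
    (hF : ∀ ⦃a b⦄, Sl2Gen.Rel q a b → FreeAlgebra.lift ℂ F a = FreeAlgebra.lift ℂ F b)
    (g : Sl2Gen) : liftSl2 F hF (sl2 q g) = F g :=
  (RingQuot.liftAlgHom_mkAlgHom_apply ℂ _ hF _).trans (FreeAlgebra.lift_ι_apply _ _)

theorem liftAff_gen {q : ℂˣ} {B : Type*} [Ring B] [Algebra ℂ B] (F : AffGen → B)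
    (hF : ∀ ⦃a b⦄, AffGen.Rel q a b → FreeAlgebra.lift ℂ F a = FreeAlgebra.lift ℂ F b)
    (g : AffGen) : liftAff F hF (aff q g) = F g :=
  (RingQuot.liftAlgHom_mkAlgHom_apply ℂ _ hF _).trans (FreeAlgebra.lift_ι_apply _ _)

/-! ### Relations among generators -/

section relations

variable (q : ℂˣ)

theorem sl2_K_Kinv : sl2 q .K * sl2 q .Kinv = 1 := by
  simpa [sl2] using mkSl2_rel (Sl2Gen.Rel.K_Kinv (q := q))

theorem sl2_Kinv_K : sl2 q .Kinv * sl2 q .K = 1 := by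
  simpa [sl2] using mkSl2_rel (Sl2Gen.Rel.Kinv_K (q := q))

theorem sl2_K_e : sl2 q .K * sl2 q .e * sl2 q .Kinv = (q : ℂ) ^ 2 • sl2 q .e := by
  simpa [sl2] using mkSl2_rel (Sl2Gen.Rel.K_e (q := q))

theorem sl2_K_f : sl2 q .K * sl2 q .f * sl2 q .Kinv = ((q : ℂ)⁻¹) ^ 2 • sl2 q .f := by
  simpa [sl2] using mkSl2_rel (Sl2Gen.Rel.K_f (q := q))

theorem sl2_e_f : sl2 q .e * sl2 q .f - sl2 q .f * sl2 q .e
    = ((q : ℂ) - (q : ℂ)⁻¹)⁻¹ • (sl2 q .K - sl2 q .Kinv) := by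
  simpa [sl2] using mkSl2_rel (Sl2Gen.Rel.e_f (q := q))

theorem aff_K_Kinv (i : Fin 2) : aff q (.K i) * aff q (.Kinv i) = 1 := by
  simpa [aff] using mkAff_rel (AffGen.Rel.K_Kinv (q := q) i)

theorem aff_Kinv_K (i : Fin 2) : aff q (.Kinv i) * aff q (.K i) = 1 := by
  simpa [aff] using mkAff_rel (AffGen.Rel.Kinv_K (q := q) i)

theorem aff_K_K (i j : Fin 2) : aff q (.K i) * aff q (.K j) = aff q (.K j) * aff q (.K i) := by
  have h : aff q (.K 0) * aff q (.K 1) = aff q (.K 1) * aff q (.K 0) := by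
    simpa [aff] using mkAff_rel (AffGen.Rel.K_K (q := q))
  fin_cases i <;> fin_cases j <;> first | rfl | exact h | exact h.symm

theorem aff_K_e (i : Fin 2) :
    aff q (.K i) * aff q (.e i) * aff q (.Kinv i) = (q : ℂ) ^ 2 • aff q (.e i) := by
  simpa [aff] using mkAff_rel (AffGen.Rel.K_e (q := q) i)

theorem aff_K_f (i : Fin 2) :
    aff q (.K i) * aff q (.f i) * aff q (.Kinv i) = ((q : ℂ)⁻¹) ^ 2 • aff q (.f i) := by
  simpa [aff] using mkAff_rel (AffGen.Rel.K_f (q := q) i)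

theorem aff_K_e' (i j : Fin 2) (h : i ≠ j) :
    aff q (.K i) * aff q (.e j) * aff q (.Kinv i) = ((q : ℂ)⁻¹) ^ 2 • aff q (.e j) := by
  simpa [aff] using mkAff_rel (AffGen.Rel.K_e' (q := q) i j h)

theorem aff_K_f' (i j : Fin 2) (h : i ≠ j) :
    aff q (.K i) * aff q (.f j) * aff q (.Kinv i) = (q : ℂ) ^ 2 • aff q (.f j) := by
  simpa [aff] using mkAff_rel (AffGen.Rel.K_f' (q := q) i j h)

theorem aff_e_f (i : Fin 2) : aff q (.e i) * aff q (.f i) - aff q (.f i) * aff q (.e i)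
    = ((q : ℂ) - (q : ℂ)⁻¹)⁻¹ • (aff q (.K i) - aff q (.Kinv i)) := by
  simpa [aff] using mkAff_rel (AffGen.Rel.e_f (q := q) i)

theorem aff_e_f' (i j : Fin 2) (h : i ≠ j) :
    aff q (.e i) * aff q (.f j) = aff q (.f j) * aff q (.e i) := by
  have := mkAff_rel (AffGen.Rel.e_f' (q := q) i j h)
  rw [map_sub, map_mul, map_mul, map_zero] at this
  exact sub_eq_zero.mp this

/-- The quantum Serre expression. -/
def serre {R : Type*} [Ring R] [Algebra ℂ R] (q : ℂˣ) (a c : R) : R :=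
  a ^ 3 * c - qthree q • (a ^ 2 * c * a) + qthree q • (a * c * a ^ 2) - c * a ^ 3

theorem aff_serre_e (i j : Fin 2) (h : i ≠ j) : serre q (aff q (.e i)) (aff q (.e j)) = 0 := by
  simpa [aff, serre] using mkAff_rel (AffGen.Rel.serre_e (q := q) i j h)

theorem aff_serre_f (i j : Fin 2) (h : i ≠ j) : serre q (aff q (.f i)) (aff q (.f j)) = 0 := by
  simpa [aff, serre] using mkAff_rel (AffGen.Rel.serre_f (q := q) i j h)

end relations

/-! ### Computations in an arbitrary algebra -/

section computations

variable {R : Type*} [Ring R] [Algebra ℂ R]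

theorem mul_inv_comm_of_conj {k l a : R} {s : ℂ} (hlk : l * k = 1)
    (h : k * a * l = s • a) : k * a = s • (a * k) := by
  have := congrArg (· * k) h
  simpa [mul_assoc, hlk] using this

theorem inv_mul_comm_of_conj {k l a : R} {s t : ℂ} (hlk : l * k = 1) (hst : t * s = 1)
    (h : k * a * l = s • a) : l * a = t • (a * l) := by
  have := congrArg (fun z => t • (l * z)) h
  simp only [mul_smul_comm, smul_smul, hst, one_smul] at this
  rw [← this, ← mul_assoc, ← mul_assoc, hlk, one_mul]

theorem serre_add (q : ℂˣ) {a b c d : R}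
    (hab : a * b = (q : ℂ) ^ 2 • (b * a)) (had : a * d = ((q : ℂ)⁻¹) ^ 2 • (d * a))
    (hcb : c * b = ((q : ℂ)⁻¹) ^ 2 • (b * c))
    (hac : serre q a c = 0) (hbd : serre q b d = 0) : serre q (a + b) (c + d) = 0 := by
  have hab' : ∀ z, a * (b * z) = (q : ℂ) ^ 2 • (b * (a * z)) := fun z => by
    rw [← mul_assoc, hab, smul_mul_assoc, mul_assoc]
  have had' : ∀ z, a * (d * z) = ((q : ℂ)⁻¹) ^ 2 • (d * (a * z)) := fun z => by
    rw [← mul_assoc, had, smul_mul_assoc, mul_assoc]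
  have hcb' : ∀ z, c * (b * z) = ((q : ℂ)⁻¹) ^ 2 • (b * (c * z)) := fun z => by
    rw [← mul_assoc, hcb, smul_mul_assoc, mul_assoc]
  have key : serre q (a + b) (c + d) = serre q a c + serre q b d := by
    have hq : (q : ℂ) ≠ 0 := q.ne_zero
    simp only [serre, qthree, pow_succ, pow_zero, one_mul, mul_add, add_mul, mul_assoc, hab, had,
      hcb, hab', had', hcb', mul_smul_comm, smul_mul_assoc, smul_smul, smul_add]
    match_scalars <;> field_simp <;> ring
  rw [key, hac, hbd, add_zero]

theorem serre_smul (q : ℂˣ) (r s : ℂ) (a c : R) (h : serre q a c = 0) :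
    serre q (r • a) (s • c) = 0 := by
  have key : serre q (r • a) (s • c) = (r ^ 3 * s) • serre q a c := by
    simp only [serre, smul_pow, smul_mul_assoc, mul_smul_comm, smul_smul, smul_add, smul_sub]
    match_scalars <;> ring
  rw [key, h, smul_zero]

/-- The Serre relation for `f, e` or `e, f` in `U_q(sl₂)`. -/
theorem serre_of_bracket (q : ℂˣ) {a c k l : R} {r s : ℂ} (hr : r = (q : ℂ) ^ 2 ∨
    r = ((q : ℂ)⁻¹) ^ 2) (hk : k * a = r • (a * k)) (hl : l * a = r⁻¹ • (a * l))
    (h : c * a - a * c = s • (k - l)) : serre q a c = 0 := by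
  have hca : c * a = a * c + s • (k - l) := by rw [← h]; abel
  have hca' : ∀ z, c * (a * z) = a * (c * z) + s • (k * z - l * z) := fun z => by
    rw [← mul_assoc, hca, add_mul, mul_assoc, smul_mul_assoc, sub_mul]
  have hk' : ∀ z, k * (a * z) = r • (a * (k * z)) := fun z => by
    rw [← mul_assoc, hk, smul_mul_assoc, mul_assoc]
  have hl' : ∀ z, l * (a * z) = r⁻¹ • (a * (l * z)) := fun z => by
    rw [← mul_assoc, hl, smul_mul_assoc, mul_assoc]
  have hq : (q : ℂ) ≠ 0 := q.ne_zero
  simp only [serre, qthree, pow_succ, pow_zero, one_mul, mul_add, add_mul, mul_assoc, hca, hca',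
    hk, hl, hk', hl', mul_smul_comm, smul_smul, smul_add, smul_sub, mul_sub]
  rcases hr with rfl | rfl <;> match_scalars <;> field_simp <;> ring

end computations

/-! ### Comultiplications -/

/-- Values of the comultiplication of `U_q(sl₂)` on generators. -/
def comulSl2Gen (q : ℂˣ) : Sl2Gen → UqSl2 q ⊗[ℂ] UqSl2 q
  | .e => sl2 q .e ⊗ₜ sl2 q .K + 1 ⊗ₜ sl2 q .e
  | .f => sl2 q .f ⊗ₜ 1 + sl2 q .Kinv ⊗ₜ sl2 q .f
  | .K => sl2 q .K ⊗ₜ sl2 q .K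
  | .Kinv => sl2 q .Kinv ⊗ₜ sl2 q .Kinv

/-- Values of the comultiplication of `U_q(ŝl₂)` on generators. -/
def comulAffGen (q : ℂˣ) : AffGen → UqAff q ⊗[ℂ] UqAff q
  | .e i => aff q (.e i) ⊗ₜ aff q (.K i) + 1 ⊗ₜ aff q (.e i)
  | .f i => aff q (.f i) ⊗ₜ 1 + aff q (.Kinv i) ⊗ₜ aff q (.f i)
  | .K i => aff q (.K i) ⊗ₜ aff q (.K i)
  | .Kinv i => aff q (.Kinv i) ⊗ₜ aff q (.Kinv i)

section comulLemmas

variable {A : Type*} [Ring A] [Algebra ℂ A]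

theorem conj_comul_e {k l k' e : A} {s : ℂ} (hkl : k * l = 1) (hkk : k * k' = k' * k)
    (h : k * e * l = s • e) :
    (k ⊗ₜ[ℂ] k) * (e ⊗ₜ[ℂ] k' + 1 ⊗ₜ[ℂ] e) * (l ⊗ₜ[ℂ] l) = s • (e ⊗ₜ[ℂ] k' + 1 ⊗ₜ[ℂ] e) := by
  have h' : k * k' * l = k' := by rw [hkk, mul_assoc, hkl, mul_one]
  simp only [mul_add, add_mul, Algebra.TensorProduct.tmul_mul_tmul, mul_one, h, h', hkl, smul_add,
    TensorProduct.smul_tmul', TensorProduct.tmul_smul]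

theorem conj_comul_f {k l l' f : A} {s : ℂ} (hkl : k * l = 1) (hkk : k * l' = l' * k)
    (h : k * f * l = s • f) :
    (k ⊗ₜ[ℂ] k) * (f ⊗ₜ[ℂ] 1 + l' ⊗ₜ[ℂ] f) * (l ⊗ₜ[ℂ] l) = s • (f ⊗ₜ[ℂ] 1 + l' ⊗ₜ[ℂ] f) := by
  have h' : k * l' * l = l' := by rw [hkk, mul_assoc, hkl, mul_one]
  simp only [mul_add, add_mul, Algebra.TensorProduct.tmul_mul_tmul, mul_one, h, h', hkl, smul_add,
    TensorProduct.smul_tmul', TensorProduct.tmul_smul]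

theorem comul_bracket {k l e f : A} {s t r : ℂ} (hlk : l * k = 1) (hst : t * s = 1)
    (hke : k * e * l = s • e) (hkf : k * f * l = t • f) (h : e * f - f * e = r • (k - l)) :
    (e ⊗ₜ[ℂ] k + 1 ⊗ₜ[ℂ] e) * (f ⊗ₜ[ℂ] 1 + l ⊗ₜ[ℂ] f) -
      (f ⊗ₜ[ℂ] 1 + l ⊗ₜ[ℂ] f) * (e ⊗ₜ[ℂ] k + 1 ⊗ₜ[ℂ] e) = r • (k ⊗ₜ[ℂ] k - l ⊗ₜ[ℂ] l) := by
  have h1 : e * f = f * e + r • (k - l) := by rw [← h]; abel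
  have h2 : k * f = t • (f * k) := mul_inv_comm_of_conj hlk hkf
  have h3 : l * e = t • (e * l) := inv_mul_comm_of_conj hlk hst hke
  simp only [mul_add, add_mul, Algebra.TensorProduct.tmul_mul_tmul, mul_one, one_mul, h1, h2, h3,
    TensorProduct.add_tmul, TensorProduct.tmul_add, TensorProduct.tmul_smul,
    TensorProduct.tmul_sub, TensorProduct.sub_tmul, smul_sub,
    ← TensorProduct.smul_tmul']
  abel

end comulLemmas

theorem q_sq_inv (q : ℂˣ) : ((q : ℂ)⁻¹) ^ 2 * (q : ℂ) ^ 2 = 1 := by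
  have hq : (q : ℂ) ≠ 0 := q.ne_zero
  field_simp

theorem comulSl2_rel (q : ℂˣ) ⦃a b : FreeAlgebra ℂ Sl2Gen⦄ (h : Sl2Gen.Rel q a b) :
    FreeAlgebra.lift ℂ (comulSl2Gen q) a = FreeAlgebra.lift ℂ (comulSl2Gen q) b := by
  cases h with
  | K_Kinv =>
    simp [comulSl2Gen, sl2_K_Kinv, Algebra.TensorProduct.one_def]
  | Kinv_K =>
    simp [comulSl2Gen, sl2_Kinv_K, Algebra.TensorProduct.one_def]
  | K_e =>
    simpa [comulSl2Gen] using conj_comul_e (sl2_K_Kinv q) rfl (sl2_K_e q)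
  | K_f =>
    simpa [comulSl2Gen] using
      conj_comul_f (sl2_K_Kinv q) ((sl2_K_Kinv q).trans (sl2_Kinv_K q).symm) (sl2_K_f q)
  | e_f =>
    simpa [comulSl2Gen] using
      comul_bracket (sl2_Kinv_K q) (q_sq_inv q) (sl2_K_e q) (sl2_K_f q) (sl2_e_f q)

/-- The comultiplication of `U_q(sl₂)`. -/
def comulSl2 (q : ℂˣ) : UqSl2 q →ₐ[ℂ] UqSl2 q ⊗[ℂ] UqSl2 q :=
  liftSl2 (comulSl2Gen q) (comulSl2_rel q)

theorem aff_K_Kinv_comm (q : ℂˣ) (i j : Fin 2) :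
    aff q (.K i) * aff q (.Kinv j) = aff q (.Kinv j) * aff q (.K i) := by
  calc aff q (.K i) * aff q (.Kinv j)
      = aff q (.Kinv j) * (aff q (.K j) * aff q (.K i)) * aff q (.Kinv j) := by
        rw [← mul_assoc, aff_Kinv_K, one_mul]
    _ = aff q (.Kinv j) * aff q (.K i) := by
        rw [aff_K_K, mul_assoc, mul_assoc, aff_K_Kinv, mul_one]

theorem aff_Kinv_Kinv_comm (q : ℂˣ) (i j : Fin 2) :
    aff q (.Kinv i) * aff q (.Kinv j) = aff q (.Kinv j) * aff q (.Kinv i) := by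
  calc aff q (.Kinv i) * aff q (.Kinv j)
      = aff q (.Kinv i) * aff q (.Kinv j) * (aff q (.K i) * aff q (.Kinv i)) := by
        rw [aff_K_Kinv, mul_one]
    _ = aff q (.Kinv i) * (aff q (.K i) * aff q (.Kinv j)) * aff q (.Kinv i) := by
        rw [aff_K_Kinv_comm q i j]; simp only [mul_assoc, aff_K_Kinv_comm q i i]
    _ = aff q (.Kinv j) * aff q (.Kinv i) := by
        rw [← mul_assoc, aff_Kinv_K, one_mul]

/-- The Serre expression is compatible with tensoring by commuting elements. -/
theorem serre_tmul_left {A : Type*} [Ring A] [Algebra ℂ A] (q : ℂˣ) {a c k m : A}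
    (hkm : k * m = m * k) (h : serre q a c = 0) :
    serre q (a ⊗ₜ[ℂ] k) (c ⊗ₜ[ℂ] m) = 0 := by
  have h1 : m * k ^ 3 = k ^ 3 * m := (Commute.pow_left (show Commute k m from hkm) 3).eq.symm
  have h2 : k ^ 2 * m * k = k ^ 3 * m := by rw [mul_assoc, ← hkm, ← mul_assoc, ← pow_succ]
  have h3 : k * m * k ^ 2 = k ^ 3 * m := by
    rw [mul_assoc, ← (Commute.pow_left (show Commute k m from hkm) 2).eq, ← mul_assoc,
      ← pow_succ']
  have key : serre q (a ⊗ₜ[ℂ] k) (c ⊗ₜ[ℂ] m) = serre q a c ⊗ₜ[ℂ] (k ^ 3 * m) := by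
    simp only [serre, Algebra.TensorProduct.tmul_pow, Algebra.TensorProduct.tmul_mul_tmul, h1, h2,
      h3, TensorProduct.add_tmul, TensorProduct.sub_tmul, TensorProduct.smul_tmul']
  rw [key, h, TensorProduct.zero_tmul]

theorem serre_tmul_right {A : Type*} [Ring A] [Algebra ℂ A] (q : ℂˣ) {a c k m : A}
    (hkm : k * m = m * k) (h : serre q a c = 0) :
    serre q (k ⊗ₜ[ℂ] a) (m ⊗ₜ[ℂ] c) = 0 := by
  have := congrArg (Algebra.TensorProduct.comm ℂ A A) (serre_tmul_left q hkm h)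
  simpa [serre] using this

theorem comulAff_rel (q : ℂˣ) ⦃a b : FreeAlgebra ℂ AffGen⦄ (h : AffGen.Rel q a b) :
    FreeAlgebra.lift ℂ (comulAffGen q) a = FreeAlgebra.lift ℂ (comulAffGen q) b := by
  have hq2 := q_sq_inv q
  have hq2' : (q : ℂ) ^ 2 * ((q : ℂ)⁻¹) ^ 2 = 1 := by rw [mul_comm]; exact hq2
  cases h with
  | K_Kinv i => simp [comulAffGen, aff_K_Kinv, Algebra.TensorProduct.one_def]
  | Kinv_K i => simp [comulAffGen, aff_Kinv_K, Algebra.TensorProduct.one_def]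
  | K_K => simp [comulAffGen, aff_K_K q 0 1]
  | K_e i => simpa [comulAffGen] using conj_comul_e (aff_K_Kinv q i) rfl (aff_K_e q i)
  | K_f i =>
    simpa [comulAffGen] using conj_comul_f (aff_K_Kinv q i) (aff_K_Kinv_comm q i i) (aff_K_f q i)
  | K_e' i j h =>
    simpa [comulAffGen] using conj_comul_e (aff_K_Kinv q i) (aff_K_K q i j) (aff_K_e' q i j h)
  | K_f' i j h =>
    simpa [comulAffGen] using
      conj_comul_f (aff_K_Kinv q i) (aff_K_Kinv_comm q i j) (aff_K_f' q i j h)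
  | e_f i =>
    simpa [comulAffGen] using
      comul_bracket (aff_Kinv_K q i) hq2 (aff_K_e q i) (aff_K_f q i) (aff_e_f q i)
  | e_f' i j h =>
    have h1 := inv_mul_comm_of_conj (aff_Kinv_K q j) hq2' (aff_K_e' q j i h.symm)
    have h2 := mul_inv_comm_of_conj (aff_Kinv_K q i) (aff_K_f' q i j h)
    have h3 := aff_e_f' q i j h
    simp only [comulAffGen, map_sub, map_mul, FreeAlgebra.lift_ι_apply, map_zero, mul_add, add_mul,
      Algebra.TensorProduct.tmul_mul_tmul, mul_one, one_mul, h1, h2, h3,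
      TensorProduct.tmul_smul, ← TensorProduct.smul_tmul']
    abel
  | serre_e i j h =>
    have h1 := mul_inv_comm_of_conj (aff_Kinv_K q i) (aff_K_e q i)
    have h2 := mul_inv_comm_of_conj (aff_Kinv_K q i) (aff_K_e' q i j h)
    have h3 := mul_inv_comm_of_conj (aff_Kinv_K q j) (aff_K_e' q j i h.symm)
    have := serre_add q (a := aff q (.e i) ⊗ₜ[ℂ] aff q (.K i)) (b := 1 ⊗ₜ[ℂ] aff q (.e i))
      (c := aff q (.e j) ⊗ₜ[ℂ] aff q (.K j)) (d := 1 ⊗ₜ[ℂ] aff q (.e j))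
      (by simp [h1]) (by simp [h2]) (by simp [h3])
      (serre_tmul_left q (aff_K_K q i j) (aff_serre_e q i j h))
      (serre_tmul_right q rfl (aff_serre_e q i j h))
    simpa [comulAffGen, serre] using this
  | serre_f i j h =>
    have h1 := inv_mul_comm_of_conj (aff_Kinv_K q i) hq2' (aff_K_f q i)
    have h2 := inv_mul_comm_of_conj (aff_Kinv_K q i) hq2 (aff_K_f' q i j h)
    have h3 := inv_mul_comm_of_conj (aff_Kinv_K q j) hq2 (aff_K_f' q j i h.symm)
    have := serre_add q (a := aff q (.Kinv i) ⊗ₜ[ℂ] aff q (.f i)) (b := aff q (.f i) ⊗ₜ[ℂ] 1)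
      (c := aff q (.Kinv j) ⊗ₜ[ℂ] aff q (.f j)) (d := aff q (.f j) ⊗ₜ[ℂ] 1)
      (by simp [h1, TensorProduct.smul_tmul']) (by simp [h2, TensorProduct.smul_tmul'])
      (by simp [h3, TensorProduct.smul_tmul'])
      (serre_tmul_right q (aff_Kinv_Kinv_comm q i j) (aff_serre_f q i j h))
      (serre_tmul_left q rfl (aff_serre_f q i j h))
    simpa [comulAffGen, serre, add_comm] using this

/-- The comultiplication of `U_q(ŝl₂)`. -/
def comulAff (q : ℂˣ) : UqAff q →ₐ[ℂ] UqAff q ⊗[ℂ] UqAff q :=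
  liftAff (comulAffGen q) (comulAff_rel q)

/-! ### Evaluation homomorphisms -/

/-- Values of the evaluation map `ev_x` on generators. -/
def evGen (q x : ℂˣ) : AffGen → UqSl2 q
  | .e i => if i = 0 then ((q : ℂ)⁻¹ * (x : ℂ)) • sl2 q .f else sl2 q .e
  | .f i => if i = 0 then ((q : ℂ) * (x : ℂ)⁻¹) • sl2 q .e else sl2 q .f
  | .K i => if i = 0 then sl2 q .Kinv else sl2 q .K
  | .Kinv i => if i = 0 then sl2 q .K else sl2 q .Kinv

theorem conj_inv {R : Type*} [Ring R] [Algebra ℂ R] {k l a : R} {s t : ℂ} (hlk : l * k = 1)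
    (hst : t * s = 1) (h : k * a * l = s • a) : l * a * k = t • a := by
  rw [inv_mul_comm_of_conj hlk hst h, smul_mul_assoc, mul_assoc, hlk, mul_one]

theorem ev_rel (q x : ℂˣ) ⦃a b : FreeAlgebra ℂ AffGen⦄ (h : AffGen.Rel q a b) :
    FreeAlgebra.lift ℂ (evGen q x) a = FreeAlgebra.lift ℂ (evGen q x) b := by
  have hq2 := q_sq_inv q
  have hq2' : (q : ℂ) ^ 2 * ((q : ℂ)⁻¹) ^ 2 = 1 := by rw [mul_comm]; exact hq2
  have hq : (q : ℂ) ≠ 0 := q.ne_zero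
  have hx : (x : ℂ) ≠ 0 := x.ne_zero
  have e1 := conj_inv (sl2_Kinv_K q) hq2 (sl2_K_e q)
  have f1 := conj_inv (sl2_Kinv_K q) hq2' (sl2_K_f q)
  have hr : (q : ℂ)⁻¹ * (x : ℂ) * ((q : ℂ) * (x : ℂ)⁻¹) = 1 := by field_simp
  have hr' : (q : ℂ) * (x : ℂ)⁻¹ * ((q : ℂ)⁻¹ * (x : ℂ)) = 1 := by field_simp
  have ke := mul_inv_comm_of_conj (sl2_Kinv_K q) (sl2_K_e q)
  have kf := mul_inv_comm_of_conj (sl2_Kinv_K q) (sl2_K_f q)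
  have le := inv_mul_comm_of_conj (sl2_Kinv_K q) hq2 (sl2_K_e q)
  have lf := inv_mul_comm_of_conj (sl2_Kinv_K q) hq2' (sl2_K_f q)
  have sfe : serre q (sl2 q .f) (sl2 q .e) = 0 :=
    serre_of_bracket q (Or.inr rfl) kf (by rw [lf]; simp) (sl2_e_f q)
  have sef : serre q (sl2 q .e) (sl2 q .f) = 0 :=
    serre_of_bracket q (s := -((q : ℂ) - (q : ℂ)⁻¹)⁻¹) (Or.inl rfl) ke (by rw [le]; simp)
      (by rw [neg_smul, ← sl2_e_f, neg_sub])
  cases h with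
  | K_Kinv i => fin_cases i <;> simp [evGen, sl2_K_Kinv, sl2_Kinv_K]
  | Kinv_K i => fin_cases i <;> simp [evGen, sl2_K_Kinv, sl2_Kinv_K]
  | K_K => simp [evGen, sl2_K_Kinv, sl2_Kinv_K]
  | K_e i =>
    fin_cases i
    · simp only [evGen, map_mul, map_smul, FreeAlgebra.lift_ι_apply, Fin.zero_eta, if_true,
        mul_smul_comm, smul_mul_assoc, f1]
      rw [smul_comm]
    · simpa [evGen] using sl2_K_e q
  | K_f i =>
    fin_cases i
    · simp only [evGen, map_mul, map_smul, FreeAlgebra.lift_ι_apply, Fin.zero_eta, if_true,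
        mul_smul_comm, smul_mul_assoc, e1]
      rw [smul_comm]
    · simpa [evGen] using sl2_K_f q
  | K_e' i j h =>
    fin_cases i <;> fin_cases j <;> first | exact absurd rfl h | skip
    · simpa [evGen] using e1
    · have := sl2_K_f q
      simp only [evGen, map_mul, map_smul, FreeAlgebra.lift_ι_apply, Fin.zero_eta, Fin.mk_one,
        if_true, one_ne_zero, if_false, mul_smul_comm, smul_mul_assoc, this]
      rw [smul_comm]
  | K_f' i j h =>
    fin_cases i <;> fin_cases j <;> first | exact absurd rfl h | skip
    · simpa [evGen] using f1
    · have := sl2_K_e q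
      simp only [evGen, map_mul, map_smul, FreeAlgebra.lift_ι_apply, Fin.zero_eta, Fin.mk_one,
        if_true, one_ne_zero, if_false, mul_smul_comm, smul_mul_assoc, this]
      rw [smul_comm]
  | e_f i =>
    fin_cases i
    · have := sl2_e_f q
      simp only [evGen, map_mul, map_sub, map_smul, FreeAlgebra.lift_ι_apply, Fin.zero_eta,
        if_true, mul_smul_comm, smul_mul_assoc, smul_smul, hr, hr', one_smul]
      rw [← neg_sub, this, ← smul_neg, neg_sub]
    · simpa [evGen] using sl2_e_f q
  | e_f' i j h =>
    fin_cases i <;> fin_cases j <;> first | exact absurd rfl h | simp [evGen]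
  | serre_e i j h =>
    fin_cases i <;> fin_cases j <;> first | exact absurd rfl h | skip
    · simpa [evGen, serre] using serre_smul q ((q : ℂ)⁻¹ * (x : ℂ)) 1 _ _ sfe
    · simpa [evGen, serre] using serre_smul q 1 ((q : ℂ)⁻¹ * (x : ℂ)) _ _ sef
  | serre_f i j h =>
    fin_cases i <;> fin_cases j <;> first | exact absurd rfl h | skip
    · simpa [evGen, serre] using serre_smul q ((q : ℂ) * (x : ℂ)⁻¹) 1 _ _ sef
    · simpa [evGen, serre] using serre_smul q 1 ((q : ℂ) * (x : ℂ)⁻¹) _ _ sfe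

/-- The evaluation homomorphism `ev_x : U_q(ŝl₂) → U_q(sl₂)`. -/
def ev (q x : ℂˣ) : UqAff q →ₐ[ℂ] UqSl2 q :=
  liftAff (evGen q x) (ev_rel q x)

/-! ### The modules `V_lam`

A module over a `ℂ`-algebra `A` on a complex vector space `V` is given by its structure map
`A →ₐ[ℂ] Module.End ℂ V`. -/

/-- The normal basis vector `v_n` for `n < p`; `v_n = 0` for `n ≥ p`. -/
def nb (p n : ℕ) : Fin p → ℂ := fun i => if (i : ℕ) = n then 1 else 0

/-- Action of the generators of `U_q(sl₂)` on the normal basis of `V_lam`. -/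
def verGen (q : ℂˣ) (p : ℕ) (lam : ℂ) : Sl2Gen → Module.End ℂ (Fin p → ℂ)
  | .e => (Pi.basisFun ℂ (Fin p)).constr ℂ fun i =>
      if (i : ℕ) = 0 then 0 else qnum q (lam + 1 - (i : ℕ)) • nb p ((i : ℕ) - 1)
  | .f => (Pi.basisFun ℂ (Fin p)).constr ℂ fun i => qnum q ((i : ℕ) + 1) • nb p ((i : ℕ) + 1)
  | .K => (Pi.basisFun ℂ (Fin p)).constr ℂ fun i => (q : ℂ) ^ (lam - 2 * (i : ℕ)) • nb p i
  | .Kinv => (Pi.basisFun ℂ (Fin p)).constr ℂ fun i => (q : ℂ) ^ (-(lam - 2 * (i : ℕ))) • nb p i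

section verLemmas

variable (q : ℂˣ) (p : ℕ) (lam : ℂ)

theorem basisFun_eq_nb (i : Fin p) : Pi.basisFun ℂ (Fin p) i = nb p i := by
  ext j
  simp [nb, Pi.single_apply, Fin.ext_iff]

theorem nb_of_le {n : ℕ} (h : p ≤ n) : nb p n = 0 := by
  ext i
  have := i.isLt
  simp only [nb, Pi.zero_apply, ite_eq_right_iff, one_ne_zero, imp_false]
  omega

theorem constr_nb (F : ℕ → (Fin p → ℂ)) {n : ℕ} (h : n < p) :
    (Pi.basisFun ℂ (Fin p)).constr ℂ (fun i : Fin p => F i) (nb p n) = F n := by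
  have := (Pi.basisFun ℂ (Fin p)).constr_basis ℂ (fun i : Fin p => F i) ⟨n, h⟩
  rwa [basisFun_eq_nb] at this

theorem ver_K (n : ℕ) : verGen q p lam .K (nb p n) = (q : ℂ) ^ (lam - 2 * n) • nb p n := by
  rcases lt_or_ge n p with h | h
  · exact constr_nb p (fun n => (q : ℂ) ^ (lam - 2 * (n : ℂ)) • nb p n) h
  · simp [nb_of_le p h]

theorem ver_Kinv (n : ℕ) :
    verGen q p lam .Kinv (nb p n) = (q : ℂ) ^ (-(lam - 2 * n)) • nb p n := by
  rcases lt_or_ge n p with h | h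
  · exact constr_nb p (fun n => (q : ℂ) ^ (-(lam - 2 * (n : ℂ))) • nb p n) h
  · simp [nb_of_le p h]

theorem ver_f (n : ℕ) : verGen q p lam .f (nb p n) = qnum q (n + 1) • nb p (n + 1) := by
  rcases lt_or_ge n p with h | h
  · exact constr_nb p (fun n => qnum q ((n : ℂ) + 1) • nb p (n + 1)) h
  · simp [nb_of_le p h, nb_of_le p (Nat.le_succ_of_le h)]

theorem ver_e_zero : verGen q p lam .e (nb p 0) = 0 := by
  rcases lt_or_ge 0 p with h | h
  · exact (constr_nb p
      (fun n => if n = 0 then 0 else qnum q (lam + 1 - (n : ℂ)) • nb p (n - 1)) h).trans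
      (if_pos rfl)
  · simp [nb_of_le p h]

theorem ver_e_succ {n : ℕ} (h : n + 1 < p) :
    verGen q p lam .e (nb p (n + 1)) = qnum q (lam - n) • nb p n := by
  have := constr_nb p
      (fun n => if n = 0 then 0 else qnum q (lam + 1 - (n : ℂ)) • nb p (n - 1)) h
  simp only [Nat.add_eq_zero_iff, one_ne_zero, and_false, if_false, Nat.add_sub_cancel] at this
  rw [show lam - (n : ℂ) = lam + 1 - ((n + 1 : ℕ) : ℂ) by push_cast; ring]
  exact this

theorem end_ext {S T : Module.End ℂ (Fin p → ℂ)} (h : ∀ n < p, S (nb p n) = T (nb p n)) :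
    S = T := by
  refine (Pi.basisFun ℂ (Fin p)).ext fun i => ?_
  rw [basisFun_eq_nb]
  exact h i i.isLt

variable {p}

theorem cpow_sub_nat (n : ℕ) : (q : ℂ) ^ (lam - n) = (q : ℂ) ^ lam * ((q : ℂ) ^ n)⁻¹ := by
  rw [Complex.cpow_sub _ _ q.ne_zero, Complex.cpow_natCast, div_eq_mul_inv]

theorem cpow_neg_sub_nat (n : ℕ) :
    (q : ℂ) ^ (-(lam - n)) = ((q : ℂ) ^ lam)⁻¹ * (q : ℂ) ^ n := by
  rw [Complex.cpow_neg, cpow_sub_nat, mul_inv, inv_inv]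

theorem cpow_nat_succ (n : ℕ) : (q : ℂ) ^ ((n : ℂ) + 1) = (q : ℂ) ^ n * q := by
  rw [← pow_succ, ← Complex.cpow_natCast, Nat.cast_succ]

theorem cpow_lam_ne : (q : ℂ) ^ lam ≠ 0 := by
  simp [Complex.cpow_eq_zero_iff, q.ne_zero]

theorem qnum_smul_e (hqp : (q : ℂ) ^ p = 1) {n : ℕ} (hn : n < p) :
    qnum q (n + 1) • verGen q p lam .e (nb p (n + 1)) =
      (qnum q (n + 1) * qnum q (lam - n)) • nb p n := by
  rcases lt_or_eq_of_le (Nat.succ_le_of_lt hn) with h | h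
  · rw [ver_e_succ q p lam h, smul_smul]
  · have : qnum q ((n : ℂ) + 1) = 0 := by
      rw [qnum, Complex.cpow_neg, ← Nat.cast_succ, h, Complex.cpow_natCast, hqp]
      simp
    simp [this]

theorem qnum_identity (n : ℕ) :
    qnum q (n + 1) * qnum q (lam - n) - qnum q (lam - n + 1) * qnum q n =
      ((q : ℂ) - (q : ℂ)⁻¹)⁻¹ *
        ((q : ℂ) ^ (lam - 2 * n) - (q : ℂ) ^ (-(lam - 2 * n))) := by
  have hq : (q : ℂ) ≠ 0 := q.ne_zero
  have hL := cpow_lam_ne q lam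
  have hN : (q : ℂ) ^ n ≠ 0 := pow_ne_zero n hq
  have h1 : lam - 2 * (n : ℂ) = lam - ((n + n : ℕ) : ℂ) := by push_cast; ring
  have h2 : (q : ℂ) ^ (lam - n + 1) = (q : ℂ) ^ (lam - n) * q := by
    rw [Complex.cpow_add _ _ hq, Complex.cpow_one]
  rw [h1]
  simp only [qnum, Complex.cpow_neg, h2, cpow_sub_nat, cpow_nat_succ, Complex.cpow_natCast,
    pow_add]
  generalize (q : ℂ) ^ lam = L at *
  generalize (q : ℂ) ^ n = N at *
  generalize (q : ℂ) = z at *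
  by_cases hD : z - z⁻¹ = 0
  · simp [hD]
  · rw [div_mul_div_comm, div_mul_div_comm, ← sub_div, div_eq_iff (mul_ne_zero hD hD),
      inv_mul_eq_div, div_mul_eq_mul_div, eq_div_iff hD]
    field_simp
    ring

theorem ver_rel (hqp : q ^ p = 1) ⦃a b : FreeAlgebra ℂ Sl2Gen⦄ (h : Sl2Gen.Rel q a b) :
    FreeAlgebra.lift ℂ (verGen q p lam) a = FreeAlgebra.lift ℂ (verGen q p lam) b := by
  have hq : (q : ℂ) ≠ 0 := q.ne_zero
  have hqp' : (q : ℂ) ^ p = 1 := by rw [← Units.val_pow_eq_pow_val, hqp, Units.val_one]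
  refine end_ext p fun n hn => ?_
  have hnn : (q : ℂ) ^ (lam - 2 * n) * (q : ℂ) ^ (-(lam - 2 * n)) = 1 := by
    rw [← Complex.cpow_add _ _ hq, add_neg_cancel, Complex.cpow_zero]
  have hsucc : (q : ℂ) ^ (lam - 2 * ((n + 1 : ℕ) : ℂ)) =
      (q : ℂ) ^ (lam - 2 * n) * ((q : ℂ)⁻¹) ^ 2 := by
    rw [show lam - 2 * ((n + 1 : ℕ) : ℂ) = lam - 2 * n - (2 : ℕ) by push_cast; ring,
      cpow_sub_nat, inv_pow]
  cases h with
  | K_Kinv =>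
    simp only [map_mul, map_one, FreeAlgebra.lift_ι_apply, Module.End.mul_apply,
      Module.End.one_apply, ver_K, ver_Kinv, map_smul, smul_smul]
    rw [mul_comm, hnn, one_smul]
  | Kinv_K =>
    simp only [map_mul, map_one, FreeAlgebra.lift_ι_apply, Module.End.mul_apply,
      Module.End.one_apply, ver_K, ver_Kinv, map_smul, smul_smul]
    rw [hnn, one_smul]
  | K_e =>
    simp only [map_mul, map_smul, FreeAlgebra.lift_ι_apply, Module.End.mul_apply,
      LinearMap.smul_apply, ver_Kinv]
    rcases n with _ | n
    · simp only [ver_e_zero, map_zero, smul_zero]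
    · have h1 : (q : ℂ) ^ (lam - 2 * n) =
          (q : ℂ) ^ (lam - 2 * ((n + 1 : ℕ) : ℂ)) * (q : ℂ) ^ 2 := by
        rw [show lam - 2 * (n : ℂ) = lam - 2 * ((n + 1 : ℕ) : ℂ) + (2 : ℕ) by push_cast; ring,
          Complex.cpow_add _ _ hq, Complex.cpow_natCast]
      simp only [ver_e_succ q p lam hn, map_smul, ver_K, smul_smul]
      congr 1
      rw [h1]
      linear_combination (qnum q (lam - n) * (q : ℂ) ^ 2) * hnn
  | K_f =>
    simp only [map_mul, map_smul, FreeAlgebra.lift_ι_apply, Module.End.mul_apply,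
      LinearMap.smul_apply, ver_Kinv, ver_f, ver_K, smul_smul]
    congr 1
    rw [hsucc]
    linear_combination (qnum q (n + 1) * ((q : ℂ)⁻¹) ^ 2) * hnn
  | e_f =>
    simp only [map_mul, map_smul, map_sub, FreeAlgebra.lift_ι_apply, Module.End.mul_apply,
      LinearMap.smul_apply, LinearMap.sub_apply, ver_Kinv, ver_f, ver_K, ← sub_smul, smul_smul,
      qnum_smul_e q lam hqp' hn]
    rw [← qnum_identity]
    rcases n with _ | n
    · simp [ver_e_zero, qnum]
    · simp only [ver_e_succ q p lam hn, map_smul, ver_f, smul_smul, ← sub_smul]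
      congr 3
      · congr 1
        push_cast; ring
      · push_cast; ring

end verLemmas

/-- The module `V_lam` (when `q ^ p = 1`), with normal basis `v_0, …, v_{p-1}`. -/
def V (q : ℂˣ) {p : ℕ} (hqp : q ^ p = 1) (lam : ℂ) : UqSl2 q →ₐ[ℂ] Module.End ℂ (Fin p → ℂ) :=
  liftSl2 (verGen q p lam) (ver_rel q lam hqp)

/-! ### Tensor product modules and their morphisms -/

/-- The underlying space of `V_lam₁ ⊗ V_lam₂`. -/
abbrev VV (p : ℕ) : Type := (Fin p → ℂ) ⊗[ℂ] (Fin p → ℂ)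

/-- The external tensor product of an `A`-module and a `B`-module, as an `A ⊗ B`-module:
`a ⊗ b` acts as `(action of a) ⊗ (action of b)`. -/
def tensorRep {A B M N : Type*} [Ring A] [Algebra ℂ A] [Ring B] [Algebra ℂ B]
    [AddCommGroup M] [Module ℂ M] [AddCommGroup N] [Module ℂ N]
    (ρ : A →ₐ[ℂ] Module.End ℂ M) (σ : B →ₐ[ℂ] Module.End ℂ N) :
    A ⊗[ℂ] B →ₐ[ℂ] Module.End ℂ (M ⊗[ℂ] N) :=
  (Module.endTensorEndAlgHom (R := ℂ) (S := ℂ) (A := ℂ) (M := M) (N := N)).comp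
    (Algebra.TensorProduct.map ρ σ)

/-- The `U_q(sl₂)`-module `V_lam₁ ⊗ V_lam₂`. -/
def sl2Tensor (q : ℂˣ) {p : ℕ} (hqp : q ^ p = 1) (lam₁ lam₂ : ℂ) :
    UqSl2 q →ₐ[ℂ] Module.End ℂ (VV p) :=
  (tensorRep (V q hqp lam₁) (V q hqp lam₂)).comp (comulSl2 q)

/-- The `U_q(ŝl₂)`-module `V_lam₁(x) ⊗ V_lam₂(y)`: `g` acts through `(ev_x ⊗ ev_y)(Δ g)`. -/
def affTensor (q : ℂˣ) {p : ℕ} (hqp : q ^ p = 1) (lam₁ : ℂ) (x : ℂˣ) (lam₂ : ℂ) (y : ℂˣ) :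
    UqAff q →ₐ[ℂ] Module.End ℂ (VV p) :=
  (tensorRep (V q hqp lam₁) (V q hqp lam₂)).comp
    ((Algebra.TensorProduct.map (ev q x) (ev q y)).comp (comulAff q))

/-- `T` is a homomorphism of `A`-modules. -/
def IsModuleHom {A M N : Type*} [Ring A] [Algebra ℂ A] [AddCommGroup M] [Module ℂ M]
    [AddCommGroup N] [Module ℂ N] (ρ : A →ₐ[ℂ] Module.End ℂ M) (σ : A →ₐ[ℂ] Module.End ℂ N)
    (T : M →ₗ[ℂ] N) : Prop :=
  ∀ (a : A) (v : M), T (ρ a v) = σ a (T v)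

/-- The `A`-modules given by `ρ` and `σ` are isomorphic. -/
def AreIsomorphic {A M N : Type*} [Ring A] [Algebra ℂ A] [AddCommGroup M] [Module ℂ M]
    [AddCommGroup N] [Module ℂ N] (ρ : A →ₐ[ℂ] Module.End ℂ M)
    (σ : A →ₐ[ℂ] Module.End ℂ N) : Prop :=
  ∃ T : M ≃ₗ[ℂ] N, IsModuleHom ρ σ T.toLinearMap

/-- The vector space underlying the `A`-submodule generated by `v`. -/
def cyclic {A M : Type*} [Ring A] [Algebra ℂ A] [AddCommGroup M] [Module ℂ M]
    (ρ : A →ₐ[ℂ] Module.End ℂ M) (v : M) : Submodule ℂ M :=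
  Submodule.span ℂ (Set.range fun a : A => ρ a v)

/-- The action of `A` on the submodule generated by `v`. -/
def cyclicRep {A M : Type*} [Ring A] [Algebra ℂ A] [AddCommGroup M] [Module ℂ M]
    (ρ : A →ₐ[ℂ] Module.End ℂ M) (v : M) : A →ₐ[ℂ] Module.End ℂ (cyclic ρ v) :=
  have h : ∀ a : A, ∀ w ∈ cyclic ρ v, ρ a w ∈ cyclic ρ v := fun a w hw => by
    induction hw using Submodule.span_induction with
    | mem w hw =>
      obtain ⟨b, rfl⟩ := hw
      exact Submodule.subset_span ⟨a * b, by simp⟩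
    | zero => simp
    | add w₁ w₂ _ _ h₁ h₂ => simpa using add_mem h₁ h₂
    | smul c w _ hw => simpa using Submodule.smul_mem _ c hw
  AlgHom.ofLinearMap
    { toFun := fun a => (ρ a).restrict (h a)
      map_add' := fun a b => by ext w; simp
      map_smul' := fun c a => by ext w; simp }
    (by ext w; simp) (fun a b => by ext w; simp)

theorem bijective_of_isInternal {p : ℕ} {M : Type*} [AddCommGroup M] [Module ℂ M]
    {W : Fin p → Submodule ℂ M} (h : DirectSum.IsInternal W) :
    Function.Bijective (DirectSum.coeLinearMap W) := h

/-- The projection onto the `l`-th summand of an internal direct sum decomposition. -/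
def summandProj {p : ℕ} {M : Type*} [AddCommGroup M] [Module ℂ M] {W : Fin p → Submodule ℂ M}
    (h : DirectSum.IsInternal W) (l : Fin p) : M →ₗ[ℂ] M :=
  (W l).subtype ∘ₗ DirectSum.component ℂ (Fin p) (fun k => W k) l ∘ₗ
    (LinearEquiv.ofBijective (DirectSum.coeLinearMap W) (bijective_of_isInternal h)).symm.toLinearMap

/-! ### Highest weight vectors, conditions and the coefficients of the intertwiner -/

/-- The highest weight vector `Ω_l = ∑_{i=0}^{l} c_{i,l-i} v_i ⊗ w_{l-i}` of `V_lam₁ ⊗ V_lam₂`. -/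
def Omega (q : ℂˣ) (p : ℕ) (lam₁ lam₂ : ℂ) (l : ℕ) : VV p :=
  ∑ i ∈ Finset.range (l + 1),
    ((-1) ^ i * (q : ℂ) ^ ((i : ℂ) * (2 * l - i - lam₂ - 1)) *
      ∏ j ∈ Finset.range (i + 1), qnum q (lam₂ - l + j) / qnum q (lam₁ - j + 1)) •
    (nb p i ⊗ₜ[ℂ] nb p (l - i))

/-- Non-degeneracy of the highest weights `lam₁`, `lam₂` and `lam₁ + lam₂ - 2j`. -/
def Condition1 (q : ℂˣ) (p : ℕ) (lam₁ lam₂ : ℂ) : Prop :=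
  (∀ i ≤ p, qnum q (lam₁ + 1 - (i : ℂ)) ≠ 0 ∧ qnum q (lam₂ + 1 - (i : ℂ)) ≠ 0) ∧
  ∀ i ≤ p, ∀ j < p, qnum q (lam₁ + lam₂ - 2 * (j : ℂ) + 1 - (i : ℂ)) ≠ 0

/-- `y / x ≠ q ^ (lam₁ + lam₂ - 2(l - 1))` for `l = 1, …, p - 1`. -/
def Condition2 (q : ℂˣ) (p : ℕ) (lam₁ lam₂ : ℂ) (x y : ℂˣ) : Prop :=
  ∀ l : ℕ, 1 ≤ l → l ≤ p - 1 →
    (y : ℂ) / (x : ℂ) ≠ (q : ℂ) ^ (lam₁ + lam₂ - 2 * ((l : ℂ) - 1))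

/-- `y / x ≠ q ^ (-(lam₁ + lam₂ - 2(l - 1)))` for `l = 1, …, p - 1`. -/
def Condition3 (q : ℂˣ) (p : ℕ) (lam₁ lam₂ : ℂ) (x y : ℂˣ) : Prop :=
  ∀ l : ℕ, 1 ≤ l → l ≤ p - 1 →
    (y : ℂ) / (x : ℂ) ≠ (q : ℂ) ^ (-(lam₁ + lam₂ - 2 * ((l : ℂ) - 1)))

/-- Numerator of the `j`-th factor of the coefficient `c_l`. -/
def cNum (q : ℂˣ) (lam₁ lam₂ : ℂ) (x y : ℂˣ) (j : ℕ) : ℂ :=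
  qnum q (lam₂ - j) *
    ((x : ℂ) * (q : ℂ) ^ lam₁ - (y : ℂ) * (q : ℂ) ^ (-lam₂ + 2 * (j : ℂ) - 2))

/-- Denominator of the `j`-th factor of the coefficient `c_l`. -/
def cDen (q : ℂˣ) (lam₁ lam₂ : ℂ) (x y : ℂˣ) (j : ℕ) : ℂ :=
  qnum q (lam₁ - j) *
    (-((x : ℂ) * (q : ℂ) ^ (-lam₁ + 2 * (j : ℂ) - 2)) + (y : ℂ) * (q : ℂ) ^ lam₂)

/-- The coefficient `c_l` (with `c_0 = 1`). -/
def cCoeff (q : ℂˣ) (lam₁ lam₂ : ℂ) (x y : ℂˣ) (l : ℕ) : ℂ :=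
  ∏ j ∈ Finset.Icc 1 l, cNum q lam₁ lam₂ x y j / cDen q lam₁ lam₂ x y j

/-- The operator `Ř = ∑_l c_l I ∘ P_l`. -/
def Rcheck (q : ℂˣ) {p : ℕ} (lam₁ lam₂ : ℂ) (x y : ℂˣ) (I : VV p ≃ₗ[ℂ] VV p)
    (P : Fin p → (VV p →ₗ[ℂ] VV p)) : VV p →ₗ[ℂ] VV p :=
  ∑ l : Fin p, cCoeff q lam₁ lam₂ x y l • (I.toLinearMap ∘ₗ P l)

end

end QuantumAffine

open QuantumAffine

/-!
The module `V_{λ₁} ⊗ V_{λ₂}` is studied through *row zero*: the map `row p 0` keeping the component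
`v_0 ⊗ w` of a tensor. A vector killed by `e` is determined by its row zero, since `e u = 0`
expresses each row through the previous one (`eq_zero_of_e_of_row_zero`). Moreover row zero of
`f u`, `K u`, `e_0 u` and `f_0 u` is computed from row zero of `u` and of `e u` alone. Hence an
identity between two vectors may be checked after applying `e`, which lowers the degree, and after
taking row zero, which leaves a multiple of one basis vector of `V_{λ₂}`. Most computations below
are of this kind.

The vectors `Ω_l` are killed by `e` and have row zero proportional to `w_l`, so they span the
highest weight vectors. As `f ^ p Ω_l = 0` (again killed by `e`, with vanishing row zero), `Ω_l`
generates an image of `V_{λ₁+λ₂-2l}`. The sum of these images is direct: by downward action of `e`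
a relation reduces to one between the `Ω_l`, and their row zeros are independent. A dimension count
finishes the decomposition (`sumEquiv`, `isInternal_cyclic_Omega`) and gives `I` (`swapEquiv`).

A homomorphism `T` over the affine algebra is in particular one over `U_q(sl₂)`, hence multiplies
the rescaled highest weight vectors `Ξ_l` by scalars `τ_l`. Since `f_0` commutes with `e`, one has
`f_0 Ξ_l = δ_l Ξ_{l-1}`, and comparison gives a recursion `τ_{l+1} δ'_{l+1} = τ_l δ_{l+1}`, where
`δ_{l+1}` and `δ'_{l+1}` vanish exactly when Condition 2, respectively Condition 3, fails at the
index `l + 1`. The two cannot fail at the same index by Condition 1, so invertibility of `T` forces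
both (`conditions_of_areIsomorphic`).

Conversely let `T` be a `U_q(sl₂)`-homomorphism whose scalars satisfy the recursion, as those of `Ř`
do. The vectors `f_0 f Ξ_l` and `f_0 f² Ξ_l` are expanded in the decomposition; the diagonal
coefficient `epsCoeff` is symmetric under exchange of the two modules, and the coefficient
`zetaCoeff` of `Ξ_{l+1}` matches the recursion (`epsCoeff_symm`, `zetaCoeff_eq`). The Serre relation
propagates `T f_0 = f_0 T` to all `f ^ k Ξ_l` (`comm_f_zero`). For `e_0` no further expansion is
needed: the defect `T e_0 - e_0 T` commutes with `f_1` and `f_0`, which generate everything from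
`Ξ_0` because `zetaCoeff ≠ 0`, so it vanishes once it vanishes on `Ξ_0` (`comm_e_zero`).
-/

namespace QuantumAffine

/-! ### Module homomorphisms and generators -/

section generators

variable {q : ℂˣ} {M N : Type*} [AddCommGroup M] [Module ℂ M] [AddCommGroup N] [Module ℂ N]

theorem isModuleHom_of_adjoin {A : Type*} [Ring A] [Algebra ℂ A] {ρ : A →ₐ[ℂ] Module.End ℂ M}
    {σ : A →ₐ[ℂ] Module.End ℂ N} {T : M →ₗ[ℂ] N} {s : Set A} (hs : Algebra.adjoin ℂ s = ⊤)
    (h : ∀ a ∈ s, ∀ v, T (ρ a v) = σ a (T v)) : IsModuleHom ρ σ T := by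
  intro a
  have ha : a ∈ Algebra.adjoin ℂ s := hs ▸ Algebra.mem_top
  induction ha using Algebra.adjoin_induction with
  | mem a ha => exact h a ha
  | algebraMap c => intro v; simp [Module.algebraMap_end_apply]
  | add a b _ _ ha hb => intro v; simp [ha, hb]
  | mul a b _ _ ha hb => intro v; simp [ha, hb]

theorem adjoin_sl2 (q : ℂˣ) : Algebra.adjoin ℂ (Set.range (sl2 q)) = ⊤ := by
  have h := congrArg (Subalgebra.map (mkSl2 q)) (FreeAlgebra.adjoin_range_ι ℂ Sl2Gen)
  rw [AlgHom.map_adjoin, ← Set.range_comp, Algebra.map_top] at h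
  rw [show sl2 q = mkSl2 q ∘ FreeAlgebra.ι ℂ from rfl, h]
  exact (AlgHom.range_eq_top _).2 (RingQuot.mkAlgHom_surjective ℂ _)

theorem adjoin_aff (q : ℂˣ) : Algebra.adjoin ℂ (Set.range (aff q)) = ⊤ := by
  have h := congrArg (Subalgebra.map (mkAff q)) (FreeAlgebra.adjoin_range_ι ℂ AffGen)
  rw [AlgHom.map_adjoin, ← Set.range_comp, Algebra.map_top] at h
  rw [show aff q = mkAff q ∘ FreeAlgebra.ι ℂ from rfl, h]
  exact (AlgHom.range_eq_top _).2 (RingQuot.mkAlgHom_surjective ℂ _)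

theorem isModuleHom_sl2 {ρ : UqSl2 q →ₐ[ℂ] Module.End ℂ M} {σ : UqSl2 q →ₐ[ℂ] Module.End ℂ N}
    {T : M →ₗ[ℂ] N} (h : ∀ g v, T (ρ (sl2 q g) v) = σ (sl2 q g) (T v)) : IsModuleHom ρ σ T :=
  isModuleHom_of_adjoin (adjoin_sl2 q) (by rintro _ ⟨g, rfl⟩; exact h g)

theorem isModuleHom_aff {ρ : UqAff q →ₐ[ℂ] Module.End ℂ M} {σ : UqAff q →ₐ[ℂ] Module.End ℂ N}
    {T : M →ₗ[ℂ] N} (h : ∀ g v, T (ρ (aff q g) v) = σ (aff q g) (T v)) : IsModuleHom ρ σ T :=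
  isModuleHom_of_adjoin (adjoin_aff q) (by rintro _ ⟨g, rfl⟩; exact h g)

theorem IsModuleHom.pow {A : Type*} [Ring A] [Algebra ℂ A] {ρ : A →ₐ[ℂ] Module.End ℂ M}
    {σ : A →ₐ[ℂ] Module.End ℂ N} {T : M →ₗ[ℂ] N} (h : IsModuleHom ρ σ T) (a : A) (k : ℕ) (v : M) :
    T ((ρ a ^ k) v) = (σ a ^ k) (T v) := by
  rw [← map_pow, ← map_pow, h]

end generators

/-! ### Quantum integers -/

section qnum

variable {q : ℂˣ} {p : ℕ}

theorem qnum_eq (q : ℂˣ) (z : ℂ) :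
    qnum q z = ((q : ℂ) ^ z - ((q : ℂ) ^ z)⁻¹) / ((q : ℂ) - (q : ℂ)⁻¹) := by
  rw [qnum, Complex.cpow_neg]

theorem q_sub_inv_ne_zero (hp : Odd p) (hp1 : 1 < p) (hq : IsPrimitiveRoot q p) :
    (q : ℂ) - (q : ℂ)⁻¹ ≠ 0 := by
  intro h
  have h0 := q.ne_zero
  have h2 : q ^ 2 = 1 := by
    ext
    push_cast
    field_simp at h
    linear_combination h
  have := Nat.le_of_dvd two_pos (hq.dvd_of_pow_eq_one _ h2)
  obtain ⟨k, rfl⟩ := hp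
  omega

theorem qnum_natCast_ne_zero (hp : Odd p) (hp1 : 1 < p) (hq : IsPrimitiveRoot q p) {k : ℕ}
    (h0 : 0 < k) (hk : k < p) : qnum q k ≠ 0 := by
  have hd := q_sub_inv_ne_zero hp hp1 hq
  rw [qnum_eq, Complex.cpow_natCast]
  refine div_ne_zero (fun h => ?_) hd
  have hq0 := q.ne_zero
  have h2 : q ^ (2 * k) = 1 := by
    ext
    push_cast
    have := pow_ne_zero k hq0
    field_simp at h
    linear_combination h
  have h3 := (Nat.Coprime.dvd_of_dvd_mul_left hp.coprime_two_right
    (hq.dvd_of_pow_eq_one _ h2))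
  exact absurd (Nat.le_of_dvd h0 h3) (by omega)

theorem qnum_zero (q : ℂˣ) : qnum q 0 = 0 := by simp [qnum]

theorem qnum_natCast_self (hqp : q ^ p = 1) : qnum q p = 0 := by
  have : (q : ℂ) ^ p = 1 := by rw [← Units.val_pow_eq_pow_val, hqp, Units.val_one]
  rw [qnum_eq, Complex.cpow_natCast, this]
  simp

theorem cpow_sub_self (hqp : q ^ p = 1) (z : ℂ) : (q : ℂ) ^ (z - p) = (q : ℂ) ^ z := by
  have : (q : ℂ) ^ p = 1 := by rw [← Units.val_pow_eq_pow_val, hqp, Units.val_one]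
  rw [cpow_sub_nat, this, inv_one, mul_one]

theorem qnum_sub_self (hqp : q ^ p = 1) (z : ℂ) : qnum q (z - p) = qnum q z := by
  rw [qnum_eq, qnum_eq, cpow_sub_self hqp]

/-- The quantum factorial `[k]! = [1][2]⋯[k]`. -/
noncomputable def qfact (q : ℂˣ) (k : ℕ) : ℂ := ∏ j ∈ Finset.range k, qnum q ((j : ℂ) + 1)

theorem qfact_zero (q : ℂˣ) : qfact q 0 = 1 := by simp [qfact]

theorem qfact_succ (q : ℂˣ) (k : ℕ) : qfact q (k + 1) = qfact q k * qnum q ((k : ℂ) + 1) := by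
  rw [qfact, Finset.prod_range_succ, qfact]

theorem qfact_ne_zero (hp : Odd p) (hp1 : 1 < p) (hq : IsPrimitiveRoot q p) {k : ℕ}
    (hk : k < p) : qfact q k ≠ 0 :=
  Finset.prod_ne_zero_iff.2 fun j hj => by
    have := qnum_natCast_ne_zero hp hp1 hq (Nat.succ_pos j)
      (lt_of_le_of_lt (Nat.succ_le_of_lt (Finset.mem_range.1 hj)) hk)
    simpa using this

end qnum

/-! ### Highest weight vectors in a module over `U_q(sl₂)` -/

section highestWeight

variable {q : ℂˣ} {p : ℕ} {L : ℂ} {M : Type*} [AddCommGroup M] [Module ℂ M]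
  {ρ : UqSl2 q →ₐ[ℂ] Module.End ℂ M} {u : M}

theorem rep_K_f (ρ : UqSl2 q →ₐ[ℂ] Module.End ℂ M) (v : M) :
    ρ (sl2 q .K) (ρ (sl2 q .f) v) = ((q : ℂ)⁻¹) ^ 2 • ρ (sl2 q .f) (ρ (sl2 q .K) v) := by
  have := congrArg (fun a => ρ a v) (mul_inv_comm_of_conj (sl2_Kinv_K q) (sl2_K_f q))
  simpa using this

theorem rep_e_f (ρ : UqSl2 q →ₐ[ℂ] Module.End ℂ M) (v : M) :
    ρ (sl2 q .e) (ρ (sl2 q .f) v) = ρ (sl2 q .f) (ρ (sl2 q .e) v) +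
      ((q : ℂ) - (q : ℂ)⁻¹)⁻¹ • (ρ (sl2 q .K) v - ρ (sl2 q .Kinv) v) := by
  have := congrArg (fun a => ρ a v) (sl2_e_f q)
  simp only [map_sub, map_mul, map_smul, LinearMap.sub_apply, Module.End.mul_apply,
    LinearMap.smul_apply] at this
  rw [← this]
  abel

theorem rep_Kinv_of_K (ρ : UqSl2 q →ₐ[ℂ] Module.End ℂ M) {v : M} {c : ℂ}
    (h : ρ (sl2 q .K) v = (q : ℂ) ^ c • v) : ρ (sl2 q .Kinv) v = (q : ℂ) ^ (-c) • v := by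
  have h1 := congrArg (fun a => ρ a v) (sl2_Kinv_K q)
  simp only [map_mul, map_one, Module.End.mul_apply, Module.End.one_apply, h, map_smul] at h1
  conv_rhs => rw [← h1]
  rw [smul_smul, ← Complex.cpow_add _ _ q.ne_zero]
  simp

theorem rep_K_pow_f (hK : ρ (sl2 q .K) u = (q : ℂ) ^ L • u) (k : ℕ) :
    ρ (sl2 q .K) ((ρ (sl2 q .f) ^ k) u) = (q : ℂ) ^ (L - 2 * k) • (ρ (sl2 q .f) ^ k) u := by
  induction k with
  | zero => simpa using hK
  | succ k ih =>
    rw [pow_succ', Module.End.mul_apply, rep_K_f, ih, map_smul, smul_smul,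
      show L - 2 * ((k + 1 : ℕ) : ℂ) = L - 2 * k - (2 : ℕ) by push_cast; ring, cpow_sub_nat,
      inv_pow, mul_comm]

theorem rep_e_pow_f (he : ρ (sl2 q .e) u = 0) (hK : ρ (sl2 q .K) u = (q : ℂ) ^ L • u) (k : ℕ) :
    ρ (sl2 q .e) ((ρ (sl2 q .f) ^ (k + 1)) u) =
      (qnum q ((k : ℂ) + 1) * qnum q (L - k)) • (ρ (sl2 q .f) ^ k) u := by
  have key : ∀ k : ℕ, ρ (sl2 q .f) (ρ (sl2 q .e) ((ρ (sl2 q .f) ^ k) u)) =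
      (qnum q (L - k + 1) * qnum q k) • (ρ (sl2 q .f) ^ k) u →
      ρ (sl2 q .e) ((ρ (sl2 q .f) ^ (k + 1)) u) =
      (qnum q ((k : ℂ) + 1) * qnum q (L - k)) • (ρ (sl2 q .f) ^ k) u := fun k h => by
    have hK' := rep_K_pow_f (ρ := ρ) hK k
    rw [pow_succ', Module.End.mul_apply, rep_e_f, h, hK', rep_Kinv_of_K ρ hK', ← sub_smul,
      smul_smul, ← add_smul, ← qnum_identity]
    congr 1
    ring
  induction k with
  | zero => exact key 0 (by simp [he, qnum_zero])
  | succ k ih =>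
    refine key _ ?_
    rw [ih, map_smul, ← Module.End.mul_apply, ← pow_succ', mul_comm]
    push_cast
    congr 3
    ring_nf

/-- The linear map from the space of `V_L` to `M` sending `v_k` to the divided power
`f ^ k u / [k]!`. -/
noncomputable def hwMap (ρ : UqSl2 q →ₐ[ℂ] Module.End ℂ M) (p : ℕ) (u : M) :
    (Fin p → ℂ) →ₗ[ℂ] M :=
  (Pi.basisFun ℂ (Fin p)).constr ℂ fun k => (qfact q k)⁻¹ • (ρ (sl2 q .f) ^ (k : ℕ)) u

theorem hwMap_nb {k : ℕ} (hk : k < p) :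
    hwMap ρ p u (nb p k) = (qfact q k)⁻¹ • (ρ (sl2 q .f) ^ k) u := by
  have := (Pi.basisFun ℂ (Fin p)).constr_basis ℂ
    (fun k : Fin p => (qfact q k)⁻¹ • (ρ (sl2 q .f) ^ (k : ℕ)) u) ⟨k, hk⟩
  rwa [basisFun_eq_nb] at this

theorem V_gen (hqp : q ^ p = 1) (lam : ℂ) (g : Sl2Gen) :
    V q hqp lam (sl2 q g) = verGen q p lam g := liftSl2_gen _ _ _

theorem linearMap_ext_nb {S T : (Fin p → ℂ) →ₗ[ℂ] M} (h : ∀ n < p, S (nb p n) = T (nb p n)) :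
    S = T := by
  refine (Pi.basisFun ℂ (Fin p)).ext fun i => ?_
  rw [basisFun_eq_nb]
  exact h i i.isLt

/-- A highest weight vector of weight `L` killed by `f ^ p` is the image of `v_0` under a
homomorphism from `V_L`. -/
theorem hwMap_isModuleHom (hp : Odd p) (hp1 : 1 < p) (hq : IsPrimitiveRoot q p)
    (he : ρ (sl2 q .e) u = 0) (hK : ρ (sl2 q .K) u = (q : ℂ) ^ L • u)
    (hf : (ρ (sl2 q .f) ^ p) u = 0) :
    IsModuleHom (V q hq.pow_eq_one L) ρ (hwMap ρ p u) := by
  refine isModuleHom_sl2 fun g => ?_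
  suffices h : hwMap ρ p u ∘ₗ V q hq.pow_eq_one L (sl2 q g) = ρ (sl2 q g) ∘ₗ hwMap ρ p u from
    fun v => LinearMap.congr_fun h v
  refine linearMap_ext_nb fun k hk => ?_
  have hK' := rep_K_pow_f (ρ := ρ) hK k
  simp only [LinearMap.comp_apply, V_gen, hwMap_nb hk, map_smul]
  cases g with
  | K => rw [ver_K, map_smul, hwMap_nb hk, hK', smul_comm]
  | Kinv => rw [ver_Kinv, map_smul, hwMap_nb hk, rep_Kinv_of_K ρ hK', smul_comm]
  | f =>
    rw [ver_f, map_smul, ← Module.End.mul_apply, ← pow_succ']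
    rcases lt_or_eq_of_le (Nat.succ_le_of_lt hk) with h | h
    · have h1 := qfact_ne_zero hp hp1 hq h
      rw [Nat.succ_eq_add_one, qfact_succ] at h1
      rw [hwMap_nb h, smul_smul, Nat.succ_eq_add_one, qfact_succ]
      congr 1
      have := left_ne_zero_of_mul h1
      have := right_ne_zero_of_mul h1
      field_simp
    · rw [Nat.succ_eq_add_one] at h
      rw [h, hf, nb_of_le p le_rfl, map_zero, smul_zero, smul_zero]
  | e =>
    rcases k with _ | k
    · simp [ver_e_zero, he]
    · have h1 := qfact_ne_zero hp hp1 hq hk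
      rw [qfact_succ] at h1
      rw [ver_e_succ q p L hk, map_smul, hwMap_nb (by omega), rep_e_pow_f he hK, smul_smul,
        smul_smul, qfact_succ]
      congr 1
      have := left_ne_zero_of_mul h1
      have := right_ne_zero_of_mul h1
      field_simp

end highestWeight

/-! ### The basis `[m]! v_m` of `V_λ` -/

section scaledBasis

variable {q : ℂˣ} {p : ℕ}

/-- The vector `f ^ m v_0 = [m]! v_m`; it vanishes for `m ≥ p`. -/
noncomputable def fvec (q : ℂˣ) (p m : ℕ) : Fin p → ℂ := qfact q m • nb p m

theorem fvec_of_le {m : ℕ} (h : p ≤ m) : fvec q p m = 0 := by rw [fvec, nb_of_le p h, smul_zero]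

theorem ver_f_fvec (lam : ℂ) (m : ℕ) : verGen q p lam .f (fvec q p m) = fvec q p (m + 1) := by
  rw [fvec, map_smul, ver_f, smul_smul, fvec, qfact_succ]

theorem ver_Kinv_fvec (lam : ℂ) (m : ℕ) :
    verGen q p lam .Kinv (fvec q p m) = (q : ℂ) ^ (-(lam - 2 * m)) • fvec q p m := by
  rw [fvec, map_smul, ver_Kinv, smul_comm]

theorem ver_e_fvec_zero (lam : ℂ) : verGen q p lam .e (fvec q p 0) = 0 := by
  rw [fvec, map_smul, ver_e_zero, smul_zero]

theorem ver_e_fvec_succ (hqp : q ^ p = 1) (lam : ℂ) (m : ℕ) :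
    verGen q p lam .e (fvec q p (m + 1)) =
      (qnum q ((m : ℂ) + 1) * qnum q (lam - m)) • fvec q p m := by
  have hqp' : (q : ℂ) ^ p = 1 := by rw [← Units.val_pow_eq_pow_val, hqp, Units.val_one]
  rcases lt_or_ge m p with h | h
  · rw [fvec, map_smul, qfact_succ, mul_smul, qnum_smul_e q lam hqp' h, fvec, smul_comm]
  · rw [fvec_of_le h, fvec_of_le (Nat.le_succ_of_le h), map_zero, smul_zero]

theorem ver_Kinv_K (lam : ℂ) (v : Fin p → ℂ) :
    verGen q p lam .Kinv (verGen q p lam .K v) = v := by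
  have h1 : verGen q p lam .Kinv ∘ₗ verGen q p lam .K = LinearMap.id :=
    linearMap_ext_nb fun n _ => by
      rw [LinearMap.comp_apply, ver_K, map_smul, ver_Kinv, smul_smul,
        ← Complex.cpow_add _ _ q.ne_zero]
      simp
  exact LinearMap.congr_fun h1 v

theorem eq_zero_of_ver_K (lam : ℂ) {v : Fin p → ℂ} (h : verGen q p lam .K v = 0) : v = 0 := by
  rw [← ver_Kinv_K (q := q) lam v, h, map_zero]

end scaledBasis

/-! ### Action of the generators on tensor products -/

section tensorAction

variable {q : ℂˣ} {p : ℕ} (hqp : q ^ p = 1) (lam₁ lam₂ : ℂ) (x y : ℂˣ)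

theorem tensorRep_tmul {A B M N : Type*} [Ring A] [Algebra ℂ A] [Ring B] [Algebra ℂ B]
    [AddCommGroup M] [Module ℂ M] [AddCommGroup N] [Module ℂ N]
    (ρ : A →ₐ[ℂ] Module.End ℂ M) (σ : B →ₐ[ℂ] Module.End ℂ N) (a : A) (b : B) (v : M) (w : N) :
    tensorRep ρ σ (a ⊗ₜ b) (v ⊗ₜ w) = ρ a v ⊗ₜ[ℂ] σ b w := rfl

theorem sl2Tensor_e (v w : Fin p → ℂ) : sl2Tensor q hqp lam₁ lam₂ (sl2 q .e) (v ⊗ₜ w) =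
    verGen q p lam₁ .e v ⊗ₜ verGen q p lam₂ .K w + v ⊗ₜ verGen q p lam₂ .e w := by
  simp [sl2Tensor, comulSl2, liftSl2_gen, comulSl2Gen, tensorRep_tmul, V_gen]

theorem sl2Tensor_f (v w : Fin p → ℂ) : sl2Tensor q hqp lam₁ lam₂ (sl2 q .f) (v ⊗ₜ w) =
    verGen q p lam₁ .f v ⊗ₜ w + verGen q p lam₁ .Kinv v ⊗ₜ verGen q p lam₂ .f w := by
  simp [sl2Tensor, comulSl2, liftSl2_gen, comulSl2Gen, tensorRep_tmul, V_gen]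

theorem sl2Tensor_K (v w : Fin p → ℂ) : sl2Tensor q hqp lam₁ lam₂ (sl2 q .K) (v ⊗ₜ w) =
    verGen q p lam₁ .K v ⊗ₜ verGen q p lam₂ .K w := by
  simp [sl2Tensor, comulSl2, liftSl2_gen, comulSl2Gen, tensorRep_tmul, V_gen]

theorem affTensor_e_one :
    affTensor q hqp lam₁ x lam₂ y (aff q (.e 1)) = sl2Tensor q hqp lam₁ lam₂ (sl2 q .e) := by
  simp [affTensor, sl2Tensor, comulSl2, comulAff, ev, liftSl2_gen, liftAff_gen, comulSl2Gen,
    comulAffGen, evGen]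

theorem affTensor_f_one :
    affTensor q hqp lam₁ x lam₂ y (aff q (.f 1)) = sl2Tensor q hqp lam₁ lam₂ (sl2 q .f) := by
  simp [affTensor, sl2Tensor, comulSl2, comulAff, ev, liftSl2_gen, liftAff_gen, comulSl2Gen,
    comulAffGen, evGen]

theorem affTensor_K_one :
    affTensor q hqp lam₁ x lam₂ y (aff q (.K 1)) = sl2Tensor q hqp lam₁ lam₂ (sl2 q .K) := by
  simp [affTensor, sl2Tensor, comulSl2, comulAff, ev, liftSl2_gen, liftAff_gen, comulSl2Gen,
    comulAffGen, evGen]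

theorem affTensor_Kinv_one :
    affTensor q hqp lam₁ x lam₂ y (aff q (.Kinv 1)) =
      sl2Tensor q hqp lam₁ lam₂ (sl2 q .Kinv) := by
  simp [affTensor, sl2Tensor, comulSl2, comulAff, ev, liftSl2_gen, liftAff_gen, comulSl2Gen,
    comulAffGen, evGen]

theorem affTensor_K_zero :
    affTensor q hqp lam₁ x lam₂ y (aff q (.K 0)) = sl2Tensor q hqp lam₁ lam₂ (sl2 q .Kinv) := by
  simp [affTensor, sl2Tensor, comulSl2, comulAff, ev, liftSl2_gen, liftAff_gen, comulSl2Gen,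
    comulAffGen, evGen]

theorem affTensor_Kinv_zero :
    affTensor q hqp lam₁ x lam₂ y (aff q (.Kinv 0)) = sl2Tensor q hqp lam₁ lam₂ (sl2 q .K) := by
  simp [affTensor, sl2Tensor, comulSl2, comulAff, ev, liftSl2_gen, liftAff_gen, comulSl2Gen,
    comulAffGen, evGen]

theorem affTensor_e_zero (v w : Fin p → ℂ) :
    affTensor q hqp lam₁ x lam₂ y (aff q (.e 0)) (v ⊗ₜ w) =
      ((q : ℂ)⁻¹ * x) • (verGen q p lam₁ .f v ⊗ₜ[ℂ] verGen q p lam₂ .Kinv w) +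
        ((q : ℂ)⁻¹ * y) • (v ⊗ₜ[ℂ] verGen q p lam₂ .f w) := by
  simp [affTensor, comulAff, liftAff_gen, comulAffGen, ev, evGen, tensorRep_tmul, V_gen,
    TensorProduct.smul_tmul']

theorem affTensor_f_zero (v w : Fin p → ℂ) :
    affTensor q hqp lam₁ x lam₂ y (aff q (.f 0)) (v ⊗ₜ w) =
      ((q : ℂ) * (x : ℂ)⁻¹) • (verGen q p lam₁ .e v ⊗ₜ[ℂ] w) +
        ((q : ℂ) * (y : ℂ)⁻¹) • (verGen q p lam₁ .K v ⊗ₜ[ℂ] verGen q p lam₂ .e w) := by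
  simp [affTensor, comulAff, liftAff_gen, comulAffGen, ev, evGen, tensorRep_tmul, V_gen,
    TensorProduct.smul_tmul']

end tensorAction

/-! ### Rows of a tensor -/

section rows

variable {q : ℂˣ} {p : ℕ}

/-- The `i`-th coordinate functional, extended by zero to `i ≥ p`. -/
noncomputable def coord (p i : ℕ) : (Fin p → ℂ) →ₗ[ℂ] ℂ :=
  if h : i < p then LinearMap.proj ⟨i, h⟩ else 0

theorem coord_nb {i n : ℕ} (hn : n < p) : coord p i (nb p n) = if i = n then 1 else 0 := by
  unfold coord
  split_ifs with h1 h2 h2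
  · simp [nb, h2]
  · simp [nb, h2]
  · omega
  · rfl

theorem coord_e (lam : ℂ) (i : ℕ) (v : Fin p → ℂ) :
    coord p i (verGen q p lam .e v) = qnum q (lam - i) * coord p (i + 1) v := by
  suffices h : coord p i ∘ₗ verGen q p lam .e = qnum q (lam - i) • coord p (i + 1) from
    LinearMap.congr_fun h v
  refine linearMap_ext_nb fun n hn => ?_
  rcases n with _ | n
  · simp [ver_e_zero, coord_nb hn]
  · simp only [LinearMap.comp_apply, LinearMap.smul_apply, ver_e_succ q p lam hn, map_smul,
      coord_nb hn, coord_nb (show n < p by omega), smul_eq_mul]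
    split_ifs with h1 h2 h2
    · rw [h1]
    · omega
    · omega
    · simp

theorem coord_K (lam : ℂ) (i : ℕ) (v : Fin p → ℂ) :
    coord p i (verGen q p lam .K v) = (q : ℂ) ^ (lam - 2 * i) * coord p i v := by
  suffices h : coord p i ∘ₗ verGen q p lam .K = ((q : ℂ) ^ (lam - 2 * i)) • coord p i from
    LinearMap.congr_fun h v
  refine linearMap_ext_nb fun n hn => ?_
  simp only [LinearMap.comp_apply, LinearMap.smul_apply, ver_K, map_smul, coord_nb hn, smul_eq_mul]
  split_ifs with h
  · rw [h]
  · simp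

theorem coord_Kinv (lam : ℂ) (i : ℕ) (v : Fin p → ℂ) :
    coord p i (verGen q p lam .Kinv v) = (q : ℂ) ^ (-(lam - 2 * i)) * coord p i v := by
  suffices h : coord p i ∘ₗ verGen q p lam .Kinv = ((q : ℂ) ^ (-(lam - 2 * i))) • coord p i from
    LinearMap.congr_fun h v
  refine linearMap_ext_nb fun n hn => ?_
  simp only [LinearMap.comp_apply, LinearMap.smul_apply, ver_Kinv, map_smul, coord_nb hn,
    smul_eq_mul]
  split_ifs with h
  · rw [h]
  · simp

theorem coord_zero_f (lam : ℂ) (v : Fin p → ℂ) : coord p 0 (verGen q p lam .f v) = 0 := by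
  suffices h : coord p 0 ∘ₗ verGen q p lam .f = 0 from LinearMap.congr_fun h v
  refine linearMap_ext_nb fun n hn => ?_
  rw [LinearMap.comp_apply, ver_f, map_smul, LinearMap.zero_apply]
  rcases lt_or_ge (n + 1) p with h | h
  · rw [coord_nb h, if_neg (by omega), smul_zero]
  · rw [nb_of_le p h, map_zero, smul_zero]

/-- The `i`-th row of a tensor: the `w_i` in the expansion `∑ i, v_i ⊗ w_i`
(zero for `i ≥ p`). -/
noncomputable def row (p i : ℕ) : VV p →ₗ[ℂ] (Fin p → ℂ) :=
  (TensorProduct.lid ℂ (Fin p → ℂ)).toLinearMap ∘ₗ (coord p i).rTensor (Fin p → ℂ)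

theorem row_tmul (i : ℕ) (v w : Fin p → ℂ) : row p i (v ⊗ₜ w) = coord p i v • w := by
  simp [row]

theorem eq_zero_of_row_eq_zero {u : VV p} (h : ∀ i < p, row p i u = 0) : u = 0 := by
  have key : ∀ u : VV p, ∑ i : Fin p, nb p i ⊗ₜ[ℂ] row p i u = u := by
    intro u
    induction u using TensorProduct.induction_on with
    | zero => simp
    | add u v hu hv => simp only [map_add, TensorProduct.tmul_add, Finset.sum_add_distrib, hu, hv]
    | tmul v w =>
      simp only [row_tmul, ← TensorProduct.smul_tmul, ← TensorProduct.sum_tmul]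
      congr 1
      ext j
      simp [nb, coord, Finset.sum_apply, ← Fin.ext_iff]
  rw [← key u]
  exact Finset.sum_eq_zero fun i _ => by rw [h i i.isLt, TensorProduct.tmul_zero]

variable (hqp : q ^ p = 1) (lam₁ lam₂ : ℂ) (x y : ℂˣ)

theorem row_e (i : ℕ) (u : VV p) : row p i (sl2Tensor q hqp lam₁ lam₂ (sl2 q .e) u) =
    qnum q (lam₁ - i) • verGen q p lam₂ .K (row p (i + 1) u) +
      verGen q p lam₂ .e (row p i u) := by
  induction u using TensorProduct.induction_on with
  | zero => simp
  | add u v hu hv => simp only [map_add, hu, hv, smul_add]; abel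
  | tmul v w =>
    simp only [sl2Tensor_e, map_add, row_tmul, coord_e, map_smul, mul_smul]

theorem row_zero_f (u : VV p) : row p 0 (sl2Tensor q hqp lam₁ lam₂ (sl2 q .f) u) =
    (q : ℂ) ^ (-lam₁) • verGen q p lam₂ .f (row p 0 u) := by
  induction u using TensorProduct.induction_on with
  | zero => simp
  | add u v hu hv => simp only [map_add, hu, hv, smul_add]
  | tmul v w =>
    simp [sl2Tensor_f, map_add, row_tmul, coord_zero_f, coord_Kinv, map_smul, mul_smul]

theorem row_zero_K (u : VV p) : row p 0 (sl2Tensor q hqp lam₁ lam₂ (sl2 q .K) u) =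
    (q : ℂ) ^ lam₁ • verGen q p lam₂ .K (row p 0 u) := by
  induction u using TensorProduct.induction_on with
  | zero => simp
  | add u v hu hv => simp only [map_add, hu, hv, smul_add]
  | tmul v w =>
    simp [sl2Tensor_K, row_tmul, coord_K, map_smul, mul_smul]

/-- Row zero of `f_0 u` is determined by row zero of `u` and of `e u`. -/
theorem row_zero_f_zero (u : VV p) :
    row p 0 (affTensor q hqp lam₁ x lam₂ y (aff q (.f 0)) u) =
      ((q : ℂ) * (x : ℂ)⁻¹) • verGen q p lam₂ .Kinv
        (row p 0 (sl2Tensor q hqp lam₁ lam₂ (sl2 q .e) u) - verGen q p lam₂ .e (row p 0 u)) +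
      ((q : ℂ) * (y : ℂ)⁻¹ * (q : ℂ) ^ lam₁) • verGen q p lam₂ .e (row p 0 u) := by
  rw [row_e, add_sub_cancel_right, map_smul, ver_Kinv_K]
  induction u using TensorProduct.induction_on with
  | zero => simp
  | add u v hu hv => simp only [map_add, hu, hv, smul_add]; abel
  | tmul v w =>
    simp [affTensor_f_zero, row_tmul, coord_K, coord_e, map_smul, mul_smul]

theorem row_zero_e_zero (u : VV p) :
    row p 0 (affTensor q hqp lam₁ x lam₂ y (aff q (.e 0)) u) =
      ((q : ℂ)⁻¹ * y) • verGen q p lam₂ .f (row p 0 u) := by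
  induction u using TensorProduct.induction_on with
  | zero => simp
  | add u v hu hv => simp only [map_add, hu, hv, smul_add]
  | tmul v w => simp [affTensor_e_zero, row_tmul, coord_zero_f]

/-- A vector of `V_{λ₁} ⊗ V_{λ₂}` killed by `e` is determined by its row zero: the equation
`e u = 0` expresses each row through the previous one. -/
theorem eq_zero_of_e_of_row_zero (h1 : ∀ i, i + 1 < p → qnum q (lam₁ - i) ≠ 0) {u : VV p}
    (he : sl2Tensor q hqp lam₁ lam₂ (sl2 q .e) u = 0) (h0 : row p 0 u = 0) : u = 0 := by
  refine eq_zero_of_row_eq_zero fun i => ?_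
  induction i with
  | zero => exact fun _ => h0
  | succ i ih =>
    intro hi
    have h := row_e hqp lam₁ lam₂ i u
    rw [he, map_zero, ih (by omega), map_zero, add_zero] at h
    exact eq_zero_of_ver_K lam₂ ((smul_eq_zero.1 h.symm).resolve_left (h1 i hi))

theorem eq_of_e_of_row_zero (h1 : ∀ i, i + 1 < p → qnum q (lam₁ - i) ≠ 0) {u v : VV p}
    (he : sl2Tensor q hqp lam₁ lam₂ (sl2 q .e) u = sl2Tensor q hqp lam₁ lam₂ (sl2 q .e) v)
    (h0 : row p 0 u = row p 0 v) : u = v :=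
  sub_eq_zero.1 (eq_zero_of_e_of_row_zero hqp lam₁ lam₂ h1 (by rw [map_sub, he, sub_self])
    (by rw [map_sub, h0, sub_self]))

end rows

/-! ### The highest weight vectors of `V_{λ₁} ⊗ V_{λ₂}` -/

section Omega

variable {q : ℂˣ} {p : ℕ} {lam₁ lam₂ : ℂ}

theorem Condition1.symm (h : Condition1 q p lam₁ lam₂) : Condition1 q p lam₂ lam₁ :=
  ⟨fun i hi => (h.1 i hi).symm, fun i hi j hj => by rw [add_comm lam₂]; exact h.2 i hi j hj⟩

theorem Condition1.left (h : Condition1 q p lam₁ lam₂) {i : ℕ} (hi : i + 1 ≤ p) :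
    qnum q (lam₁ - i) ≠ 0 := by
  have := (h.1 (i + 1) hi).1
  rwa [show lam₁ + 1 - ((i + 1 : ℕ) : ℂ) = lam₁ - i by push_cast; ring] at this

theorem Condition1.right (h : Condition1 q p lam₁ lam₂) {i : ℕ} (hi : i + 1 ≤ p) :
    qnum q (lam₂ - i) ≠ 0 := h.symm.left hi

theorem Condition1.left_add_one (h : Condition1 q p lam₁ lam₂) : qnum q (lam₁ + 1) ≠ 0 := by
  simpa using (h.1 0 (Nat.zero_le _)).1

theorem Condition1.q_sub_inv_ne_zero (h : Condition1 q p lam₁ lam₂) :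
    (q : ℂ) - (q : ℂ)⁻¹ ≠ 0 := fun h0 => h.left_add_one (by rw [qnum, h0, div_zero])

theorem Condition1.qnum_one (h : Condition1 q p lam₁ lam₂) : qnum q 1 = 1 := by
  rw [qnum_eq, Complex.cpow_one, div_self h.q_sub_inv_ne_zero]

theorem Condition1.sum (h : Condition1 q p lam₁ lam₂) {l i : ℕ} (hl : l < p) (hi : i + 1 ≤ p) :
    qnum q (lam₁ + lam₂ - 2 * l - i) ≠ 0 := by
  have := h.2 (i + 1) hi l hl
  rwa [show lam₁ + lam₂ - 2 * (l : ℂ) + 1 - ((i + 1 : ℕ) : ℂ) = lam₁ + lam₂ - 2 * l - i by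
    push_cast; ring] at this

theorem Condition1.sum_add_one (h : Condition1 q p lam₁ lam₂) {l : ℕ} (hl : l < p) :
    qnum q (lam₁ + lam₂ - 2 * l + 1) ≠ 0 := by
  simpa using h.2 0 (Nat.zero_le _) l hl

theorem Condition1.sum_add_two (h : Condition1 q p lam₁ lam₂) (hqp : q ^ p = 1) {l : ℕ}
    (hl : l < p) : qnum q (lam₁ + lam₂ - 2 * l + 2) ≠ 0 := by
  rcases l with _ | l
  · -- `[λ₁ + λ₂ + 2] = [λ₁ + λ₂ - 2(p - 1)]` as `q ^ (2p) = 1`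
    have := h.sum (l := p - 1) (i := 0) (by omega) (by omega)
    rwa [show lam₁ + lam₂ - 2 * ((p - 1 : ℕ) : ℂ) - ((0 : ℕ) : ℂ) =
      lam₁ + lam₂ - 2 * ((0 : ℕ) : ℂ) + 2 - p - p by
        rw [Nat.cast_sub (by omega)]; push_cast; ring, qnum_sub_self hqp, qnum_sub_self hqp] at this
  · have := h.sum (l := l) (i := 0) (by omega) (by omega)
    rwa [show lam₁ + lam₂ - 2 * (l : ℂ) - ((0 : ℕ) : ℂ) =
      lam₁ + lam₂ - 2 * ((l + 1 : ℕ) : ℂ) + 2 by push_cast; ring] at this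

theorem Condition1.sum_sub (h : Condition1 q p lam₁ lam₂) {l : ℕ} (hl : l < p) :
    qnum q (lam₁ + lam₂ - l + 1) ≠ 0 := by
  have := h.2 l hl.le 0 (by omega)
  rwa [show lam₁ + lam₂ - 2 * ((0 : ℕ) : ℂ) + 1 - (l : ℂ) = lam₁ + lam₂ - l + 1 by
    push_cast; ring] at this

/-- The coefficient of `v_i ⊗ w_{l-i}` in `Ω_l`. -/
noncomputable def omegaCoeff (q : ℂˣ) (lam₁ lam₂ : ℂ) (l i : ℕ) : ℂ :=
  (-1) ^ i * (q : ℂ) ^ ((i : ℂ) * (2 * l - i - lam₂ - 1)) *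
    ∏ j ∈ Finset.range (i + 1), qnum q (lam₂ - l + j) / qnum q (lam₁ - j + 1)

theorem Omega_eq (l : ℕ) : Omega q p lam₁ lam₂ l =
    ∑ i ∈ Finset.range (l + 1), omegaCoeff q lam₁ lam₂ l i • (nb p i ⊗ₜ[ℂ] nb p (l - i)) := rfl

theorem omegaCoeff_succ {l i : ℕ} (h : qnum q (lam₁ - i) ≠ 0) :
    omegaCoeff q lam₁ lam₂ (l + 1) (i + 1) * qnum q (lam₁ - i) * (q : ℂ) ^ (lam₂ - 2 * (l - i)) =
      -(omegaCoeff q lam₁ lam₂ (l + 1) i * qnum q (lam₂ - (l - i))) := by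
  rw [omegaCoeff, omegaCoeff, Finset.prod_range_succ _ (i + 1)]
  have h1 : lam₁ - ((i + 1 : ℕ) : ℂ) + 1 = lam₁ - i := by push_cast; ring
  have h2 : lam₂ - ((l + 1 : ℕ) : ℂ) + ((i + 1 : ℕ) : ℂ) = lam₂ - (l - i) := by push_cast; ring
  have h3 : (q : ℂ) ^ (((i + 1 : ℕ) : ℂ) * (2 * ((l + 1 : ℕ) : ℂ) - ((i + 1 : ℕ) : ℂ) - lam₂ - 1)) *
      (q : ℂ) ^ (lam₂ - 2 * (l - i)) =
      (q : ℂ) ^ ((i : ℂ) * (2 * ((l + 1 : ℕ) : ℂ) - i - lam₂ - 1)) := by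
    rw [← Complex.cpow_add _ _ q.ne_zero]
    congr 1
    push_cast
    ring
  rw [h1, h2, ← h3, pow_succ]
  field_simp

theorem row_zero_Omega {l : ℕ} (hl : l < p) : row p 0 (Omega q p lam₁ lam₂ l) =
    (qnum q (lam₂ - l) / qnum q (lam₁ + 1)) • nb p l := by
  rw [Omega_eq, map_sum, Finset.sum_eq_single 0]
  · simp [row_tmul, coord_nb (show 0 < p by omega), omegaCoeff]
  · intro i hi h0
    have := Finset.mem_range.1 hi
    rw [map_smul, row_tmul, coord_nb (show i < p by omega), if_neg (Ne.symm h0), zero_smul,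
      smul_zero]
  · simp

variable (hqp : q ^ p = 1)

theorem sl2Tensor_e_Omega (h1 : Condition1 q p lam₁ lam₂) {l : ℕ} (hl : l < p) :
    sl2Tensor q hqp lam₁ lam₂ (sl2 q .e) (Omega q p lam₁ lam₂ l) = 0 := by
  rw [Omega_eq, map_sum]
  simp only [map_smul, sl2Tensor_e, smul_add, Finset.sum_add_distrib]
  rcases l with _ | l
  · simp [ver_e_zero]
  · rw [Finset.sum_range_succ' _ (l + 1), Finset.sum_range_succ _ (l + 1), ver_e_zero,
      Nat.sub_self, ver_e_zero, TensorProduct.zero_tmul, TensorProduct.tmul_zero, smul_zero,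
      smul_zero, add_zero, add_zero, ← Finset.sum_add_distrib]
    refine Finset.sum_eq_zero fun i hi => ?_
    have hi' := Finset.mem_range.1 hi
    have hc := omegaCoeff_succ (lam₂ := lam₂) (l := l) (h1.left (i := i) (by omega))
    rw [ver_e_succ q p lam₁ (by omega), show l + 1 - (i + 1) = l - i by omega,
      show l + 1 - i = (l - i) + 1 by omega, ver_e_succ q p lam₂ (by omega), ver_K,
      Nat.cast_sub (by omega), TensorProduct.tmul_smul, TensorProduct.tmul_smul,
      ← TensorProduct.smul_tmul', smul_smul, smul_smul, smul_smul, ← add_smul]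
    rw [show ∀ c : ℂ, c = 0 → c • (nb p i ⊗ₜ[ℂ] nb p (l - i)) = 0 by rintro _ rfl; simp]
    linear_combination hc

theorem sl2Tensor_K_Omega (l : ℕ) :
    sl2Tensor q hqp lam₁ lam₂ (sl2 q .K) (Omega q p lam₁ lam₂ l) =
      (q : ℂ) ^ (lam₁ + lam₂ - 2 * l) • Omega q p lam₁ lam₂ l := by
  rw [Omega_eq, map_sum, Finset.smul_sum]
  refine Finset.sum_congr rfl fun i hi => ?_
  have hi' := Finset.mem_range.1 hi
  have h : (q : ℂ) ^ (lam₁ + lam₂ - 2 * l) =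
      (q : ℂ) ^ (lam₂ - 2 * ((l - i : ℕ) : ℂ)) * (q : ℂ) ^ (lam₁ - 2 * (i : ℂ)) := by
    rw [← Complex.cpow_add _ _ q.ne_zero, Nat.cast_sub (by omega)]
    congr 1
    ring
  rw [map_smul, sl2Tensor_K, ver_K, ver_K, smul_comm, TensorProduct.tmul_smul,
    ← TensorProduct.smul_tmul', h]
  module

/-- The multiple of `Ω_l` whose row zero is `[l]! w_l`; zero for `l ≥ p`. In this normalization
the formulas for the action hold without case distinctions at the ends of the range of `l`. -/
noncomputable def Xi (q : ℂˣ) (p : ℕ) (lam₁ lam₂ : ℂ) (l : ℕ) : VV p :=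
  if l < p then (qfact q l * qnum q (lam₁ + 1) / qnum q (lam₂ - l)) • Omega q p lam₁ lam₂ l else 0

theorem Xi_of_le {l : ℕ} (h : p ≤ l) : Xi q p lam₁ lam₂ l = 0 := if_neg (by omega)

theorem row_zero_Xi (h1 : Condition1 q p lam₁ lam₂) (l : ℕ) :
    row p 0 (Xi q p lam₁ lam₂ l) = fvec q p l := by
  rcases lt_or_ge l p with h | h
  · rw [Xi, if_pos h, map_smul, row_zero_Omega h, smul_smul, fvec]
    have := h1.left_add_one
    have := h1.right (i := l) (by omega)
    congr 1
    field_simp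
  · rw [Xi_of_le h, fvec_of_le h, map_zero]

theorem sl2Tensor_e_Xi (h1 : Condition1 q p lam₁ lam₂) (l : ℕ) :
    sl2Tensor q hqp lam₁ lam₂ (sl2 q .e) (Xi q p lam₁ lam₂ l) = 0 := by
  rw [Xi]
  split_ifs with h
  · rw [map_smul, sl2Tensor_e_Omega hqp h1 h, smul_zero]
  · rw [map_zero]

theorem sl2Tensor_K_Xi (l : ℕ) :
    sl2Tensor q hqp lam₁ lam₂ (sl2 q .K) (Xi q p lam₁ lam₂ l) =
      (q : ℂ) ^ (lam₁ + lam₂ - 2 * l) • Xi q p lam₁ lam₂ l := by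
  rw [Xi]
  split_ifs with h
  · rw [map_smul, sl2Tensor_K_Omega hqp, smul_comm]
  · rw [map_zero, smul_zero]

theorem row_zero_pow_f (u : VV p) {l : ℕ} {c : ℂ} (h : row p 0 u = c • fvec q p l) (k : ℕ) :
    row p 0 ((sl2Tensor q hqp lam₁ lam₂ (sl2 q .f) ^ k) u) =
      (((q : ℂ) ^ (-lam₁)) ^ k * c) • fvec q p (l + k) := by
  induction k with
  | zero => simp [h]
  | succ k ih =>
    rw [pow_succ', Module.End.mul_apply, row_zero_f, ih, map_smul, ver_f_fvec, smul_smul, pow_succ',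
      mul_assoc, add_assoc]

theorem row_zero_pow_f_Xi (h1 : Condition1 q p lam₁ lam₂) (l k : ℕ) :
    row p 0 ((sl2Tensor q hqp lam₁ lam₂ (sl2 q .f) ^ k) (Xi q p lam₁ lam₂ l)) =
      (((q : ℂ) ^ (-lam₁)) ^ k) • fvec q p (l + k) := by
  rw [row_zero_pow_f hqp _ (c := 1) (by rw [row_zero_Xi h1, one_smul]), mul_one]

theorem sl2Tensor_pow_f_Xi (h1 : Condition1 q p lam₁ lam₂) (hp1 : 1 < p) (l : ℕ) :
    (sl2Tensor q hqp lam₁ lam₂ (sl2 q .f) ^ p) (Xi q p lam₁ lam₂ l) = 0 := by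
  refine eq_zero_of_e_of_row_zero hqp lam₁ lam₂ (fun i hi => h1.left hi.le) ?_ ?_
  · obtain ⟨k, rfl⟩ : ∃ k, p = k + 1 := ⟨p - 1, by omega⟩
    rw [rep_e_pow_f (sl2Tensor_e_Xi hqp h1 l) (sl2Tensor_K_Xi hqp l), ← Nat.cast_succ,
      qnum_natCast_self hqp, zero_mul, zero_smul]
  · rw [row_zero_pow_f_Xi hqp h1, fvec_of_le (by omega), smul_zero]

/-- The scalar `c` with `Ξ_l = c Ω_l`, for `l < p`. -/
noncomputable def xiCoeff (q : ℂˣ) (lam₁ lam₂ : ℂ) (l : ℕ) : ℂ :=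
  qfact q l * qnum q (lam₁ + 1) / qnum q (lam₂ - l)

theorem Xi_eq {l : ℕ} (hl : l < p) :
    Xi q p lam₁ lam₂ l = xiCoeff q lam₁ lam₂ l • Omega q p lam₁ lam₂ l := if_pos hl

theorem xiCoeff_ne_zero (hp : Odd p) (hp1 : 1 < p) (hq : IsPrimitiveRoot q p)
    (h1 : Condition1 q p lam₁ lam₂) {l : ℕ} (hl : l < p) : xiCoeff q lam₁ lam₂ l ≠ 0 :=
  div_ne_zero (mul_ne_zero (qfact_ne_zero hp hp1 hq hl) h1.left_add_one)
    (h1.right (i := l) (by omega))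

theorem Omega_eq_smul_Xi (hp : Odd p) (hp1 : 1 < p) (hq : IsPrimitiveRoot q p)
    (h1 : Condition1 q p lam₁ lam₂) {l : ℕ} (hl : l < p) :
    Omega q p lam₁ lam₂ l = (xiCoeff q lam₁ lam₂ l)⁻¹ • Xi q p lam₁ lam₂ l := by
  rw [Xi_eq hl, inv_smul_smul₀ (xiCoeff_ne_zero hp hp1 hq h1 hl)]

end Omega

/-! ### Action of `f_0` on the highest weight vectors -/

section fZero

variable {q : ℂˣ} {p : ℕ} {lam₁ lam₂ : ℂ} (hqp : q ^ p = 1) (x y : ℂˣ)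

theorem affTensor_e_one_f_zero (v : VV p) :
    sl2Tensor q hqp lam₁ lam₂ (sl2 q .e) (affTensor q hqp lam₁ x lam₂ y (aff q (.f 0)) v) =
      affTensor q hqp lam₁ x lam₂ y (aff q (.f 0)) (sl2Tensor q hqp lam₁ lam₂ (sl2 q .e) v) := by
  have := congrArg (fun a => affTensor q hqp lam₁ x lam₂ y a v)
    (aff_e_f' q 1 0 (by decide))
  simpa [affTensor_e_one] using this

theorem affTensor_K_one_f_zero (v : VV p) :
    sl2Tensor q hqp lam₁ lam₂ (sl2 q .K) (affTensor q hqp lam₁ x lam₂ y (aff q (.f 0)) v) =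
      (q : ℂ) ^ 2 • affTensor q hqp lam₁ x lam₂ y (aff q (.f 0))
        (sl2Tensor q hqp lam₁ lam₂ (sl2 q .K) v) := by
  have := congrArg (fun a => affTensor q hqp lam₁ x lam₂ y a v)
    (mul_inv_comm_of_conj (aff_Kinv_K q 1) (aff_K_f' q 1 0 (by decide)))
  simpa [affTensor_K_one] using this

/-- The coefficient `δ_l` in `f_0 Ξ_l = δ_l Ξ_{l-1}`; it vanishes for `l = 0`. -/
noncomputable def deltaCoeff (q : ℂˣ) (lam₁ lam₂ : ℂ) (x y : ℂˣ) (l : ℕ) : ℂ :=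
  q * (qnum q l * qnum q (lam₂ + 1 - l)) *
    ((y : ℂ)⁻¹ * (q : ℂ) ^ lam₁ - (x : ℂ)⁻¹ * (q : ℂ) ^ (-lam₂ + 2 * l - 2))

theorem f_zero_Xi_zero (h1 : Condition1 q p lam₁ lam₂) :
    affTensor q hqp lam₁ x lam₂ y (aff q (.f 0)) (Xi q p lam₁ lam₂ 0) = 0 := by
  refine eq_zero_of_e_of_row_zero hqp lam₁ lam₂ (fun i hi => h1.left hi.le) ?_ ?_
  · rw [affTensor_e_one_f_zero, sl2Tensor_e_Xi hqp h1, map_zero]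
  · rw [row_zero_f_zero, sl2Tensor_e_Xi hqp h1, row_zero_Xi h1, ver_e_fvec_zero]
    simp

theorem f_zero_Xi_succ (h1 : Condition1 q p lam₁ lam₂) (l : ℕ) :
    affTensor q hqp lam₁ x lam₂ y (aff q (.f 0)) (Xi q p lam₁ lam₂ (l + 1)) =
      deltaCoeff q lam₁ lam₂ x y (l + 1) • Xi q p lam₁ lam₂ l := by
  refine eq_of_e_of_row_zero hqp lam₁ lam₂ (fun i hi => h1.left hi.le) ?_ ?_
  · rw [affTensor_e_one_f_zero, sl2Tensor_e_Xi hqp h1, map_zero, map_smul, sl2Tensor_e_Xi hqp h1,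
      smul_zero]
  · rw [row_zero_f_zero, sl2Tensor_e_Xi hqp h1, map_smul, row_zero_Xi h1, row_zero_Xi h1,
      ver_e_fvec_succ hqp, map_zero, zero_sub, map_neg, map_smul, ver_Kinv_fvec]
    rw [smul_neg, smul_smul, smul_smul, smul_smul, ← neg_smul, ← add_smul, deltaCoeff]
    congr 1
    rw [show -(lam₂ - 2 * (l : ℂ)) = -lam₂ + 2 * ((l + 1 : ℕ) : ℂ) - 2 by push_cast; ring,
      show lam₂ + 1 - ((l + 1 : ℕ) : ℂ) = lam₂ - l by push_cast; ring]
    push_cast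
    ring

/-- `f_0 Ξ_l` is a highest weight vector of weight `λ₁ + λ₂ - 2l + 2`. -/
theorem e_pow_f_f_zero_Xi (h1 : Condition1 q p lam₁ lam₂) (l k : ℕ) :
    sl2Tensor q hqp lam₁ lam₂ (sl2 q .e) ((sl2Tensor q hqp lam₁ lam₂ (sl2 q .f) ^ (k + 1))
      (affTensor q hqp lam₁ x lam₂ y (aff q (.f 0)) (Xi q p lam₁ lam₂ l))) =
    (qnum q ((k : ℂ) + 1) * qnum q (lam₁ + lam₂ - 2 * l + 2 - k)) •
      (sl2Tensor q hqp lam₁ lam₂ (sl2 q .f) ^ k)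
        (affTensor q hqp lam₁ x lam₂ y (aff q (.f 0)) (Xi q p lam₁ lam₂ l)) := by
  refine rep_e_pow_f ?_ ?_ k
  · rw [affTensor_e_one_f_zero, sl2Tensor_e_Xi hqp h1, map_zero]
  · rw [affTensor_K_one_f_zero, sl2Tensor_K_Xi, map_smul, smul_smul,
      Complex.cpow_add _ 2 q.ne_zero, mul_comm]
    norm_num

theorem row_zero_pow_f_f_zero_Xi (h1 : Condition1 q p lam₁ lam₂) (l k : ℕ) :
    row p 0 ((sl2Tensor q hqp lam₁ lam₂ (sl2 q .f) ^ (k + 1))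
      (affTensor q hqp lam₁ x lam₂ y (aff q (.f 0)) (Xi q p lam₁ lam₂ l))) =
    (((q : ℂ) ^ (-lam₁)) ^ (k + 1) * deltaCoeff q lam₁ lam₂ x y l) • fvec q p (l + k) := by
  rcases l with _ | l
  · simp [f_zero_Xi_zero hqp x y h1, deltaCoeff, qnum_zero]
  · rw [f_zero_Xi_succ hqp x y h1, map_smul, map_smul, row_zero_pow_f_Xi hqp h1, smul_smul,
      mul_comm, add_right_comm, add_assoc]

/-- The scalar by which row zero of `f_0 f ^ {k+1} Ξ_l` is a multiple of `[l+k]! w_{l+k}`. -/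
noncomputable def rowCoeff (q : ℂˣ) (lam₁ lam₂ : ℂ) (x y : ℂˣ) (l k : ℕ) : ℂ :=
  q * ((x : ℂ)⁻¹ * (q : ℂ) ^ (-(lam₂ - 2 * ((l : ℂ) + k))) *
      (qnum q ((k : ℂ) + 1) * qnum q (lam₁ + lam₂ - 2 * l - k) * ((q : ℂ) ^ (-lam₁)) ^ k -
        ((q : ℂ) ^ (-lam₁)) ^ (k + 1) * (qnum q ((l : ℂ) + k + 1) * qnum q (lam₂ - (l + k)))) +
    (y : ℂ)⁻¹ * ((q : ℂ) ^ (-lam₁)) ^ k *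
      (qnum q ((l : ℂ) + k + 1) * qnum q (lam₂ - (l + k))))

theorem row_zero_f_zero_pow_f_Xi (h1 : Condition1 q p lam₁ lam₂) (l k : ℕ) :
    row p 0 (affTensor q hqp lam₁ x lam₂ y (aff q (.f 0))
      ((sl2Tensor q hqp lam₁ lam₂ (sl2 q .f) ^ (k + 1)) (Xi q p lam₁ lam₂ l))) =
    rowCoeff q lam₁ lam₂ x y l k • fvec q p (l + k) := by
  rw [row_zero_f_zero, rep_e_pow_f (sl2Tensor_e_Xi hqp h1 l) (sl2Tensor_K_Xi hqp l), map_smul,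
    row_zero_pow_f_Xi hqp h1, row_zero_pow_f_Xi hqp h1, map_smul, ← add_assoc,
    ver_e_fvec_succ hqp, smul_smul, smul_smul, ← sub_smul, map_smul, ver_Kinv_fvec, smul_smul,
    smul_smul, smul_smul, ← add_smul, rowCoeff]
  congr 1
  have h : (q : ℂ) ^ lam₁ * (q : ℂ) ^ (-lam₁) = 1 := by
    rw [← Complex.cpow_add _ _ q.ne_zero]; simp
  push_cast
  linear_combination ((q : ℂ) * (y : ℂ)⁻¹ * ((q : ℂ) ^ (-lam₁)) ^ k *
      (qnum q ((l : ℂ) + k + 1) * qnum q (lam₂ - (l + k)))) * h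

/-- The diagonal coefficient in `f_0 f Ξ_l`. -/
noncomputable def epsCoeff (q : ℂˣ) (lam₁ lam₂ : ℂ) (x y : ℂˣ) (l : ℕ) : ℂ :=
  rowCoeff q lam₁ lam₂ x y l 0 -
    qnum q (lam₁ + lam₂ - 2 * l) / qnum q (lam₁ + lam₂ - 2 * l + 2) *
      ((q : ℂ) ^ (-lam₁) * deltaCoeff q lam₁ lam₂ x y l)

/-- Both sides have the same image under `e`, as `e` commutes with `f_0` and `f_0 Ξ_l` is a highest
weight vector; `epsCoeff` is then read off from row zero. -/
theorem f_zero_f_Xi (h1 : Condition1 q p lam₁ lam₂) {l : ℕ} (hl : l < p) :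
    affTensor q hqp lam₁ x lam₂ y (aff q (.f 0))
      ((sl2Tensor q hqp lam₁ lam₂ (sl2 q .f) ^ 1) (Xi q p lam₁ lam₂ l)) =
    (qnum q (lam₁ + lam₂ - 2 * l) / qnum q (lam₁ + lam₂ - 2 * l + 2)) •
      (sl2Tensor q hqp lam₁ lam₂ (sl2 q .f) ^ 1)
        (affTensor q hqp lam₁ x lam₂ y (aff q (.f 0)) (Xi q p lam₁ lam₂ l)) +
      epsCoeff q lam₁ lam₂ x y l • Xi q p lam₁ lam₂ l := by
  refine eq_of_e_of_row_zero hqp lam₁ lam₂ (fun i hi => h1.left hi.le) ?_ ?_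
  · rw [affTensor_e_one_f_zero, map_add, map_smul, map_smul, sl2Tensor_e_Xi hqp h1,
      e_pow_f_f_zero_Xi hqp x y h1 l 0, rep_e_pow_f (sl2Tensor_e_Xi hqp h1 l)
      (sl2Tensor_K_Xi hqp l) 0, map_smul, smul_smul, smul_zero, add_zero]
    have := h1.sum_add_two hqp hl
    simp only [pow_zero, Module.End.one_apply, Nat.cast_zero, sub_zero]
    congr 1
    field_simp
  · rw [map_add, map_smul, map_smul, row_zero_f_zero_pow_f_Xi hqp x y h1 l 0,
      row_zero_pow_f_f_zero_Xi hqp x y h1 l 0, row_zero_Xi h1, smul_smul, add_zero, ← add_smul,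
      epsCoeff]
    congr 1
    ring

/-- The coefficient of `Ξ_{l+1}` in `f_0 f ^ 2 Ξ_l`. -/
noncomputable def zetaCoeff (q : ℂˣ) (lam₁ lam₂ : ℂ) (x y : ℂˣ) (l : ℕ) : ℂ :=
  rowCoeff q lam₁ lam₂ x y l 1 -
    qnum q (lam₁ + lam₂ - 2 * l) / qnum q (lam₁ + lam₂ - 2 * l + 2) *
      (qnum q (lam₁ + lam₂ - 2 * l - 1) / qnum q (lam₁ + lam₂ - 2 * l + 1)) *
      (((q : ℂ) ^ (-lam₁)) ^ 2 * deltaCoeff q lam₁ lam₂ x y l) -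
    qnum q 2 * qnum q (lam₁ + lam₂ - 2 * l - 1) / qnum q (lam₁ + lam₂ - 2 * l) *
      epsCoeff q lam₁ lam₂ x y l * (q : ℂ) ^ (-lam₁)

theorem f_zero_sq_f_Xi (h1 : Condition1 q p lam₁ lam₂) {l : ℕ} (hl : l < p) :
    affTensor q hqp lam₁ x lam₂ y (aff q (.f 0))
      ((sl2Tensor q hqp lam₁ lam₂ (sl2 q .f) ^ 2) (Xi q p lam₁ lam₂ l)) =
    (qnum q (lam₁ + lam₂ - 2 * l) / qnum q (lam₁ + lam₂ - 2 * l + 2) *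
      (qnum q (lam₁ + lam₂ - 2 * l - 1) / qnum q (lam₁ + lam₂ - 2 * l + 1))) •
      (sl2Tensor q hqp lam₁ lam₂ (sl2 q .f) ^ 2)
        (affTensor q hqp lam₁ x lam₂ y (aff q (.f 0)) (Xi q p lam₁ lam₂ l)) +
    (qnum q 2 * qnum q (lam₁ + lam₂ - 2 * l - 1) / qnum q (lam₁ + lam₂ - 2 * l) *
      epsCoeff q lam₁ lam₂ x y l) •
        (sl2Tensor q hqp lam₁ lam₂ (sl2 q .f) ^ 1) (Xi q p lam₁ lam₂ l) +
    zetaCoeff q lam₁ lam₂ x y l • Xi q p lam₁ lam₂ (l + 1) := by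
  refine eq_of_e_of_row_zero hqp lam₁ lam₂ (fun i hi => h1.left hi.le) ?_ ?_
  · rw [affTensor_e_one_f_zero, map_add, map_add, map_smul, map_smul, map_smul,
      sl2Tensor_e_Xi hqp h1, e_pow_f_f_zero_Xi hqp x y h1 l 1, rep_e_pow_f
      (sl2Tensor_e_Xi hqp h1 l) (sl2Tensor_K_Xi hqp l) 1, rep_e_pow_f (sl2Tensor_e_Xi hqp h1 l)
      (sl2Tensor_K_Xi hqp l) 0, map_smul, f_zero_f_Xi hqp x y h1 hl, smul_smul, smul_smul,
      smul_zero, add_zero, smul_add, smul_smul, smul_smul]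
    have h3 := h1.sum_add_two hqp hl
    have h4 := h1.sum_add_one hl
    have h5 := h1.sum (i := 0) hl (by omega)
    simp only [pow_zero, Module.End.one_apply, Nat.cast_zero, sub_zero, Nat.cast_one,
      one_add_one_eq_two, zero_add] at h5 ⊢
    rw [show lam₁ + lam₂ - 2 * (l : ℂ) + 2 - 1 = lam₁ + lam₂ - 2 * l + 1 by ring]
    congr 2
    · field_simp
    · rw [h1.qnum_one]
      field_simp
  · rw [map_add, map_add, map_smul, map_smul, map_smul, row_zero_f_zero_pow_f_Xi hqp x y h1 l 1,
      row_zero_pow_f_f_zero_Xi hqp x y h1 l 1, row_zero_Xi h1, row_zero_pow_f_Xi hqp h1, smul_smul,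
      smul_smul, ← add_smul, ← add_smul, zetaCoeff]
    congr 1
    ring

end fZero

/-! ### Identities between the matrix coefficients -/

section identities

variable {q : ℂˣ} {p : ℕ} {lam₁ lam₂ : ℂ}

theorem cpow_two_mul_natCast (q : ℂˣ) (l : ℕ) : (q : ℂ) ^ (2 * (l : ℂ)) = ((q : ℂ) ^ l) ^ 2 := by
  rw [← pow_mul, mul_comm l 2, ← Complex.cpow_natCast]
  push_cast
  rfl

theorem cpow_two (q : ℂˣ) : (q : ℂ) ^ (2 : ℂ) = (q : ℂ) ^ 2 := by
  rw [← Complex.cpow_natCast]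
  norm_num

/-- The factor `y q ^ λ₂ - x q ^ (-λ₁ + 2j - 2)` of `cDen`; with the two modules exchanged it is
the factor of `cNum`. -/
noncomputable def specFactor (q : ℂˣ) (lam₁ lam₂ : ℂ) (x y : ℂˣ) (j : ℕ) : ℂ :=
  -((x : ℂ) * (q : ℂ) ^ (-lam₁ + 2 * (j : ℂ) - 2)) + (y : ℂ) * (q : ℂ) ^ lam₂

theorem cDen_eq (q : ℂˣ) (lam₁ lam₂ : ℂ) (x y : ℂˣ) (j : ℕ) :
    cDen q lam₁ lam₂ x y j = qnum q (lam₁ - j) * specFactor q lam₁ lam₂ x y j := rfl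

theorem cNum_eq (q : ℂˣ) (lam₁ lam₂ : ℂ) (x y : ℂˣ) (j : ℕ) :
    cNum q lam₁ lam₂ x y j = qnum q (lam₂ - j) * specFactor q lam₂ lam₁ y x j := by
  rw [cNum, specFactor]
  ring

theorem deltaCoeff_eq (q : ℂˣ) (lam₁ lam₂ : ℂ) (x y : ℂˣ) (l : ℕ) :
    deltaCoeff q lam₁ lam₂ x y l = q * (x : ℂ)⁻¹ * (y : ℂ)⁻¹ * qnum q l *
      (qnum q (lam₂ + 1 - l) * specFactor q lam₂ lam₁ y x l) := by
  have hx := x.ne_zero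
  have hy := y.ne_zero
  rw [deltaCoeff, specFactor]
  field_simp
  ring

/-- The diagonal coefficient does not change when the two modules are exchanged. -/
theorem epsCoeff_symm (x y : ℂˣ) {l : ℕ} (h : qnum q (lam₁ + lam₂ - 2 * l + 2) ≠ 0) :
    epsCoeff q lam₁ lam₂ x y l = epsCoeff q lam₂ lam₁ y x l := by
  have h0 := q.ne_zero
  have ha := cpow_lam_ne q lam₁
  have hb := cpow_lam_ne q lam₂
  have hQ : (q : ℂ) ^ l ≠ 0 := pow_ne_zero l h0
  have key : ∀ c d n m : ℂ, m ≠ 0 → ∀ c' d', c * m - n * d = c' * m - n * d' →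
      c - n / m * d = c' - n / m * d' := by
    intro c d n m hm c' d' h
    field_simp
    linear_combination h
  unfold epsCoeff
  rw [add_comm lam₂ lam₁]
  refine key _ _ _ _ h _ _ ?_
  simp only [rowCoeff, deltaCoeff, qnum_eq, div_eq_mul_inv, add_comm lam₂ lam₁,
    Complex.cpow_add _ _ h0, Complex.cpow_sub _ _ h0, Complex.cpow_neg, Complex.cpow_natCast,
    cpow_two_mul_natCast, cpow_two, mul_add, Nat.cast_zero, add_zero, Complex.cpow_one,
    zero_add, pow_zero, pow_one, sub_zero]
  generalize (q : ℂ) ^ lam₁ = a at *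
  generalize (q : ℂ) ^ lam₂ = b at *
  generalize (q : ℂ) ^ l = Q at *
  generalize ((q : ℂ) - (q : ℂ)⁻¹)⁻¹ = D at *
  generalize (q : ℂ) = z at *
  generalize (x : ℂ)⁻¹ = X
  generalize (y : ℂ)⁻¹ = Y
  field_simp
  ring

/-- Factorization of the coefficient of `Ξ_{l+1}` in `f_0 f ^ 2 Ξ_l`. All factors outside the last
parentheses are symmetric under exchange of the two modules. -/
theorem zetaCoeff_eq (h1 : Condition1 q p lam₁ lam₂) (hqp : q ^ p = 1) (hp1 : 1 < p) (x y : ℂˣ)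
    {l : ℕ} (hl : l < p) :
    zetaCoeff q lam₁ lam₂ x y l =
      q * (((q : ℂ) ^ l) ^ 2)⁻¹ * (x : ℂ)⁻¹ * (y : ℂ)⁻¹ * qnum q 2 *
        qnum q (lam₁ + lam₂ - l + 1) /
          (qnum q (lam₁ + lam₂ - 2 * l) * qnum q (lam₁ + lam₂ - 2 * l + 1)) *
        (qnum q (lam₁ - l) * specFactor q lam₁ lam₂ x y (l + 1)) := by
  have hL0 : qnum q (lam₁ + lam₂ - 2 * l) ≠ 0 := by
    simpa using h1.sum (i := 0) hl (by omega)
  have hL1 := h1.sum_add_one hl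
  have hL2 := h1.sum_add_two hqp hl
  have h0 := q.ne_zero
  have hx := x.ne_zero
  have hy := y.ne_zero
  have ha := cpow_lam_ne q lam₁
  have hb := cpow_lam_ne q lam₂
  have hQ : (q : ℂ) ^ l ≠ 0 := pow_ne_zero l h0
  -- the factors `o = [1]` make the identity homogeneous in `(q - q⁻¹)⁻¹`
  have key : ∀ o r n n1 n2 m d t w k c s : ℂ, o = 1 → n ≠ 0 → n1 ≠ 0 → n2 ≠ 0 →
      r * (n * n1 * n2) * o - n * m * n * (d ^ 2 * t) * o -
        k * m * n1 * (s * n2 - n * (d * t)) * d = c * n2 * w * o ^ 2 →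
      r - n / n2 * (m / n1) * (d ^ 2 * t) - k * m / n * (s - n / n2 * (d * t)) * d =
        c / (n * n1) * w := by
    rintro o r n n1 n2 m d t w k c s rfl hn hn1 hn2 h
    field_simp
    linear_combination h
  unfold zetaCoeff epsCoeff
  refine key (qnum q 1) _ _ _ _ _ _ _ _ _ _ _ h1.qnum_one hL0 hL1 hL2 ?_
  simp only [rowCoeff, deltaCoeff, specFactor, qnum_eq, div_eq_mul_inv,
    Complex.cpow_add _ _ h0, Complex.cpow_sub _ _ h0, Complex.cpow_neg, Complex.cpow_natCast,
    cpow_two_mul_natCast, cpow_two, mul_add, Nat.cast_zero, add_zero, Complex.cpow_one,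
    zero_add, pow_zero, pow_one, sub_zero, Nat.cast_one, mul_one,
    Nat.cast_add, one_add_one_eq_two]
  generalize (q : ℂ) ^ lam₁ = a at *
  generalize (q : ℂ) ^ lam₂ = b at *
  generalize (q : ℂ) ^ l = Q at *
  generalize ((q : ℂ) - (q : ℂ)⁻¹)⁻¹ = D at *
  generalize (q : ℂ) = z at *
  generalize (x : ℂ) = x at *
  generalize (y : ℂ) = y at *
  clear hL0 hL1 hL2 key h1
  field_simp
  ring

end identities

/-! ### Decomposition into cyclic submodules -/

section cyclicModules

variable {q : ℂˣ} {p : ℕ} {M : Type*} [AddCommGroup M] [Module ℂ M]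
  {ρ : UqSl2 q →ₐ[ℂ] Module.End ℂ M} {u : M}

theorem self_mem_cyclic (ρ : UqSl2 q →ₐ[ℂ] Module.End ℂ M) (u : M) : u ∈ cyclic ρ u :=
  Submodule.subset_span ⟨1, by simp⟩

theorem rep_mem_cyclic (a : UqSl2 q) {w : M} (hw : w ∈ cyclic ρ u) : ρ a w ∈ cyclic ρ u :=
  (cyclicRep ρ u a ⟨w, hw⟩).2

theorem hwMap_nb_zero (hp : 0 < p) : hwMap ρ p u (nb p 0) = u := by
  simp [hwMap_nb hp, qfact_zero]

/-- The cyclic submodule generated by a highest weight vector is the image of `V_L`. -/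
theorem range_hwMap {L : ℂ} (hqp : q ^ p = 1) (hp : 0 < p)
    (h : IsModuleHom (V q hqp L) ρ (hwMap ρ p u)) :
    LinearMap.range (hwMap ρ p u) = cyclic ρ u := by
  apply le_antisymm
  · rintro _ ⟨v, rfl⟩
    rw [← (Pi.basisFun ℂ (Fin p)).sum_repr v, map_sum]
    refine sum_mem fun i _ => ?_
    rw [map_smul, basisFun_eq_nb, hwMap_nb i.isLt]
    refine Submodule.smul_mem _ _ (Submodule.smul_mem _ _ ?_)
    rw [← map_pow]
    exact rep_mem_cyclic _ (self_mem_cyclic ρ u)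
  · refine Submodule.span_le.2 ?_
    rintro _ ⟨a, rfl⟩
    exact ⟨V q hqp L a (nb p 0), by rw [h, hwMap_nb_zero hp]⟩

theorem areIsomorphic_cyclicRep {L : ℂ} (hqp : q ^ p = 1) (hp : 0 < p)
    (h : IsModuleHom (V q hqp L) ρ (hwMap ρ p u)) (hi : Function.Injective (hwMap ρ p u)) :
    AreIsomorphic (V q hqp L) (cyclicRep ρ u) :=
  ⟨(LinearEquiv.ofInjective _ hi).trans (LinearEquiv.ofEq _ _ (range_hwMap hqp hp h)),
    fun a v => Subtype.ext (h a v)⟩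

theorem summandProj_of_mem {W : Fin p → Submodule ℂ M} (h : DirectSum.IsInternal W) {l : Fin p}
    {w : M} (hw : w ∈ W l) : summandProj h l w = w := by
  have h1 : (LinearEquiv.ofBijective (DirectSum.coeLinearMap W) (bijective_of_isInternal h)).symm w
      = DirectSum.lof ℂ (Fin p) (fun k => W k) l ⟨w, hw⟩ := by
    rw [LinearEquiv.symm_apply_eq]
    simp
  simp only [summandProj, LinearMap.comp_apply, LinearEquiv.coe_coe, h1]
  simp [DirectSum.component.lof_self]

theorem summandProj_of_mem_ne {W : Fin p → Submodule ℂ M} (h : DirectSum.IsInternal W)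
    {l m : Fin p} (hm : m ≠ l) {w : M} (hw : w ∈ W m) : summandProj h l w = 0 := by
  have h1 : (LinearEquiv.ofBijective (DirectSum.coeLinearMap W) (bijective_of_isInternal h)).symm w
      = DirectSum.lof ℂ (Fin p) (fun k => W k) m ⟨w, hw⟩ := by
    rw [LinearEquiv.symm_apply_eq]
    simp
  simp only [summandProj, LinearMap.comp_apply, LinearEquiv.coe_coe, h1]
  simp [DirectSum.component.of, hm]

/-- The coordinates of a vector of `V_L` killed by `e` vanish, except possibly the first. -/
theorem coord_eq_zero_of_e {L : ℂ} (hL : ∀ i, i + 1 < p → qnum q (L - i) ≠ 0) {v : Fin p → ℂ}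
    (he : verGen q p L .e v = 0) {i : ℕ} (hi : i + 1 < p) : coord p (i + 1) v = 0 := by
  have h := coord_e (q := q) (p := p) L i v
  rw [he, map_zero] at h
  exact (mul_eq_zero.1 h.symm).resolve_left (hL i hi)

theorem eq_zero_of_coord {v : Fin p → ℂ} (h : ∀ i < p, coord p i v = 0) : v = 0 := by
  ext i
  have := h i i.isLt
  rwa [coord, dif_pos i.isLt] at this

end cyclicModules

section decomposition

variable {q : ℂˣ} {p : ℕ} {lam₁ lam₂ : ℂ}

/-- The linear map `⨁_l V_{λ₁+λ₂-2l} → V_{λ₁} ⊗ V_{λ₂}` sending the `l`-th highest weight vector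
`v_0` to `Ω_l`. -/
noncomputable def sumMap (hqp : q ^ p = 1) (lam₁ lam₂ : ℂ) : (Fin p → Fin p → ℂ) →ₗ[ℂ] VV p :=
  ∑ l : Fin p, hwMap (sl2Tensor q hqp lam₁ lam₂) p (Omega q p lam₁ lam₂ l) ∘ₗ LinearMap.proj l

theorem sumMap_apply (hqp : q ^ p = 1) (z : Fin p → Fin p → ℂ) : sumMap hqp lam₁ lam₂ z =
    ∑ l : Fin p, hwMap (sl2Tensor q hqp lam₁ lam₂) p (Omega q p lam₁ lam₂ l) (z l) := by
  simp [sumMap]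

theorem sumMap_single (hqp : q ^ p = 1) (l : Fin p) (v : Fin p → ℂ) :
    sumMap hqp lam₁ lam₂ (Pi.single l v) =
      hwMap (sl2Tensor q hqp lam₁ lam₂) p (Omega q p lam₁ lam₂ l) v := by
  rw [sumMap_apply, Finset.sum_eq_single l]
  · simp
  · intro m _ hm
    rw [Pi.single_eq_of_ne hm, map_zero]
  · simp

variable (hp : Odd p) (hp1 : 1 < p) (hq : IsPrimitiveRoot q p) (h1 : Condition1 q p lam₁ lam₂)
include hp hp1 hq h1

theorem sl2Tensor_pow_f_Omega {l : ℕ} (hl : l < p) :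
    (sl2Tensor q hq.pow_eq_one lam₁ lam₂ (sl2 q .f) ^ p) (Omega q p lam₁ lam₂ l) = 0 := by
  rw [Omega_eq_smul_Xi hp hp1 hq h1 hl, map_smul, sl2Tensor_pow_f_Xi hq.pow_eq_one h1 hp1, smul_zero]

theorem hwMap_Omega_isModuleHom (l : Fin p) :
    IsModuleHom (V q hq.pow_eq_one (lam₁ + lam₂ - 2 * ((l : ℕ) : ℂ)))
      (sl2Tensor q hq.pow_eq_one lam₁ lam₂)
      (hwMap (sl2Tensor q hq.pow_eq_one lam₁ lam₂) p (Omega q p lam₁ lam₂ l)) :=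
  hwMap_isModuleHom hp hp1 hq (sl2Tensor_e_Omega _ h1 l.isLt) (sl2Tensor_K_Omega _ l)
    (sl2Tensor_pow_f_Omega hp hp1 hq h1 l.isLt)

theorem rep_sumMap (a : UqSl2 q) (z : Fin p → Fin p → ℂ) :
    sl2Tensor q hq.pow_eq_one lam₁ lam₂ a (sumMap hq.pow_eq_one lam₁ lam₂ z) =
      sumMap hq.pow_eq_one lam₁ lam₂
        fun l => V q hq.pow_eq_one (lam₁ + lam₂ - 2 * ((l : ℕ) : ℂ)) a (z l) := by
  simp only [sumMap_apply, map_sum, hwMap_Omega_isModuleHom hp hp1 hq h1 _ a]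

/-- Injectivity of `sumMap`, by induction on a bound `n` for the nonzero coordinates: applying `e`
lowers the bound, and an element killed by `e` is a combination of the linearly independent
vectors `Ω_l`. -/
theorem sumMap_eq_zero (n : ℕ) (z : Fin p → Fin p → ℂ)
    (hz : ∀ l, ∀ i, n ≤ i → coord p i (z l) = 0)
    (h0 : sumMap hq.pow_eq_one lam₁ lam₂ z = 0) : z = 0 := by
  induction n generalizing z with
  | zero => exact funext fun l => eq_zero_of_coord fun i _ => hz l i (Nat.zero_le _)
  | succ n ih =>
    have he := ih (fun l => V q hq.pow_eq_one (lam₁ + lam₂ - 2 * ((l : ℕ) : ℂ)) (sl2 q .e) (z l))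
      (fun l i hi => by rw [V_gen, coord_e, hz l (i + 1) (by omega), mul_zero])
      (by rw [← rep_sumMap hp hp1 hq h1, h0, map_zero])
    have hc : ∀ l, ∀ i, i + 1 < p → coord p (i + 1) (z l) = 0 := fun l i hi =>
      coord_eq_zero_of_e (L := lam₁ + lam₂ - 2 * ((l : ℕ) : ℂ))
        (fun i hi => h1.sum l.isLt hi.le) (by simpa [V_gen] using congrFun he l) hi
    have hz0 : ∀ l, z l = coord p 0 (z l) • nb p 0 := fun l => by
      refine sub_eq_zero.1 (eq_zero_of_coord fun i hi => ?_)
      rw [map_sub, map_smul, coord_nb (by omega)]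
      rcases i with _ | i
      · simp
      · simp [hc l i hi]
    have hr := congrArg (row p 0) h0
    rw [sumMap_apply, map_sum, map_zero] at hr
    refine funext fun l => ?_
    have hrl := congrArg (coord p l) hr
    rw [map_sum, map_zero, Finset.sum_eq_single l] at hrl
    · rw [hz0 l, map_smul, hwMap_nb_zero (by omega), map_smul, row_zero_Omega l.isLt, map_smul,
        map_smul, coord_nb l.isLt, if_pos rfl] at hrl
      have h2 : qnum q (lam₂ - (l : ℕ)) ≠ 0 := h1.right l.isLt
      have h3 := h1.left_add_one
      have : coord p 0 (z l) = 0 := by simpa [h2, h3] using hrl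
      rw [hz0 l, this, zero_smul]
      rfl
    · intro m _ hm
      rw [hz0 m, map_smul, hwMap_nb_zero (by omega), map_smul, row_zero_Omega m.isLt, map_smul,
        map_smul, coord_nb m.isLt, if_neg (fun h => hm (Fin.ext h.symm)), smul_zero, smul_zero]
    · simp

theorem sumMap_injective : Function.Injective (sumMap hq.pow_eq_one lam₁ lam₂) :=
  (injective_iff_map_eq_zero _).2 fun z h0 => sumMap_eq_zero hp hp1 hq h1 p z
    (fun l i hi => by rw [coord, dif_neg (by omega)]; rfl) h0

/-- The isomorphism `⨁_l V_{λ₁+λ₂-2l} ≃ V_{λ₁} ⊗ V_{λ₂}`. -/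
noncomputable def sumEquiv : (Fin p → Fin p → ℂ) ≃ₗ[ℂ] VV p :=
  LinearMap.linearEquivOfInjective (sumMap hq.pow_eq_one lam₁ lam₂)
    (sumMap_injective hp hp1 hq h1) (by simp [Module.finrank_tensorProduct, Module.finrank_pi_fintype])

theorem sumEquiv_apply (z : Fin p → Fin p → ℂ) :
    sumEquiv hp hp1 hq h1 z = sumMap hq.pow_eq_one lam₁ lam₂ z := rfl

theorem range_hwMap_Omega (l : Fin p) :
    LinearMap.range (hwMap (sl2Tensor q hq.pow_eq_one lam₁ lam₂) p (Omega q p lam₁ lam₂ l)) =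
      cyclic (sl2Tensor q hq.pow_eq_one lam₁ lam₂) (Omega q p lam₁ lam₂ l) :=
  range_hwMap hq.pow_eq_one (by omega) (hwMap_Omega_isModuleHom hp hp1 hq h1 l)

theorem hwMap_Omega_mem (l : Fin p) (v : Fin p → ℂ) :
    hwMap (sl2Tensor q hq.pow_eq_one lam₁ lam₂) p (Omega q p lam₁ lam₂ l) v ∈
      cyclic (sl2Tensor q hq.pow_eq_one lam₁ lam₂) (Omega q p lam₁ lam₂ l) :=
  range_hwMap_Omega hp hp1 hq h1 l ▸ LinearMap.mem_range_self _ v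

theorem isInternal_cyclic_Omega : DirectSum.IsInternal fun l : Fin p =>
    cyclic (sl2Tensor q hq.pow_eq_one lam₁ lam₂) (Omega q p lam₁ lam₂ l) := by
  classical
  constructor
  · refine (injective_iff_map_eq_zero _).2 fun a ha => ?_
    have hex : ∀ l : Fin p, ∃ v, hwMap (sl2Tensor q hq.pow_eq_one lam₁ lam₂) p (Omega q p lam₁ lam₂ l) v =
        a l := fun l => by
      have hal : (a l : VV p) ∈ cyclic (sl2Tensor q hq.pow_eq_one lam₁ lam₂)
        (Omega q p lam₁ lam₂ l) := (a l).2
      rwa [← range_hwMap_Omega hp hp1 hq h1 l] at hal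
    choose z hz using hex
    have h0 : z = 0 := by
      apply sumMap_injective hp hp1 hq h1
      rw [map_zero, sumMap_apply, ← ha, DirectSum.coeAddMonoidHom_eq_dfinsuppSum,
        DFinsupp.sum_eq_sum_fintype]
      · exact Finset.sum_congr rfl fun l _ => hz l
      · simp
    refine DFinsupp.ext fun l => Subtype.ext ?_
    rw [← hz l, h0]
    simp
  · intro u
    obtain ⟨z, rfl⟩ := (sumEquiv hp hp1 hq h1).surjective u
    refine ⟨∑ l, DirectSum.of (fun l : Fin p => cyclic (sl2Tensor q hq.pow_eq_one lam₁ lam₂)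
      (Omega q p lam₁ lam₂ l)) l ⟨_, hwMap_Omega_mem hp hp1 hq h1 l (z l)⟩, ?_⟩
    rw [map_sum, sumEquiv_apply, sumMap_apply]
    simp

theorem hwMap_Omega_injective (l : Fin p) : Function.Injective
    (hwMap (sl2Tensor q hq.pow_eq_one lam₁ lam₂) p (Omega q p lam₁ lam₂ l)) := fun v w h => by
  rw [← sumMap_single, ← sumMap_single] at h
  exact Pi.single_injective (M := fun _ => Fin p → ℂ) l (sumMap_injective hp hp1 hq h1 h)

/-- Linear maps out of `V_{λ₁} ⊗ V_{λ₂}` are determined by their values on the vectors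
`f ^ k Ξ_l`. -/
theorem linearMap_ext_Xi {M : Type*} [AddCommGroup M] [Module ℂ M] {S T : VV p →ₗ[ℂ] M}
    (h : ∀ l < p, ∀ k : ℕ, S ((sl2Tensor q hq.pow_eq_one lam₁ lam₂ (sl2 q .f) ^ k)
      (Xi q p lam₁ lam₂ l)) = T ((sl2Tensor q hq.pow_eq_one lam₁ lam₂ (sl2 q .f) ^ k)
      (Xi q p lam₁ lam₂ l))) : S = T := by
  suffices hh : S ∘ₗ sumMap hq.pow_eq_one lam₁ lam₂ = T ∘ₗ sumMap hq.pow_eq_one lam₁ lam₂ by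
    refine LinearMap.ext fun u => ?_
    obtain ⟨z, rfl⟩ := (sumEquiv hp hp1 hq h1).surjective u
    exact LinearMap.congr_fun hh z
  refine LinearMap.pi_ext' fun l => linearMap_ext_nb fun k hk => ?_
  simp only [LinearMap.comp_apply, LinearMap.single_apply, sumMap_single, hwMap_nb hk,
    Omega_eq_smul_Xi hp hp1 hq h1 l.isLt, map_smul, h l l.isLt]

end decomposition

/-! ### Intertwining `f_0` and `e_0` -/

section intertwiner

variable {q : ℂˣ} {p : ℕ} {lam₁ lam₂ : ℂ} {x y : ℂˣ}

/-- The Serre relation between `f_1` and `f_0`, solved for `f_0 f_1 ^ 3`. -/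
theorem f_zero_pow_f_three (hqp : q ^ p = 1) (lam₁ lam₂ : ℂ) (x y : ℂˣ) (v : VV p) :
    affTensor q hqp lam₁ x lam₂ y (aff q (.f 0)) ((sl2Tensor q hqp lam₁ lam₂ (sl2 q .f) ^ 3) v) =
      (sl2Tensor q hqp lam₁ lam₂ (sl2 q .f) ^ 3) (affTensor q hqp lam₁ x lam₂ y (aff q (.f 0)) v) -
      qthree q • (sl2Tensor q hqp lam₁ lam₂ (sl2 q .f) ^ 2) (affTensor q hqp lam₁ x lam₂ y
        (aff q (.f 0)) ((sl2Tensor q hqp lam₁ lam₂ (sl2 q .f) ^ 1) v)) +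
      qthree q • (sl2Tensor q hqp lam₁ lam₂ (sl2 q .f) ^ 1) (affTensor q hqp lam₁ x lam₂ y
        (aff q (.f 0)) ((sl2Tensor q hqp lam₁ lam₂ (sl2 q .f) ^ 2) v)) := by
  have := congrArg (fun a => affTensor q hqp lam₁ x lam₂ y a v)
    (aff_serre_f q 1 0 (by decide))
  simp only [serre, map_sub, map_add, map_smul, map_mul, map_pow, affTensor_f_one, map_zero,
    LinearMap.sub_apply, LinearMap.add_apply, LinearMap.smul_apply, Module.End.mul_apply,
    LinearMap.zero_apply] at this
  rw [pow_one]
  exact (sub_eq_zero.1 this).symm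

variable (hp : Odd p) (hp1 : 1 < p) (hq : IsPrimitiveRoot q p) (h1 : Condition1 q p lam₁ lam₂)
  {T : VV p →ₗ[ℂ] VV p}
  (hT : IsModuleHom (sl2Tensor q hq.pow_eq_one lam₁ lam₂) (sl2Tensor q hq.pow_eq_one lam₂ lam₁) T)
  {τ : ℕ → ℂ} (hτ : ∀ l < p, T (Xi q p lam₁ lam₂ l) = τ l • Xi q p lam₂ lam₁ l)
  (hrec : ∀ l, l + 1 < p →
    τ (l + 1) * (qnum q (lam₁ - l) * specFactor q lam₁ lam₂ x y (l + 1)) =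
      τ l * (qnum q (lam₂ - l) * specFactor q lam₂ lam₁ y x (l + 1)))

include hτ in
theorem map_Xi_succ {l : ℕ} (hl : l < p) :
    T (Xi q p lam₁ lam₂ (l + 1)) = τ (l + 1) • Xi q p lam₂ lam₁ (l + 1) := by
  rcases lt_or_eq_of_le (Nat.succ_le_of_lt hl) with h | h
  · exact hτ _ h
  · rw [Xi_of_le h.ge, Xi_of_le h.ge, map_zero, smul_zero]

include hp hp1 h1 hT hτ hrec

/-- A `U_q(sl₂)`-homomorphism whose scalars on the highest weight vectors satisfy the recursion
commutes with `f_0`. On `f ^ k Ξ_l` with `k ≤ 2` this is a comparison of matrix coefficients; the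
Serre relation reduces larger `k` to these. -/
theorem comm_f_zero (v : VV p) :
    T (affTensor q hq.pow_eq_one lam₁ x lam₂ y (aff q (.f 0)) v) =
      affTensor q hq.pow_eq_one lam₂ y lam₁ x (aff q (.f 0)) (T v) := by
  have hqp := hq.pow_eq_one
  have hTf := hT.pow (sl2 q .f)
  have step0 : ∀ l < p, T (affTensor q hqp lam₁ x lam₂ y (aff q (.f 0)) (Xi q p lam₁ lam₂ l)) =
      τ l • affTensor q hqp lam₂ y lam₁ x (aff q (.f 0)) (Xi q p lam₂ lam₁ l) := by
    intro l hl
    rcases l with _ | l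
    · rw [f_zero_Xi_zero hqp x y h1, f_zero_Xi_zero hqp y x h1.symm, map_zero, smul_zero]
    · rw [f_zero_Xi_succ hqp x y h1, f_zero_Xi_succ hqp y x h1.symm, map_smul, hτ l (by omega),
        smul_smul, smul_smul, deltaCoeff_eq, deltaCoeff_eq]
      congr 1
      have e1 : lam₂ + 1 - ((l + 1 : ℕ) : ℂ) = lam₂ - l := by push_cast; ring
      have e2 : lam₁ + 1 - ((l + 1 : ℕ) : ℂ) = lam₁ - l := by push_cast; ring
      rw [e1, e2]
      linear_combination -(q * (x : ℂ)⁻¹ * (y : ℂ)⁻¹ * qnum q (l + 1 : ℕ)) * hrec l hl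
  have hcomm : T ∘ₗ affTensor q hqp lam₁ x lam₂ y (aff q (.f 0)) =
      affTensor q hqp lam₂ y lam₁ x (aff q (.f 0)) ∘ₗ T := by
    refine linearMap_ext_Xi hp hp1 hq h1 fun l hl k => ?_
    have hsum := add_comm lam₂ lam₁
    have heps := epsCoeff_symm x y (h1.sum_add_two hqp hl)
    simp only [LinearMap.comp_apply, hTf, hτ l hl, map_smul]
    induction k using Nat.strong_induction_on with
    | _ k ih =>
      match k with
      | 0 => simpa using step0 l hl
      | 1 =>
        rw [f_zero_f_Xi hqp x y h1 hl, f_zero_f_Xi hqp y x h1.symm hl, map_add, map_smul, map_smul,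
          hTf, step0 l hl, hτ l hl, hsum, heps, map_smul]
        module
      | 2 =>
        have hz : τ (l + 1) * zetaCoeff q lam₁ lam₂ x y l =
            τ l * zetaCoeff q lam₂ lam₁ y x l ∨ p ≤ l + 1 := by
          by_cases hl1 : l + 1 < p
          · left
            rw [zetaCoeff_eq h1 hqp hp1 x y hl, zetaCoeff_eq h1.symm hqp hp1 y x hl, hsum]
            linear_combination (q * (((q : ℂ) ^ l) ^ 2)⁻¹ * (x : ℂ)⁻¹ * (y : ℂ)⁻¹ * qnum q 2 *
              qnum q (lam₁ + lam₂ - l + 1) /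
              (qnum q (lam₁ + lam₂ - 2 * l) * qnum q (lam₁ + lam₂ - 2 * l + 1))) * hrec l hl1
          · right; omega
        have hz' : (τ (l + 1) * zetaCoeff q lam₁ lam₂ x y l) • Xi q p lam₂ lam₁ (l + 1) =
            (τ l * zetaCoeff q lam₂ lam₁ y x l) • Xi q p lam₂ lam₁ (l + 1) := by
          rcases hz with hz | hz
          · rw [hz]
          · rw [Xi_of_le hz, smul_zero, smul_zero]
        rw [f_zero_sq_f_Xi hqp x y h1 hl, f_zero_sq_f_Xi hqp y x h1.symm hl, map_add, map_add,
          map_smul, map_smul, map_smul, hTf, hTf, step0 l hl, hτ l hl, map_Xi_succ hτ hl, hsum,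
          heps, map_smul, map_smul, smul_add, smul_add, smul_smul (τ l) (zetaCoeff _ _ _ _ _ _),
          ← hz']
        module
      | k + 3 =>
        have i0 := ih k (by omega)
        have i1 := ih (1 + k) (by omega)
        have i2 := ih (2 + k) (by omega)
        rw [pow_add _ 1, Module.End.mul_apply, pow_add _ 1, Module.End.mul_apply] at i1
        rw [pow_add _ 2, Module.End.mul_apply, pow_add _ 2, Module.End.mul_apply] at i2
        rw [add_comm k 3, pow_add, Module.End.mul_apply, pow_add, Module.End.mul_apply,
          f_zero_pow_f_three, f_zero_pow_f_three, map_add, map_sub, map_smul, map_smul, hTf, hTf,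
          hTf, i0, i1, i2]
        simp only [map_smul]
        module
  exact LinearMap.congr_fun hcomm v

end intertwiner

section eZero

variable {q : ℂˣ} {p : ℕ} {lam₁ lam₂ : ℂ} {x y : ℂˣ}

theorem Xi_zero (hqp : q ^ p = 1) (hp1 : 1 < p) (h1 : Condition1 q p lam₁ lam₂) :
    Xi q p lam₁ lam₂ 0 = nb p 0 ⊗ₜ nb p 0 := by
  refine eq_of_e_of_row_zero hqp lam₁ lam₂ (fun i hi => h1.left hi.le) ?_ ?_
  · rw [sl2Tensor_e_Xi hqp h1, sl2Tensor_e, ver_e_zero, ver_e_zero]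
    simp
  · rw [row_zero_Xi h1, row_tmul, coord_nb (by omega), fvec, qfact_zero]
    simp

/-- The coefficient of `f Ξ_0` is symmetric under exchange of the two modules, and that of `Ξ_1` is
proportional to the factor in the recursion for the scalars of an intertwiner. -/
theorem e_zero_Xi_zero (hqp : q ^ p = 1) (hp1 : 1 < p) (h1 : Condition1 q p lam₁ lam₂)
    (x y : ℂˣ) :
    affTensor q hqp lam₁ x lam₂ y (aff q (.e 0)) (Xi q p lam₁ lam₂ 0) =
      ((q : ℂ)⁻¹ * (qnum q lam₁ * specFactor q lam₁ lam₂ x y 1) / qnum q (lam₁ + lam₂)) •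
        Xi q p lam₁ lam₂ 1 +
      ((q : ℂ)⁻¹ * (x * qnum q lam₁ + y * qnum q lam₂) / qnum q (lam₁ + lam₂)) •
        sl2Tensor q hqp lam₁ lam₂ (sl2 q .f) (Xi q p lam₁ lam₂ 0) := by
  have hL : qnum q (lam₁ + lam₂) ≠ 0 := by
    simpa using h1.sum (l := 0) (i := 0) (by omega) (by omega)
  have h0 := q.ne_zero
  have hb : (q : ℂ) ^ (-lam₂) * (q : ℂ) ^ lam₂ = 1 := by
    rw [← Complex.cpow_add _ _ h0]; simp
  refine eq_of_e_of_row_zero hqp lam₁ lam₂ (fun i hi => h1.left hi.le) ?_ ?_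
  · have hf := rep_e_pow_f (sl2Tensor_e_Xi hqp h1 0) (sl2Tensor_K_Xi hqp 0) 0
    rw [zero_add, pow_one] at hf
    rw [map_add, map_smul, map_smul, sl2Tensor_e_Xi hqp h1, hf, Xi_zero hqp hp1 h1,
      affTensor_e_zero, map_add, map_smul, map_smul, ver_f, ver_f, ver_Kinv, sl2Tensor_e,
      sl2Tensor_e]
    have e1 : ∀ lam : ℂ, verGen q p lam .e (nb p 1) = qnum q lam • nb p 0 := fun lam => by
      simpa using ver_e_succ q p lam (n := 0) hp1
    simp only [map_smul, e1, ver_e_zero, ver_K, Nat.cast_zero, zero_add, mul_zero, sub_zero,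
      h1.qnum_one, one_smul, one_mul, pow_zero, Module.End.one_apply, smul_zero, TensorProduct.tmul_zero, TensorProduct.zero_tmul, add_zero,
      ← TensorProduct.smul_tmul', TensorProduct.tmul_smul, smul_smul, ← add_smul, hb]
    congr 1
    field_simp
  · rw [row_zero_e_zero, map_add, map_smul, map_smul, row_zero_f, row_zero_Xi h1, row_zero_Xi h1,
      ver_f_fvec, zero_add, smul_smul, ← add_smul]
    congr 1
    have ha := cpow_lam_ne q lam₁
    have hb := cpow_lam_ne q lam₂
    have key : ∀ z n u v w s t : ℂ, n ≠ 0 → u * n = v + s * w →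
        z * u = z * v / n + z * s / n * w := by
      intro z n u v w s t hn h
      field_simp
      linear_combination z * h
    refine key _ _ _ _ _ _ 0 hL ?_
    simp only [specFactor, qnum_eq, Complex.cpow_add _ _ h0, Complex.cpow_sub _ _ h0,
      Complex.cpow_neg, cpow_two, Nat.cast_one, mul_one]
    field_simp
    ring

theorem comm_e_zero_f_one (hqp : q ^ p = 1) (lam₁ lam₂ : ℂ) (x y : ℂˣ) (v : VV p) :
    affTensor q hqp lam₁ x lam₂ y (aff q (.e 0)) (sl2Tensor q hqp lam₁ lam₂ (sl2 q .f) v) =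
      sl2Tensor q hqp lam₁ lam₂ (sl2 q .f) (affTensor q hqp lam₁ x lam₂ y (aff q (.e 0)) v) := by
  have := congrArg (fun a => affTensor q hqp lam₁ x lam₂ y a v) (aff_e_f' q 0 1 (by decide))
  simpa [affTensor_f_one] using this

theorem e_zero_f_zero (hqp : q ^ p = 1) (lam₁ lam₂ : ℂ) (x y : ℂˣ) (v : VV p) :
    affTensor q hqp lam₁ x lam₂ y (aff q (.e 0)) (affTensor q hqp lam₁ x lam₂ y (aff q (.f 0)) v) =
      affTensor q hqp lam₁ x lam₂ y (aff q (.f 0)) (affTensor q hqp lam₁ x lam₂ y (aff q (.e 0)) v) +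
      ((q : ℂ) - (q : ℂ)⁻¹)⁻¹ • (sl2Tensor q hqp lam₁ lam₂ (sl2 q .Kinv) v -
        sl2Tensor q hqp lam₁ lam₂ (sl2 q .K) v) := by
  have := congrArg (fun a => affTensor q hqp lam₁ x lam₂ y a v) (aff_e_f q 0)
  simp only [map_sub, map_mul, map_smul, affTensor_K_zero, affTensor_Kinv_zero,
    LinearMap.sub_apply, Module.End.mul_apply, LinearMap.smul_apply] at this
  rw [← this]
  abel

variable (hp : Odd p) (hp1 : 1 < p) (hq : IsPrimitiveRoot q p) (h1 : Condition1 q p lam₁ lam₂)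
  {T : VV p →ₗ[ℂ] VV p}
  (hT : IsModuleHom (sl2Tensor q hq.pow_eq_one lam₁ lam₂) (sl2Tensor q hq.pow_eq_one lam₂ lam₁) T)
  {τ : ℕ → ℂ} (hτ : ∀ l < p, T (Xi q p lam₁ lam₂ l) = τ l • Xi q p lam₂ lam₁ l)
  (hrec : ∀ l, l + 1 < p →
    τ (l + 1) * (qnum q (lam₁ - l) * specFactor q lam₁ lam₂ x y (l + 1)) =
      τ l * (qnum q (lam₂ - l) * specFactor q lam₂ lam₁ y x (l + 1)))
  (hspec : ∀ l, l + 1 < p → specFactor q lam₁ lam₂ x y (l + 1) ≠ 0)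

include hp hp1 h1 hT hτ hrec hspec

/-- Commutation with `e_0`. The defect `E = T e_0 - e_0 T` commutes with `f_1` and `f_0`, and the
vector `Ξ_{l+1}` is obtained from `Ξ_0, …, Ξ_l` by these two operators because `ζ_l ≠ 0`. Hence
`E = 0` as soon as `E Ξ_0 = 0`. -/
theorem comm_e_zero (v : VV p) :
    T (affTensor q hq.pow_eq_one lam₁ x lam₂ y (aff q (.e 0)) v) =
      affTensor q hq.pow_eq_one lam₂ y lam₁ x (aff q (.e 0)) (T v) := by
  have hqp := hq.pow_eq_one
  have hf0 := comm_f_zero hp hp1 hq h1 hT hτ hrec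
  obtain ⟨E, hE⟩ : ∃ E, E = T ∘ₗ affTensor q hqp lam₁ x lam₂ y (aff q (.e 0)) -
    affTensor q hqp lam₂ y lam₁ x (aff q (.e 0)) ∘ₗ T := ⟨_, rfl⟩
  have hE' : ∀ v, E v = T (affTensor q hqp lam₁ x lam₂ y (aff q (.e 0)) v) -
    affTensor q hqp lam₂ y lam₁ x (aff q (.e 0)) (T v) := fun v => by rw [hE]; rfl
  have hEf : ∀ v, E (sl2Tensor q hqp lam₁ lam₂ (sl2 q .f) v) =
      sl2Tensor q hqp lam₂ lam₁ (sl2 q .f) (E v) := fun v => by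
    rw [hE', hE', comm_e_zero_f_one, hT, hT, comm_e_zero_f_one, map_sub]
  have hEpow : ∀ k v, E ((sl2Tensor q hqp lam₁ lam₂ (sl2 q .f) ^ k) v) =
      (sl2Tensor q hqp lam₂ lam₁ (sl2 q .f) ^ k) (E v) := by
    intro k v
    induction k with
    | zero => simp
    | succ k ih =>
      rw [pow_succ', Module.End.mul_apply, hEf, ih, pow_succ', Module.End.mul_apply]
  have hEf0 : ∀ v, E (affTensor q hqp lam₁ x lam₂ y (aff q (.f 0)) v) =
      affTensor q hqp lam₂ y lam₁ x (aff q (.f 0)) (E v) := fun v => by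
    rw [hE', hE', e_zero_f_zero, hf0, e_zero_f_zero, map_add, hf0, map_smul, map_sub T, hT, hT,
      map_sub]
    abel
  have hE0 : E (Xi q p lam₁ lam₂ 0) = 0 := by
    have hr := hrec 0 hp1
    simp only [zero_add, Nat.cast_zero, sub_zero] at hr
    rw [hE', hτ 0 (by omega), map_smul, e_zero_Xi_zero hqp hp1 h1, e_zero_Xi_zero hqp hp1 h1.symm,
      map_add, map_smul, map_smul, hT, hτ 0 (by omega), hτ 1 hp1, map_smul, smul_smul, smul_add,
      smul_smul, add_comm lam₂ lam₁, add_comm ((y : ℂ) * _) _]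
    match_scalars
    swap
    · ring
    linear_combination ((q : ℂ)⁻¹ / qnum q (lam₁ + lam₂)) * hr
  have hEXi : ∀ l < p, E (Xi q p lam₁ lam₂ l) = 0 := by
    intro l
    induction l with
    | zero => exact fun _ => hE0
    | succ l ih =>
      intro hl
      have hl' : l < p := by omega
      have h := congrArg E (f_zero_sq_f_Xi hqp x y h1 hl')
      rw [hEf0, hEpow, map_add, map_add, map_smul, map_smul, map_smul, hEpow, hEpow, hEf0,
        ih hl'] at h
      simp only [map_zero, smul_zero, zero_add] at h
      refine (smul_eq_zero.1 h.symm).resolve_left ?_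
      have h2 : qnum q 2 ≠ 0 := by
        have := qnum_natCast_ne_zero hp hp1 hq (k := 2) (by omega)
          (by obtain ⟨k, rfl⟩ := hp; omega)
        exact_mod_cast this
      have hL0 : qnum q (lam₁ + lam₂ - 2 * l) ≠ 0 := by
        simpa using h1.sum (i := 0) hl' (by omega)
      rw [zetaCoeff_eq h1 hqp hp1 x y hl']
      have := h1.sum_add_one hl'
      have := h1.sum_sub hl'
      have := h1.left (i := l) (by omega)
      have := hspec l hl
      have := q.ne_zero
      have := x.ne_zero
      have := y.ne_zero
      positivity
  have hzero : E = 0 := by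
    refine linearMap_ext_Xi hp hp1 hq h1 fun l hl k => ?_
    rw [hEpow, hEXi l hl, map_zero, LinearMap.zero_apply]
  exact sub_eq_zero.1 (by rw [← hE', hzero, LinearMap.zero_apply])

/-- Hence such a `U_q(sl₂)`-homomorphism is a homomorphism of modules over the affine algebra. -/
theorem isModuleHom_affTensor : IsModuleHom (affTensor q hq.pow_eq_one lam₁ x lam₂ y)
    (affTensor q hq.pow_eq_one lam₂ y lam₁ x) T := by
  refine isModuleHom_aff fun g v => ?_
  cases g with
  | e i =>
    fin_cases i
    · exact comm_e_zero hp hp1 hq h1 hT hτ hrec hspec v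
    · simpa [affTensor_e_one] using hT _ v
  | f i =>
    fin_cases i
    · exact comm_f_zero hp hp1 hq h1 hT hτ hrec v
    · simpa [affTensor_f_one] using hT _ v
  | K i =>
    fin_cases i
    · simpa [affTensor_K_zero] using hT _ v
    · simpa [affTensor_K_one] using hT _ v
  | Kinv i =>
    fin_cases i
    · simpa [affTensor_Kinv_zero] using hT _ v
    · simpa [affTensor_Kinv_one] using hT _ v

end eZero

/-! ### Homomorphisms and their scalars on highest weight vectors -/

section scalars

variable {q : ℂˣ} {p : ℕ} {lam₁ lam₂ : ℂ}

theorem condition2_iff (x y : ℂˣ) : Condition2 q p lam₁ lam₂ x y ↔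
    ∀ l : ℕ, 1 ≤ l → l ≤ p - 1 → specFactor q lam₂ lam₁ y x l ≠ 0 := by
  refine forall_congr' fun l => imp_congr_right fun _ => imp_congr_right fun _ => not_congr ?_
  have hx := x.ne_zero
  have hz := cpow_lam_ne q (-lam₂ + 2 * (l : ℂ) - 2)
  have h : (q : ℂ) ^ (lam₁ + lam₂ - 2 * ((l : ℂ) - 1)) * (q : ℂ) ^ (-lam₂ + 2 * (l : ℂ) - 2) =
      (q : ℂ) ^ lam₁ := by
    rw [← Complex.cpow_add _ _ q.ne_zero]
    congr 1
    ring
  rw [div_eq_iff hx, specFactor, ← h]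
  constructor
  · intro h'
    rw [h']
    ring
  · intro h'
    apply mul_right_cancel₀ hz
    linear_combination -h'

theorem condition3_iff (x y : ℂˣ) : Condition3 q p lam₁ lam₂ x y ↔
    ∀ l : ℕ, 1 ≤ l → l ≤ p - 1 → specFactor q lam₁ lam₂ x y l ≠ 0 := by
  refine forall_congr' fun l => imp_congr_right fun _ => imp_congr_right fun _ => not_congr ?_
  have hx := x.ne_zero
  have hz := cpow_lam_ne q lam₂
  have h : (q : ℂ) ^ (-(lam₁ + lam₂ - 2 * ((l : ℂ) - 1))) * (q : ℂ) ^ lam₂ =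
      (q : ℂ) ^ (-lam₁ + 2 * (l : ℂ) - 2) := by
    rw [← Complex.cpow_add _ _ q.ne_zero]
    congr 1
    ring
  rw [div_eq_iff hx, specFactor, ← h]
  constructor
  · intro h'
    rw [h']
    ring
  · intro h'
    apply mul_right_cancel₀ hz
    linear_combination h'

/-- Under Condition 1 the `l`-th instances of Conditions 2 and 3 cannot fail simultaneously: then
`q ^ (λ₁ + λ₂ - 2(l - 1))` would equal its inverse. -/
theorem specFactor_ne_zero_of_swap (h1 : Condition1 q p lam₁ lam₂) {x y : ℂˣ} {l : ℕ}
    (hl : l + 1 < p) (h : specFactor q lam₂ lam₁ y x (l + 1) = 0) :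
    specFactor q lam₁ lam₂ x y (l + 1) ≠ 0 := by
  intro h'
  have h0 := q.ne_zero
  have hx := x.ne_zero
  have hy := y.ne_zero
  refine h1.sum (l := l) (i := 0) (by omega) (by omega) ?_
  rw [qnum_eq, div_eq_zero_iff]
  left
  simp only [specFactor, Complex.cpow_add _ _ h0, Complex.cpow_sub _ _ h0, Complex.cpow_neg,
    cpow_two_mul_natCast, cpow_two, Nat.cast_add, Nat.cast_one, mul_add, Nat.cast_zero, mul_one,
    Complex.cpow_zero, div_one] at h h' ⊢
  have ha := cpow_lam_ne q lam₁
  have hb := cpow_lam_ne q lam₂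
  have hQ : (q : ℂ) ^ l ≠ 0 := pow_ne_zero l h0
  generalize (q : ℂ) ^ lam₁ = a at *
  generalize (q : ℂ) ^ lam₂ = b at *
  generalize (q : ℂ) ^ l = Q at *
  generalize (x : ℂ) = x at *
  generalize (y : ℂ) = y at *
  field_simp at h h' ⊢
  have h2 : x * (a ^ 2 * b ^ 2 - Q ^ 2 ^ 2) = 0 := by
    linear_combination (a * b) * h + Q ^ 2 * h'
  have := (mul_eq_zero.1 h2).resolve_left hx
  linear_combination this

variable (hp : Odd p) (hp1 : 1 < p) (hq : IsPrimitiveRoot q p) (h1 : Condition1 q p lam₁ lam₂)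
include hp hp1 hq h1

/-- The highest weight vectors of weight `λ₁ + λ₂ - 2l` are the multiples of `Ξ_l`. -/
theorem exists_eq_smul_Xi {l : ℕ} (hl : l < p) {u : VV p}
    (he : sl2Tensor q hq.pow_eq_one lam₁ lam₂ (sl2 q .e) u = 0)
    (hK : sl2Tensor q hq.pow_eq_one lam₁ lam₂ (sl2 q .K) u =
      (q : ℂ) ^ (lam₁ + lam₂ - 2 * l) • u) : ∃ t : ℂ, u = t • Xi q p lam₁ lam₂ l := by
  have hr : row p 0 u = coord p l (row p 0 u) • nb p l := by
    refine sub_eq_zero.1 (eq_zero_of_coord fun i hi => ?_)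
    rw [map_sub, map_smul, coord_nb hl]
    split_ifs with hil
    · simp [hil]
    · have h := congrArg (coord p i) (congrArg (row p 0) hK)
      rw [row_zero_K, map_smul, map_smul, map_smul, coord_K, smul_eq_mul, smul_eq_mul, ← mul_assoc,
        ← Complex.cpow_add _ _ q.ne_zero] at h
      by_contra hne
      have hc : coord p i (row p 0 u) ≠ 0 := by simpa using hne
      have h2 := mul_right_cancel₀ hc h
      rw [← add_sub_assoc, Complex.cpow_sub _ _ q.ne_zero, Complex.cpow_sub _ _ q.ne_zero,
        cpow_two_mul_natCast, cpow_two_mul_natCast] at h2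
      have ha := cpow_lam_ne q (lam₁ + lam₂)
      have hi0 : ((q : ℂ) ^ i) ^ 2 ≠ 0 := pow_ne_zero _ (pow_ne_zero _ q.ne_zero)
      have hl0 : ((q : ℂ) ^ l) ^ 2 ≠ 0 := pow_ne_zero _ (pow_ne_zero _ q.ne_zero)
      rw [div_eq_div_iff hi0 hl0] at h2
      have h3 := mul_left_cancel₀ ha h2
      have h4 : (q ^ 2) ^ l = (q ^ 2) ^ i := by
        ext
        push_cast
        rw [← pow_mul, mul_comm, pow_mul, h3, ← pow_mul, mul_comm, pow_mul]
      exact hil ((hq.pow_of_coprime 2 hp.coprime_two_left).pow_inj hi hl h4.symm)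
  refine ⟨coord p l (row p 0 u) * (qfact q l)⁻¹, ?_⟩
  refine eq_of_e_of_row_zero hq.pow_eq_one lam₁ lam₂ (fun i hi => h1.left hi.le) ?_ ?_
  · rw [he, map_smul, sl2Tensor_e_Xi _ h1, smul_zero]
  · rw [map_smul, row_zero_Xi h1, fvec, smul_smul, mul_assoc,
      inv_mul_cancel₀ (qfact_ne_zero hp hp1 hq hl), mul_one, ← hr]

theorem Xi_ne_zero {l : ℕ} (hl : l < p) : Xi q p lam₁ lam₂ l ≠ 0 := fun h => by
  have h2 := congrArg (coord p l) (congrArg (row p 0) h)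
  rw [row_zero_Xi h1, fvec, map_smul, coord_nb hl, map_zero, map_zero, if_pos rfl, smul_eq_mul,
    mul_one] at h2
  exact qfact_ne_zero hp hp1 hq hl h2

/-- The scalars of an isomorphism on the `Ξ_l` are nonzero, so by the recursion coming from `f_0` the
factors in Conditions 2 and 3 vanish simultaneously, which is impossible. -/
theorem conditions_of_areIsomorphic {x y : ℂˣ}
    (h : AreIsomorphic (affTensor q hq.pow_eq_one lam₁ x lam₂ y)
      (affTensor q hq.pow_eq_one lam₂ y lam₁ x)) :
    Condition2 q p lam₁ lam₂ x y ∧ Condition3 q p lam₁ lam₂ x y := by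
  obtain ⟨T, hT⟩ := h
  have hqp := hq.pow_eq_one
  have hex : ∀ l, l < p → ∃ t : ℂ, T (Xi q p lam₁ lam₂ l) = t • Xi q p lam₂ lam₁ l := by
    intro l hl
    refine exists_eq_smul_Xi hp hp1 hq h1.symm hl ?_ ?_
    · have := hT (aff q (.e 1)) (Xi q p lam₁ lam₂ l)
      rw [affTensor_e_one, affTensor_e_one, sl2Tensor_e_Xi hqp h1, map_zero] at this
      exact this.symm
    · have := hT (aff q (.K 1)) (Xi q p lam₁ lam₂ l)
      rw [affTensor_K_one, affTensor_K_one, sl2Tensor_K_Xi hqp, map_smul] at this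
      rw [add_comm lam₂ lam₁]
      exact this.symm
  choose! τ hτ using hex
  have hτ0 : ∀ l < p, τ l ≠ 0 := fun l hl h => by
    have := hτ l hl
    rw [h, zero_smul] at this
    exact Xi_ne_zero hp hp1 hq h1 hl (T.map_eq_zero_iff.1 this)
  have hrec : ∀ l, l + 1 < p →
      τ (l + 1) * (qnum q (lam₁ - l) * specFactor q lam₁ lam₂ x y (l + 1)) =
        τ l * (qnum q (lam₂ - l) * specFactor q lam₂ lam₁ y x (l + 1)) := by
    intro l hl
    have h := hT (aff q (.f 0)) (Xi q p lam₁ lam₂ (l + 1))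
    rw [f_zero_Xi_succ hqp x y h1, map_smul, LinearEquiv.coe_coe, hτ l (by omega), hτ _ hl, map_smul,
      f_zero_Xi_succ hqp y x h1.symm, smul_smul, smul_smul] at h
    have h2 := smul_left_injective ℂ (Xi_ne_zero hp hp1 hq h1.symm (show l < p by omega)) h
    rw [deltaCoeff_eq, deltaCoeff_eq] at h2
    have e1 : lam₂ + 1 - ((l + 1 : ℕ) : ℂ) = lam₂ - l := by push_cast; ring
    have e2 : lam₁ + 1 - ((l + 1 : ℕ) : ℂ) = lam₁ - l := by push_cast; ring
    rw [e1, e2] at h2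
    have hc : (q : ℂ) * (x : ℂ)⁻¹ * (y : ℂ)⁻¹ * qnum q (l + 1 : ℕ) ≠ 0 :=
      mul_ne_zero (mul_ne_zero (mul_ne_zero q.ne_zero (inv_ne_zero x.ne_zero))
        (inv_ne_zero y.ne_zero)) (qnum_natCast_ne_zero hp hp1 hq (Nat.succ_pos l) hl)
    apply mul_left_cancel₀ hc
    linear_combination -h2
  constructor
  · rw [condition2_iff]
    intro l hl hl' h0
    obtain ⟨l, rfl⟩ : ∃ k, l = k + 1 := ⟨l - 1, by omega⟩
    have h := hrec l (by omega)
    rw [h0, mul_zero, mul_zero] at h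
    exact mul_ne_zero (hτ0 (l + 1) (by omega)) (mul_ne_zero (h1.left (i := l) (by omega))
      (specFactor_ne_zero_of_swap h1 (by omega) h0)) h
  · rw [condition3_iff]
    intro l hl hl' h0
    obtain ⟨l, rfl⟩ : ∃ k, l = k + 1 := ⟨l - 1, by omega⟩
    have h := hrec l (by omega)
    rw [h0, mul_zero, mul_zero] at h
    exact mul_ne_zero (hτ0 l (by omega)) (mul_ne_zero (h1.right (i := l) (by omega))
      (specFactor_ne_zero_of_swap h1.symm (by omega) h0)) h.symm

/-- A linear map acting by a scalar between corresponding summands is a homomorphism. -/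
theorem isModuleHom_of_sumMap {T : VV p →ₗ[ℂ] VV p} {c : Fin p → ℂ}
    (hT : ∀ z, T (sumMap hq.pow_eq_one lam₁ lam₂ z) =
      sumMap hq.pow_eq_one lam₂ lam₁ fun l => c l • z l) :
    IsModuleHom (sl2Tensor q hq.pow_eq_one lam₁ lam₂) (sl2Tensor q hq.pow_eq_one lam₂ lam₁) T := by
  intro a v
  obtain ⟨z, rfl⟩ := (sumEquiv hp hp1 hq h1).surjective v
  have h2 := rep_sumMap hp hp1 hq h1.symm a (fun l => c l • z l)
  simp only [add_comm lam₂ lam₁, map_smul] at h2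
  rw [sumEquiv_apply, rep_sumMap hp hp1 hq h1, hT, hT, h2]

theorem bijective_of_sumMap {T : VV p →ₗ[ℂ] VV p} {c : Fin p → ℂ} (hc : ∀ l, c l ≠ 0)
    (hT : ∀ z, T (sumMap hq.pow_eq_one lam₁ lam₂ z) =
      sumMap hq.pow_eq_one lam₂ lam₁ fun l => c l • z l) : Function.Bijective T := by
  have hinj : Function.Injective T := by
    refine (injective_iff_map_eq_zero _).2 fun v hv => ?_
    obtain ⟨z, rfl⟩ := (sumEquiv hp hp1 hq h1).surjective v
    rw [sumEquiv_apply, hT] at hv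
    have h0 := (injective_iff_map_eq_zero _).1 (sumMap_injective hp hp1 hq h1.symm) _ hv
    have : z = 0 := funext fun l => (smul_eq_zero.1 (congrFun h0 l)).resolve_left (hc l)
    rw [this, map_zero]
  exact ⟨hinj, LinearMap.injective_iff_surjective.1 hinj⟩

/-- The isomorphism `I`, matching the summands of the two decompositions. -/
noncomputable def swapEquiv : VV p ≃ₗ[ℂ] VV p :=
  (sumEquiv hp hp1 hq h1).symm.trans (sumEquiv hp hp1 hq h1.symm)

theorem swapEquiv_sumMap (z : Fin p → Fin p → ℂ) :
    swapEquiv hp hp1 hq h1 (sumMap hq.pow_eq_one lam₁ lam₂ z) =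
      sumMap hq.pow_eq_one lam₂ lam₁ z := by
  rw [swapEquiv, LinearEquiv.trans_apply, ← sumEquiv_apply hp hp1 hq h1,
    LinearEquiv.symm_apply_apply, sumEquiv_apply]

theorem swapEquiv_hwMap (l : Fin p) (v : Fin p → ℂ) :
    swapEquiv hp hp1 hq h1
        (hwMap (sl2Tensor q hq.pow_eq_one lam₁ lam₂) p (Omega q p lam₁ lam₂ l) v) =
      hwMap (sl2Tensor q hq.pow_eq_one lam₂ lam₁) p (Omega q p lam₂ lam₁ l) v := by
  rw [← sumMap_single, swapEquiv_sumMap, sumMap_single]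

theorem swapEquiv_Omega (l : Fin p) :
    swapEquiv hp hp1 hq h1 (Omega q p lam₁ lam₂ l) = Omega q p lam₂ lam₁ l := by
  have := swapEquiv_hwMap hp hp1 hq h1 l (nb p 0)
  rwa [hwMap_nb_zero (by omega), hwMap_nb_zero (by omega)] at this

theorem swapEquiv_isModuleHom : IsModuleHom (sl2Tensor q hq.pow_eq_one lam₁ lam₂)
    (sl2Tensor q hq.pow_eq_one lam₂ lam₁) (swapEquiv hp hp1 hq h1).toLinearMap :=
  isModuleHom_of_sumMap hp hp1 hq h1 (c := fun _ => 1) fun z => by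
    simpa using swapEquiv_sumMap hp hp1 hq h1 z

theorem eq_swapEquiv {J : VV p ≃ₗ[ℂ] VV p}
    (hJ : IsModuleHom (sl2Tensor q hq.pow_eq_one lam₁ lam₂)
      (sl2Tensor q hq.pow_eq_one lam₂ lam₁) J.toLinearMap)
    (hO : ∀ l : Fin p, J (Omega q p lam₁ lam₂ l) = Omega q p lam₂ lam₁ l) :
    J = swapEquiv hp hp1 hq h1 := by
  refine LinearEquiv.toLinearMap_injective (linearMap_ext_Xi hp hp1 hq h1 fun l hl k => ?_)
  rw [hJ.pow, (swapEquiv_isModuleHom hp hp1 hq h1).pow, Xi_eq hl, map_smul, map_smul]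
  have h2 := (hO ⟨l, hl⟩).trans (swapEquiv_Omega hp hp1 hq h1 ⟨l, hl⟩).symm
  simp only [LinearEquiv.coe_coe, map_smul]
  rw [show J (Omega q p lam₁ lam₂ l) = swapEquiv hp hp1 hq h1 (Omega q p lam₁ lam₂ l) from h2]

variable (x y : ℂˣ)

/-- `Ř` multiplies the `l`-th summand by `c_l`. -/
theorem Rcheck_sumMap (hdec : DirectSum.IsInternal fun l : Fin p =>
    cyclic (sl2Tensor q hq.pow_eq_one lam₁ lam₂) (Omega q p lam₁ lam₂ l))
    (z : Fin p → Fin p → ℂ) :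
    Rcheck q lam₁ lam₂ x y (swapEquiv hp hp1 hq h1) (summandProj hdec)
      (sumMap hq.pow_eq_one lam₁ lam₂ z) =
    sumMap hq.pow_eq_one lam₂ lam₁ fun l => cCoeff q lam₁ lam₂ x y l • z l := by
  have hP : ∀ l, summandProj hdec l (sumMap hq.pow_eq_one lam₁ lam₂ z) =
      hwMap (sl2Tensor q hq.pow_eq_one lam₁ lam₂) p (Omega q p lam₁ lam₂ l) (z l) := by
    intro l
    rw [sumMap_apply, map_sum, Finset.sum_eq_single l]
    · exact summandProj_of_mem hdec (hwMap_Omega_mem hp hp1 hq h1 l (z l))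
    · intro m _ hm
      exact summandProj_of_mem_ne hdec hm (hwMap_Omega_mem hp hp1 hq h1 m (z m))
    · simp
  simp only [Rcheck, LinearMap.sum_apply, LinearMap.smul_apply, LinearMap.comp_apply, hP,
    LinearEquiv.coe_coe, swapEquiv_hwMap]
  rw [sumMap_apply]
  simp only [map_smul]

omit hp hp1 hq in
theorem cDen_ne_zero (h3 : Condition3 q p lam₁ lam₂ x y) {j : ℕ} (hj : 1 ≤ j) (hj' : j ≤ p - 1) :
    cDen q lam₁ lam₂ x y j ≠ 0 :=
  mul_ne_zero (h1.left (i := j) (by omega)) ((condition3_iff x y).1 h3 j hj hj')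

omit hp hp1 hq in
theorem cCoeff_ne_zero (h2 : Condition2 q p lam₁ lam₂ x y) (h3 : Condition3 q p lam₁ lam₂ x y)
    {l : ℕ} (hl : l < p) : cCoeff q lam₁ lam₂ x y l ≠ 0 := by
  refine Finset.prod_ne_zero_iff.2 fun j hj => ?_
  obtain ⟨hj1, hj2⟩ := Finset.mem_Icc.1 hj
  refine div_ne_zero ?_ (cDen_ne_zero h1 x y h3 hj1 (by omega))
  rw [cNum_eq]
  exact mul_ne_zero (h1.right (i := j) (by omega)) ((condition2_iff x y).1 h2 j hj1 (by omega))

theorem Rcheck_isModuleHom (hdec : DirectSum.IsInternal fun l : Fin p =>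
    cyclic (sl2Tensor q hq.pow_eq_one lam₁ lam₂) (Omega q p lam₁ lam₂ l))
    (h3 : Condition3 q p lam₁ lam₂ x y) :
    IsModuleHom (affTensor q hq.pow_eq_one lam₁ x lam₂ y)
      (affTensor q hq.pow_eq_one lam₂ y lam₁ x)
      (Rcheck q lam₁ lam₂ x y (swapEquiv hp hp1 hq h1) (summandProj hdec)) := by
  have hR := Rcheck_sumMap hp hp1 hq h1 x y hdec
  refine isModuleHom_affTensor hp hp1 hq h1 (isModuleHom_of_sumMap hp hp1 hq h1 hR)
    (τ := fun l => cCoeff q lam₁ lam₂ x y l * xiCoeff q lam₁ lam₂ l / xiCoeff q lam₂ lam₁ l)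
    ?_ ?_ ?_
  · intro l hl
    have h := hR (Pi.single ⟨l, hl⟩ (nb p 0))
    have e : (fun m : Fin p => cCoeff q lam₁ lam₂ x y m •
        (Pi.single ⟨l, hl⟩ (nb p 0) : Fin p → Fin p → ℂ) m) =
        Pi.single ⟨l, hl⟩ (cCoeff q lam₁ lam₂ x y l • nb p 0) := by
      ext1 m
      rcases eq_or_ne m ⟨l, hl⟩ with rfl | hm
      · simp
      · simp [Pi.single_eq_of_ne hm]
    rw [e, sumMap_single, sumMap_single, map_smul, hwMap_nb_zero (by omega),
      hwMap_nb_zero (by omega)] at h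
    have hx' := xiCoeff_ne_zero hp hp1 hq h1.symm hl
    simp only at h
    rw [Xi_eq hl, Xi_eq hl, map_smul, h, smul_smul, smul_smul, div_mul_cancel₀ _ hx', mul_comm]
  · intro l hl
    have hd := cDen_ne_zero h1 x y h3 (Nat.succ_pos l) (by omega)
    have hA := h1.left (i := l) (by omega)
    have hB := h1.right (i := l) (by omega)
    have hA' := h1.left (i := l + 1) (by omega)
    have hB' := h1.right (i := l + 1) (by omega)
    have hF := qfact_ne_zero hp hp1 hq (show l < p by omega)
    have hF' := qfact_ne_zero hp hp1 hq hl
    have hA1 := h1.left_add_one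
    have hB1 := h1.symm.left_add_one
    have hc : cCoeff q lam₁ lam₂ x y (l + 1) = cCoeff q lam₁ lam₂ x y l *
        (cNum q lam₁ lam₂ x y (l + 1) / cDen q lam₁ lam₂ x y (l + 1)) := by
      rw [cCoeff, Finset.prod_Icc_succ_top (by omega), cCoeff]
    rw [cDen_eq] at hd
    have hs := right_ne_zero_of_mul hd
    simp only [hc, cNum_eq, cDen_eq, xiCoeff]
    field_simp
  · exact fun l hl => (condition3_iff x y).1 h3 (l + 1) (by omega) (by omega)

end scalars

end QuantumAffine

theorem theorem4p1 (p : ℕ) (hp : Odd p) (hp1 : 1 < p) (q : ℂˣ) (hq : IsPrimitiveRoot q p)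
    (lam₁ lam₂ : ℂ) (x y : ℂˣ) (h1 : Condition1 q p lam₁ lam₂) :
    (AreIsomorphic (affTensor q hq.pow_eq_one lam₁ x lam₂ y)
        (affTensor q hq.pow_eq_one lam₂ y lam₁ x) ↔
      Condition2 q p lam₁ lam₂ x y ∧ Condition3 q p lam₁ lam₂ x y) ∧
    ∃ hdec : DirectSum.IsInternal fun l : Fin p =>
        cyclic (sl2Tensor q hq.pow_eq_one lam₁ lam₂) (Omega q p lam₁ lam₂ l),
      (∀ l : Fin p, AreIsomorphic (V q hq.pow_eq_one (lam₁ + lam₂ - 2 * ((l : ℕ) : ℂ)))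
        (cyclicRep (sl2Tensor q hq.pow_eq_one lam₁ lam₂) (Omega q p lam₁ lam₂ l))) ∧
      ∃ I : VV p ≃ₗ[ℂ] VV p,
        (IsModuleHom (sl2Tensor q hq.pow_eq_one lam₁ lam₂)
            (sl2Tensor q hq.pow_eq_one lam₂ lam₁) I.toLinearMap ∧
          ∀ l : Fin p, I (Omega q p lam₁ lam₂ l) = Omega q p lam₂ lam₁ l) ∧
        (∀ J : VV p ≃ₗ[ℂ] VV p,
          IsModuleHom (sl2Tensor q hq.pow_eq_one lam₁ lam₂)
            (sl2Tensor q hq.pow_eq_one lam₂ lam₁) J.toLinearMap →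
          (∀ l : Fin p, J (Omega q p lam₁ lam₂ l) = Omega q p lam₂ lam₁ l) → J = I) ∧
        (Condition2 q p lam₁ lam₂ x y → Condition3 q p lam₁ lam₂ x y →
          (∀ j : ℕ, 1 ≤ j → j ≤ p - 1 → cDen q lam₁ lam₂ x y j ≠ 0) ∧
          Function.Bijective (Rcheck q lam₁ lam₂ x y I (summandProj hdec)) ∧
          IsModuleHom (affTensor q hq.pow_eq_one lam₁ x lam₂ y)
            (affTensor q hq.pow_eq_one lam₂ y lam₁ x)
            (Rcheck q lam₁ lam₂ x y I (summandProj hdec))) := by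
  have hdec := isInternal_cyclic_Omega hp hp1 hq h1
  have hbij : Condition2 q p lam₁ lam₂ x y → Condition3 q p lam₁ lam₂ x y → Function.Bijective
      (Rcheck q lam₁ lam₂ x y (swapEquiv hp hp1 hq h1) (summandProj hdec)) := fun h2 h3 =>
    bijective_of_sumMap hp hp1 hq h1 (fun l => cCoeff_ne_zero h1 x y h2 h3 l.isLt)
      (Rcheck_sumMap hp hp1 hq h1 x y hdec)
  refine ⟨⟨conditions_of_areIsomorphic hp hp1 hq h1, fun h =>
      ⟨LinearEquiv.ofBijective _ (hbij h.1 h.2), Rcheck_isModuleHom hp hp1 hq h1 x y hdec h.2⟩⟩,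
    hdec, fun l => areIsomorphic_cyclicRep hq.pow_eq_one (by omega)
      (hwMap_Omega_isModuleHom hp hp1 hq h1 l) (hwMap_Omega_injective hp hp1 hq h1 l),
    swapEquiv hp hp1 hq h1,
    ⟨swapEquiv_isModuleHom hp hp1 hq h1, swapEquiv_Omega hp hp1 hq h1⟩,
    fun J hJ hO => eq_swapEquiv hp hp1 hq h1 hJ hO, fun h2 h3 =>
      ⟨fun j hj hj' => cDen_ne_zero h1 x y h3 hj hj', hbij h2 h3,
        Rcheck_isModuleHom hp hp1 hq h1 x y hdec h3⟩⟩
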